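/- **Setting.** Let $f:\mathbb R^2\to[0,\infty)$ be a probability density. For a twice differentiable $g:\mathbb R^2\to\mathbb R$ write $d^2g=(g^{(2,0)},g^{(1,1)},g^{(0,2)})$ and $$\lambda_2^g=J(d^2g),\quad V^g=G(d^2g),\quad J(u,v,w)=\tfrac12\big(u+w-\sqrt{(u-w)^2+4v^2}\big),$$ $$G(u,v,w)=\begin{pmatrix}2u-2w+2v-2\sqrt{(w-u)^2+4v^2}\\ w-u+4v-\sqrt{(w-u)^2+4v^2}\end{pmatrix},$$ so that $\lambda_2^g$ is the smaller eigenvalue of the Hessian $\nabla^2 g$ and $\nabla^2g\,V^g=\lambda_2^gV^g$. Let $\mathfrak X^g_{x_0}$ be the integral curve $\frac{d}{dt}\mathfrak X^g_{x_0}(t)=V^g(\mathfrak X^g_{x_0}(t))$, $\mathfrak X^g_{x_0}(0)=x_0$. A filament point of $g$ is a point $x$ with $\langle\nabla g(x),V^g(x)\rangle=0$ and $\lambda^g_2(x)<0$. Let $\Theta^g_{x_0}$ be the set of all $t\in\mathbb R$ for which $\mathfrak X^g_{x_0}(t)$ is a filament point of $g$, and let $\theta^g_{x_0}$ be a minimizer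 of $|t|$ over $t\in\Theta^g_{x_0}$ (one of the minimizers if there are several, and $0$ if there is none). Write $V,\lambda_2,\mathfrak X,\theta$ for $g=f$ and $\hat V,\hat\lambda_2,\hat{\mathfrak X},\hat\Theta,\hat\theta$ for $g=\hat f$, where $$\hat f(x)=\frac1{nh_n^2}\sum_{i=1}^nK\Big(\frac{x-X_i}{h_n}\Big)$$ and $X_1,X_2,\dots$ are independent with density $f$. For $\mathcal L\subset\mathbb R^2$ and $a^*>0$ let $\mathcal G=\{\mathfrak X_y(t):y\in\mathcal L,\ |t|\le a^*\}$. **Assumptions.** * (F1) $f$ is four times continuously differentiable, and its partial derivatives of orders one to four are bounded. * (F2) $\mathcal H\subset\mathbb R^2$ is compact, $f>0$ on the $\epsilon_0$-enlargement of $\mathcal H$ for some $\epsilon_0>0$, and $\nabla^2f(x)$ has two distinct eigenvalues for every $x\in\mathcal H$. * (F3) $\mathcal L\subset\mathcal H$ is a compact set of filament points of $f$, $\mathcal G\subset\mathcal H$, for every $x_0\in\mathcal G$ the minimizer $\theta_{x_0}$ exists and is unique, and $\mathcal L=\{\mathfrak X_{x_0}(\theta_{x_0}):x_0\in\mathcal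 G\}$. * (F4) There is $\gamma>0$ with $\big\|\frac1{u-s}\int_s^uV(\mathfrak X_{x_0}(r))\,dr\big\|\ge\gamma$ for all $x_0\in\mathcal L$ and $-a^*\le s<u\le a^*$. * (F5) $\big\langle\nabla\langle\nabla f,V\rangle(x),V(x)\big\rangle\ne0$ for all $x\in\mathcal L$. * (F6) There is no point $x$ with $\lambda_2(x)=0$ and $\langle\nabla f(x),V(x)\rangle=0$ in $\mathcal H$, nor among the points $\mathfrak X_{x_0}(t)$, $x_0\in\mathcal G$, $|t|\le|\theta_{x_0}|$, that are passed when the integral curves are followed in both directions up to time $|\theta_{x_0}|$. (If these pieces of curves stay in $\mathcal H$, this is a condition on $\mathcal H$ only.) * (K1) $K$ is a probability density with $K(-x)=K(x)$ whose support is the closed unit ball; $K$ is four times differentiable, its partial derivatives of orders one to four are bounded, and $\int K(x)xx^T\,dx=\mu_2I_{2\times2}$ for some $\mu_2<\infty$. * (K2) The matrix $\int d^2K(x)\,d^2K(x)^T\,dx$ is finite. * (H1) $h_n>0$, $h_n\to0$, $nh_n^8/(\log n)^3\to\infty$, and $nh_n^9\to\beta$ for some $\beta\ge0$. **Proposition.**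 Under these assumptions $$\sup_{x_0\in\mathcal G}|\hat\theta_{x_0}-\theta_{x_0}|=O_p\Big(\sqrt{\tfrac{\log n}{nh_n^6}}\Big)\qquad(n\to\infty).$$ If, in addition, $\nabla f(\mathfrak X_{x_0}(\theta_{x_0}))=0$ for all $x_0\in\mathcal G$, then $$\sup_{x_0\in\mathcal G}|\hat\theta_{x_0}-\theta_{x_0}|=O_p\Big(\sqrt{\tfrac{\log n}{nh_n^5}}\Big).$$ Moreover, with probability tending to one, for every $x_0\in\mathcal G$ the set $\hat\Theta_{x_0}$ is non-empty and has exactly one element of minimal absolute value. (Probabilities of sets that are not measurable are read as outer probabilities.) -/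

import Mathlib

open MeasureTheory ProbabilityTheory Filter Topology
open scoped Gradient ENNReal

noncomputable section

/-- The Euclidean plane. -/
abbrev Plane : Type := EuclideanSpace ℝ (Fin 2)

namespace Ridge

/-- The first order partial derivative `∂g/∂xᵢ`. -/
def partialDeriv (i : Fin 2) (g : Plane → ℝ) (x : Plane) : ℝ :=
  fderiv ℝ g x (EuclideanSpace.single i 1)

/-- The Hessian matrix of `g`. -/
def hessian (g : Plane → ℝ) (x : Plane) : Matrix (Fin 2) (Fin 2) ℝ :=
  Matrix.of fun i j => partialDeriv i (partialDeriv j g) x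

/-- The vector `d²g = (g^{(2,0)}, g^{(1,1)}, g^{(0,2)})` of second order partial derivatives. -/
def secondDerivs (g : Plane → ℝ) (x : Plane) : Fin 3 → ℝ :=
  ![hessian g x 0 0, hessian g x 0 1, hessian g x 1 1]

/-- All partial derivatives of `g` of the orders one to four are bounded. The value
`iteratedFDeriv ℝ k g x (e_{i₁}, …, e_{i_k})` is the partial derivative of order `k`
in the coordinates `i₁, …, i_k`. -/
def BoundedPartials (g : Plane → ℝ) : Prop :=
  ∀ k : ℕ, 1 ≤ k → k ≤ 4 → ∀ i : Fin k → Fin 2, ∃ C : ℝ, ∀ x : Plane,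
    |iteratedFDeriv ℝ k g x (fun j => EuclideanSpace.single (i j) (1 : ℝ))| ≤ C

/-- `g` is four times (Fréchet) differentiable. -/
def FourTimesDifferentiable (g : Plane → ℝ) : Prop :=
  ∀ k : ℕ, k < 4 → Differentiable ℝ (iteratedFDeriv ℝ k g)

/-- `g` is a probability density function with respect to Lebesgue measure. -/
def IsDensity (g : Plane → ℝ) : Prop :=
  (∀ x, 0 ≤ g x) ∧ Integrable g ∧ ∫ x, g x = 1

/-- The map `G(u, v, w)`, which sends the entries of a symmetric matrix with rows `(u, v)`, `(v, w)`
to a vector in the eigenspace of its smaller eigenvalue. -/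
def eigenvectorMap (p : Fin 3 → ℝ) : Plane :=
  !₂[2 * p 0 - 2 * p 2 + 2 * p 1 - 2 * √((p 2 - p 0) ^ 2 + 4 * p 1 ^ 2),
     p 2 - p 0 + 4 * p 1 - √((p 2 - p 0) ^ 2 + 4 * p 1 ^ 2)]

/-- The map `J(u, v, w)`: the smaller eigenvalue of the matrix with rows `(u, v)`, `(v, w)`. -/
def eigenvalueMap (p : Fin 3 → ℝ) : ℝ :=
  (p 0 + p 2 - √((p 0 - p 2) ^ 2 + 4 * p 1 ^ 2)) / 2

/-- The second eigenvector field `V = G(d²g)` of the Hessian of `g`. -/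
def V (g : Plane → ℝ) (x : Plane) : Plane := eigenvectorMap (secondDerivs g x)

/-- The second (smaller) eigenvalue `λ₂ = J(d²g)` of the Hessian of `g`. -/
def lambda2 (g : Plane → ℝ) (x : Plane) : ℝ := eigenvalueMap (secondDerivs g x)

/-- The directional derivative `⟨∇g(x), V(x)⟩`. -/
def slope (g : Plane → ℝ) (x : Plane) : ℝ := inner ℝ (∇ g x) (V g x)

/-- `x` is a filament point of `g`. -/
def IsFilamentPoint (g : Plane → ℝ) (x : Plane) : Prop := slope g x = 0 ∧ lambda2 g x < 0

/-- `γ` is the integral curve, defined for all times, of the vector field `W` with start `x₀`. -/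
def IsIntegralCurveFrom (W : Plane → Plane) (x₀ : Plane) (γ : ℝ → Plane) : Prop :=
  γ 0 = x₀ ∧ ∀ t, HasDerivAt γ (W (γ t)) t

open Classical in
/-- The integral curve of `W` with start `x₀` (for a globally Lipschitz field `W` it exists
and is unique; the constant curve is a default value where there is none). -/
def integralCurve (W : Plane → Plane) (x₀ : Plane) : ℝ → Plane :=
  if h : ∃ γ, IsIntegralCurveFrom W x₀ γ then h.choose else fun _ => x₀

/-- The integral curve `𝔛_{x₀}(t)` driven by the second eigenvector field of the Hessian of `g`. -/
def path (g : Plane → ℝ) (x₀ : Plane) (t : ℝ) : Plane := integralCurve (V g) x₀ t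

/-- The set `Θ_{x₀}` of the times at which the integral curve is at a filament point. -/
def filamentTimes (g : Plane → ℝ) (x₀ : Plane) : Set ℝ :=
  {t | IsFilamentPoint g (path g x₀ t)}

/-- `t` minimizes the absolute value over `S`. -/
def IsArgminAbs (S : Set ℝ) (t : ℝ) : Prop := t ∈ S ∧ ∀ s ∈ S, |t| ≤ |s|

open Classical in
/-- The parameter `θ_{x₀} = argmin {|t| : t ∈ Θ_{x₀}}`: one of the minimizers if there are any,
and `0` otherwise. -/
def theta (g : Plane → ℝ) (x₀ : Plane) : ℝ :=
  if h : ∃ t, IsArgminAbs (filamentTimes g x₀) t then h.choose else 0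

/-- The set `𝒢(L, a) = {𝔛_y(t) : y ∈ L, -a ≤ t ≤ a}` of starting points. -/
def startingSet (g : Plane → ℝ) (L : Set Plane) (a : ℝ) : Set Plane :=
  {x | ∃ y ∈ L, ∃ t ∈ Set.Icc (-a) a, x = path g y t}

/-- The set of all points that are passed when the paths with start in `𝒢(L, a)` are followed, in
both directions, up to the time `|θ_{x₀}|`. -/
def traversedSet (g : Plane → ℝ) (L : Set Plane) (a : ℝ) : Set Plane :=
  {x | ∃ x₀ ∈ startingSet g L a, ∃ t : ℝ, |t| ≤ |theta g x₀| ∧ x = path g x₀ t}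

/-- The kernel density estimator with kernel `K`, bandwidth `h` and the data `x 0, …, x (n - 1)`. -/
def kde (K : Plane → ℝ) (h : ℝ) (n : ℕ) (x : ℕ → Plane) (y : Plane) : ℝ :=
  1 / (n * h ^ 2) * ∑ i ∈ Finset.range n, K (h⁻¹ • (y - x i))

/-- `Y n = O_p(α n)`, for `[0, ∞]`-valued `Y n`. No measurability is required: the probability
of a set that is not measurable is its outer probability. -/
def IsBigOInProbability {Ω : Type*} [MeasurableSpace Ω] (P : Measure Ω)
    (Y : ℕ → Ω → ℝ≥0∞) (α : ℕ → ℝ) : Prop :=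
  ∀ ε : ℝ, 0 < ε → ∃ M : ℝ, 0 < M ∧ ∀ᶠ n in atTop,
    P {ω | ENNReal.ofReal (M * α n) < Y n ω} ≤ ENNReal.ofReal ε

/-- The uniform deviation `sup_{x₀ ∈ S} |θ_{x₀}(g₁) - θ_{x₀}(g₂)|`, possibly infinite. -/
def thetaDeviation (g₁ g₂ : Plane → ℝ) (S : Set Plane) : ℝ≥0∞ :=
  ⨆ x₀ ∈ S, ENNReal.ofReal |theta g₁ x₀ - theta g₂ x₀|

/-- The assumptions on the density `f`: four times continuously differentiable, with bounded
partial derivatives of the orders one to four. -/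
structure DensityAssumptions (f : Plane → ℝ) : Prop where
  density : IsDensity f
  smooth : ContDiff ℝ 4 f
  bounded : BoundedPartials f

/-- The assumptions on the set `H`. `Metric.thickening ε H` is the union of the open
balls of radius `ε` with centre in `H`. -/
structure RegionAssumptions (f : Plane → ℝ) (H : Set Plane) : Prop where
  compact : IsCompact H
  pos : ∃ ε : ℝ, 0 < ε ∧ ∀ x ∈ Metric.thickening ε H, 0 < f x
  distinct_eigenvalues : ∀ x ∈ H, ∃ μ ν : ℝ, μ ≠ ν ∧
    Module.End.HasEigenvalue (Matrix.toLin' (hessian f x)) μ ∧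
    Module.End.HasEigenvalue (Matrix.toLin' (hessian f x)) ν

/-- The assumptions on the filament `L` and on the constant `a`. -/
structure FilamentAssumptions (f : Plane → ℝ) (H L : Set Plane) (a : ℝ) : Prop where
  pos : 0 < a
  compact : IsCompact L
  subset : L ⊆ H
  filament : ∀ x ∈ L, IsFilamentPoint f x
  starting_subset : startingSet f L a ⊆ H
  unique : ∀ x₀ ∈ startingSet f L a, ∃! t, IsArgminAbs (filamentTimes f x₀) t
  eq_image : L = {x | ∃ x₀ ∈ startingSet f L a, x = path f x₀ (theta f x₀)}
  mean_speed : ∃ γ : ℝ, 0 < γ ∧ ∀ x₀ ∈ L, ∀ s u : ℝ, -a ≤ s → s < u → u ≤ a →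
    γ ≤ ‖(u - s)⁻¹ • ∫ r in s..u, V f (path f x₀ r)‖
  transversal : ∀ x ∈ L, inner ℝ (∇ (slope f) x) (V f x) ≠ 0
  nondegenerate : ∀ x ∈ H ∪ traversedSet f L a, ¬ (lambda2 f x = 0 ∧ slope f x = 0)

/-- The assumptions on the kernel `K`. -/
structure KernelAssumptions (K : Plane → ℝ) : Prop where
  density : IsDensity K
  symmetric : ∀ x, K (-x) = K x
  support : tsupport K = Metric.closedBall 0 1
  differentiable : FourTimesDifferentiable K
  bounded : BoundedPartials K
  second_moment : ∃ μ₂ : ℝ, ∀ i j : Fin 2, ∫ x : Plane, K x * (x i * x j) = if i = j then μ₂ else 0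
  roughness : ∀ i j : Fin 3, Integrable fun x => secondDerivs K x i * secondDerivs K x j

/-- The assumptions on the bandwidths `h n`. -/
structure BandwidthAssumptions (h : ℕ → ℝ) : Prop where
  pos : ∀ n, 0 < h n
  to_zero : Tendsto h atTop (𝓝 0)
  lower : Tendsto (fun n : ℕ => n * h n ^ 8 / Real.log n ^ 3) atTop atTop
  upper : ∃ β : ℝ, 0 ≤ β ∧ Tendsto (fun n : ℕ => n * h n ^ 9) atTop (𝓝 β)

/-- Under `P` the `X i` are independent and identically distributed with density `f`. -/
structure IsSample {Ω : Type*} [MeasurableSpace Ω] (P : Measure Ω) (X : ℕ → Ω → Plane)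
    (f : Plane → ℝ) : Prop where
  measurable : ∀ i, Measurable (X i)
  indep : iIndepFun X P
  law : ∀ i, P.map (X i) = volume.withDensity fun x => ENNReal.ofReal (f x)

end Ridge

end

noncomputable section

namespace Ridge

open Set Metric
open scoped NNReal

/-! The filament time of `g` at `x` is a zero of `t ↦ slope g (path g x t)`. For `f` this zero is
simple by `transversal`, and a simple zero moves under perturbation by at most a constant times the
value of the perturbed function at the old zero. So everything reduces to bounding `slope g (path g
x θ)` with `θ = theta f x`, for a function `g` whose partial derivatives of orders one to three are
close to those of `f`. The third order is needed because the derivative of the slope along a curve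
contains third derivatives. That no other filament point becomes the closest one follows from
`unique` and `nondegenerate` by compactness. The argument is local in the starting point
(`exists_isolated_zero`, `exists_local_zero`), and the compactness of the starting set makes its
constants uniform (`exists_theta_sub_le`).

Since `slope f` vanishes at `path f x θ`, the slope to be bounded consists of three contributions:
the error `δ₁` of the gradient, the error `δ₂` of the second derivatives multiplied by the size of
`∇ f`, and the displacement of the path (`abs_slope_sub_le`). By Gronwall's inequality the
displacement is controlled by the time integral of `V g - V f` along the path of `f`
(`IsIntegralCurveFrom.norm_sub_le`). In general this integral is only bounded by `δ₂`, which gives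
the exponent 6. Where `∇ f` vanishes on the filament, the second contribution disappears. In the
third, `V` is linearized in the second derivatives with remainder of order `δ₂ ^ 2`
(`norm_integral_V_sub_le`), and the linear part is an integral of second derivatives along a curve.
Integration over one dimension saves one power of `h`, hence the exponent 5. Both estimates are
collected in `deterministic_bound`.

On the probabilistic side, a Chernoff bound over a finite net controls centred empirical means
uniformly in a parameter (`tendsto_measure_uniform_deviation`). It is applied to the derivatives of
order `k ≤ 3`, with variance of order `h⁻¹ ^ (2 + 2 * k)`, and to the path integrals of second
derivatives. For the latter, `mean_speed` prevents a curve from spending more than a time of order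
`h` in a ball of radius `h`, so the variance has order `h⁻¹ ^ 5` (`tendsto_measure_path_integral`).
The bias is of order `h ^ 2` for derivatives of order at most two by the symmetry of the kernel, and
`n * h n ^ 9` being bounded makes it no larger than the rate with exponent 5. The two sides meet in
`exists_withHighProbability_theta`. -/

/-! ### Integral curves of Lipschitz vector fields -/

/-- A bounded Lipschitz vector field has a global integral curve through every point. -/
theorem exists_isIntegralCurveFrom {W : Plane → Plane} {K : ℝ≥0} {M : ℝ} (hW : LipschitzWith K W)
    (hM : ∀ x, ‖W x‖ ≤ M) (x₀ : Plane) : ∃ γ, IsIntegralCurveFrom W x₀ γ := by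
  have hM0 : 0 ≤ M := (norm_nonneg _).trans (hM x₀)
  have key : ∀ N : ℕ, ∃ α : ℝ → Plane, α 0 = x₀ ∧ ∀ t ∈ Icc (-(N + 1 : ℝ)) (N + 1),
      HasDerivWithinAt α (W (α t)) (Icc (-(N + 1 : ℝ)) (N + 1)) t := by
    intro N
    have h0 : (0 : ℝ) ∈ Icc (-(N + 1 : ℝ)) (N + 1) := ⟨by linarith, by positivity⟩
    have hpl : IsPicardLindelof (fun _ => W) (⟨0, h0⟩ : Icc (-(N + 1 : ℝ)) (N + 1)) x₀
        (Real.toNNReal (M * (N + 1))) 0 (Real.toNNReal M) K := by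
      refine IsPicardLindelof.of_time_independent (fun x _ => ?_) (hW.lipschitzOnWith) ?_
      · rw [Real.coe_toNNReal _ hM0]; exact hM x
      · rw [Real.coe_toNNReal _ hM0, Real.coe_toNNReal _ (by positivity)]
        simp
    exact hpl.exists_eq_forall_mem_Icc_hasDerivWithinAt₀
  choose α hα0 hα using key
  have hd : ∀ (N : ℕ) (t : ℝ), |t| < N + 1 → HasDerivAt (α N) (W (α N t)) t := by
    intro N t ht
    rw [abs_lt] at ht
    exact (hα N t ⟨ht.1.le, ht.2.le⟩).hasDerivAt (Icc_mem_nhds ht.1 ht.2)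
  have huniq : ∀ (N N' : ℕ) (t : ℝ), |t| < N + 1 → |t| < N' + 1 → α N t = α N' t := by
    intro N N' t h1 h2
    have hT := lt_min h1 h2
    obtain ⟨T, hT1, hT2⟩ := exists_between hT
    have hTN := hT2.trans_le (min_le_left _ _)
    have hTN' := hT2.trans_le (min_le_right _ _)
    have hlt : ∀ s ∈ Ioo (-T) T, |s| < T := fun s hs => abs_lt.mpr hs
    have := ODE_solution_unique_of_mem_Ioo (v := fun _ => W) (s := fun _ => univ) (K := K)
      (f := α N) (g := α N') (a := -T) (b := T) (t₀ := 0)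
      (fun _ _ => hW.lipschitzOnWith) ⟨by linarith [abs_nonneg t], by linarith [abs_nonneg t]⟩
      (fun s hs => ⟨hd N s ((hlt s hs).trans hTN), mem_univ _⟩)
      (fun s hs => ⟨hd N' s ((hlt s hs).trans hTN'), mem_univ _⟩) (by rw [hα0, hα0])
    exact this (abs_lt.mp hT1)
  -- The solutions on the growing intervals agree where they overlap, so at time `t` any interval
  -- containing `t` in its interior may be used.
  refine ⟨fun t => α ⌈|t|⌉₊ t, by simp [hα0], fun t => ?_⟩
  have hlt : ∀ s : ℝ, |s| < (⌈|s|⌉₊ : ℝ) + 1 := fun s => (Nat.le_ceil _).trans_lt (lt_add_one _)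
  have hev : (fun s => α ⌈|s|⌉₊ s) =ᶠ[𝓝 t] α ⌈|t|⌉₊ := by
    have : ∀ᶠ s : ℝ in 𝓝 t, |s| < (⌈|t|⌉₊ : ℝ) + 1 :=
      continuous_abs.continuousAt.eventually_lt continuousAt_const (hlt t)
    filter_upwards [this] with s hs
    exact huniq _ _ _ (hlt s) hs
  exact (hd _ t (hlt t)).congr_of_eventuallyEq hev

theorem IsIntegralCurveFrom.eq {W : Plane → Plane} {K : ℝ≥0} (hW : LipschitzWith K W)
    {x₀ : Plane} {γ γ' : ℝ → Plane} (h : IsIntegralCurveFrom W x₀ γ)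
    (h' : IsIntegralCurveFrom W x₀ γ') : γ = γ' :=
  ODE_solution_unique_univ (v := fun _ => W) (s := fun _ => univ) (K := K) (t₀ := 0)
    (fun _ => hW.lipschitzOnWith) (fun t => ⟨h.2 t, mem_univ _⟩) (fun t => ⟨h'.2 t, mem_univ _⟩)
    (by rw [h.1, h'.1])

theorem IsIntegralCurveFrom.comp_neg {W : Plane → Plane} {x₀ : Plane} {γ : ℝ → Plane}
    (h : IsIntegralCurveFrom W x₀ γ) :
    IsIntegralCurveFrom (fun x => -W x) x₀ (fun t => γ (-t)) := by
  refine ⟨by simp [h.1], fun t => ?_⟩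
  have := (h.2 (-t)).scomp t (hasDerivAt_neg t)
  simpa [Function.comp_def] using this

theorem IsIntegralCurveFrom.comp_add {W : Plane → Plane} {x₀ : Plane} {γ : ℝ → Plane}
    (h : IsIntegralCurveFrom W x₀ γ) (s : ℝ) :
    IsIntegralCurveFrom W (γ s) (fun t => γ (s + t)) := by
  refine ⟨by simp, fun t => ?_⟩
  exact HasDerivAt.comp_const_add s t (h.2 (s + t))

theorem IsIntegralCurveFrom.continuous {W : Plane → Plane} {x₀ : Plane} {γ : ℝ → Plane}
    (h : IsIntegralCurveFrom W x₀ γ) : Continuous γ :=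
  continuous_iff_continuousAt.mpr fun t => (h.2 t).continuousAt

/-- Comparison of the integral curves of two vector fields: the difference is controlled by the
integrals of the difference of the fields along one of the curves. -/
theorem IsIntegralCurveFrom.norm_sub_le_of_nonneg {W W' : Plane → Plane} {x₀ x₀' : Plane}
    {γ γ' : ℝ → Plane} {B : Set Plane} {Λ : ℝ≥0} {A T : ℝ} (hγ : IsIntegralCurveFrom W x₀ γ)
    (hγ' : IsIntegralCurveFrom W' x₀' γ') (hc : Continuous fun t => W' (γ t) - W (γ t))
    (hL : LipschitzOnWith Λ W' B) (hB : ∀ t ∈ Icc 0 T, γ t ∈ B ∧ γ' t ∈ B)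
    (hA : ∀ r ∈ Icc 0 T, ‖∫ s in (0 : ℝ)..r, (W' (γ s) - W (γ s))‖ ≤ A) (hT : 0 ≤ T) :
    ‖γ' T - γ T‖ ≤ (‖x₀' - x₀‖ + A) * Real.exp (Λ * T) := by
  have hA0 : 0 ≤ A := (norm_nonneg _).trans (hA 0 ⟨le_rfl, hT⟩)
  -- Subtracting the integrated field difference leaves a function with derivative `W' (γ' t) - W'
  -- (γ t)`. Gronwall's inequality applied to it therefore sees the field difference only through
  -- its integrals, where cancellation along the curve is still visible.
  set D : ℝ → Plane := fun t => γ' t - γ t - ∫ s in (0 : ℝ)..t, (W' (γ s) - W (γ s)) with hD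
  have hDd : ∀ t, HasDerivAt D (W' (γ' t) - W' (γ t)) t := by
    intro t
    have h3 : HasDerivAt (fun t => ∫ s in (0 : ℝ)..t, (W' (γ s) - W (γ s)))
        (W' (γ t) - W (γ t)) t := intervalIntegral.integral_hasDerivAt_right
          (hc.intervalIntegrable _ _) (hc.stronglyMeasurableAtFilter _ _) hc.continuousAt
    convert! ((hγ'.2 t).sub (hγ.2 t)).sub h3 using 1
    abel
  have hbd : ∀ t ∈ Icc 0 T, ‖γ' t - γ t‖ ≤ ‖D t‖ + A := by
    intro t ht
    have : γ' t - γ t = D t + ∫ s in (0 : ℝ)..t, (W' (γ s) - W (γ s)) := by simp [hD]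
    rw [this]
    exact (norm_add_le _ _).trans (by gcongr; exact hA t ht)
  have hG := norm_le_gronwallBound_of_norm_deriv_right_le (f := D)
    (f' := fun t => W' (γ' t) - W' (γ t)) (δ := ‖x₀' - x₀‖) (K := Λ) (ε := Λ * A) (a := 0) (b := T)
    (fun t _ => (hDd t).continuousAt.continuousWithinAt)
    (fun t _ => (hDd t).hasDerivWithinAt) (by simp [hD, hγ.1, hγ'.1])
    (fun t ht => by
      have ht' : t ∈ Icc 0 T := ⟨ht.1, ht.2.le⟩
      have h1 := hL.dist_le_mul _ (hB t ht').2 _ (hB t ht').1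
      rw [dist_eq_norm, dist_eq_norm] at h1
      calc _ ≤ Λ * ‖γ' t - γ t‖ := h1
        _ ≤ Λ * (‖D t‖ + A) := by gcongr; exact hbd t ht'
        _ = _ := by ring) T ⟨hT, le_rfl⟩
  have hT' := hbd T ⟨hT, le_rfl⟩
  rw [sub_zero] at hG
  rcases eq_or_ne (Λ : ℝ) 0 with h0 | h0
  · rw [h0, gronwallBound_K0] at hG
    rw [h0]
    simp only [zero_mul, add_zero, Real.exp_zero, mul_one] at hG ⊢
    linarith
  · rw [gronwallBound_of_K_ne_0 h0, mul_div_cancel_left₀ _ h0] at hG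
    nlinarith

theorem IsIntegralCurveFrom.norm_sub_le {W W' : Plane → Plane} {x₀ x₀' : Plane}
    {γ γ' : ℝ → Plane} {B : Set Plane} {Λ : ℝ≥0} {A T : ℝ} (hγ : IsIntegralCurveFrom W x₀ γ)
    (hγ' : IsIntegralCurveFrom W' x₀' γ') (hc : Continuous fun t => W' (γ t) - W (γ t))
    (hL : LipschitzOnWith Λ W' B) (hB : ∀ t ∈ uIcc 0 T, γ t ∈ B ∧ γ' t ∈ B)
    (hA : ∀ r ∈ uIcc 0 T, ‖∫ s in (0 : ℝ)..r, (W' (γ s) - W (γ s))‖ ≤ A) :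
    ‖γ' T - γ T‖ ≤ (‖x₀' - x₀‖ + A) * Real.exp (Λ * |T|) := by
  rcases le_total 0 T with hT | hT
  · rw [uIcc_of_le hT] at hB hA
    rw [abs_of_nonneg hT]
    exact hγ.norm_sub_le_of_nonneg hγ' hc hL hB hA hT
  · rw [uIcc_of_ge hT] at hB hA
    rw [abs_of_nonpos hT]
    have hmem : ∀ t ∈ Icc 0 (-T), -t ∈ Icc T 0 :=
      fun t ht => ⟨by linarith [ht.2], by linarith [ht.1]⟩
    have := hγ.comp_neg.norm_sub_le_of_nonneg (T := -T) (A := A) hγ'.comp_neg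
      (by convert (hc.comp continuous_neg).neg using 2; simp; abel) (Λ := Λ)
      (by simpa [Pi.neg_def] using (lipschitzOnWith_neg_iff (f := W')).mpr hL)
      (fun t ht => hB _ (hmem t ht))
      (fun r hr => by
        have h1 := hA _ (hmem r hr)
        have h2 : ∫ s in (0 : ℝ)..r, (-W' (γ (-s)) - -W (γ (-s))) =
            ∫ s in (0 : ℝ)..(-r), (W' (γ s) - W (γ s)) := by
          have h3 := intervalIntegral.integral_comp_neg (a := 0) (b := r)
            (fun u => W' (γ u) - W (γ u))
          rw [neg_zero] at h3
          rw [intervalIntegral.integral_symm (-r) 0, ← h3, ← intervalIntegral.integral_neg]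
          congr 1; ext1 s; abel
        rw [h2]; exact h1) (by linarith)
    simpa using this

/-- An integral curve of a field that is small on a ball does not leave the ball too early. -/
theorem IsIntegralCurveFrom.norm_sub_start_le_of_nonneg {W : Plane → Plane} {x₀ : Plane}
    {γ : ℝ → Plane} (hγ : IsIntegralCurveFrom W x₀ γ) {M T : ℝ}
    (hW : ∀ x, ‖x - x₀‖ ≤ M * T → ‖W x‖ < M) {t : ℝ} (ht : t ∈ Icc 0 T) (hM : 0 ≤ M) :
    ‖γ t - x₀‖ ≤ M * t := by
  refine image_norm_le_of_norm_deriv_right_lt_deriv_boundary (a := 0) (b := T)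
    (f := fun t => γ t - x₀) (f' := fun t => W (γ t)) (B := fun t => M * t) (B' := fun _ => M)
    (fun s _ => ((hγ.2 s).sub_const x₀).continuousAt.continuousWithinAt)
    (fun s _ => ((hγ.2 s).sub_const x₀).hasDerivWithinAt) (by simp [hγ.1])
    (fun s => by simpa using (hasDerivAt_id s).const_mul M) (fun s hs h => hW _ ?_) ht
  rw [h]
  exact mul_le_mul_of_nonneg_left hs.2.le hM

theorem IsIntegralCurveFrom.norm_sub_start_le {W : Plane → Plane} {x₀ : Plane}
    {γ : ℝ → Plane} (hγ : IsIntegralCurveFrom W x₀ γ) {M T : ℝ}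
    (hW : ∀ x, ‖x - x₀‖ ≤ M * T → ‖W x‖ < M) {t : ℝ} (ht : |t| ≤ T) (hM : 0 ≤ M) :
    ‖γ t - x₀‖ ≤ M * |t| := by
  rcases le_total 0 t with h | h
  · rw [abs_of_nonneg h] at ht ⊢
    exact hγ.norm_sub_start_le_of_nonneg hW ⟨h, ht⟩ hM
  · rw [abs_of_nonpos h] at ht ⊢
    simpa using hγ.comp_neg.norm_sub_start_le_of_nonneg (M := M) (T := T)
      (by simpa using hW) (t := -t) ⟨by linarith, ht⟩ hM

/-! ### Iterated partial derivatives -/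

/-- The iterated partial derivative `∂_{i₁} ⋯ ∂_{i_k} g` for `l = [i₁, …, i_k]`. -/
def pd : List (Fin 2) → (Plane → ℝ) → Plane → ℝ
  | [], g => g
  | i :: l, g => partialDeriv i (pd l g)

theorem plane_eq (v : Plane) :
    v = v 0 • EuclideanSpace.single 0 (1 : ℝ) + v 1 • EuclideanSpace.single 1 (1 : ℝ) := by
  ext i; fin_cases i <;> simp

theorem abs_apply_le_norm (v : Plane) (i : Fin 2) : |v i| ≤ ‖v‖ := by
  simpa using EuclideanSpace.norm_eq v ▸ PiLp.norm_apply_le v i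

theorem fderiv_eq_partialDeriv (g : Plane → ℝ) (x v : Plane) :
    fderiv ℝ g x v = v 0 * partialDeriv 0 g x + v 1 * partialDeriv 1 g x := by
  conv_lhs => rw [plane_eq v]
  simp [partialDeriv]

theorem norm_fderiv_le_partialDeriv (g : Plane → ℝ) (x : Plane) :
    ‖fderiv ℝ g x‖ ≤ |partialDeriv 0 g x| + |partialDeriv 1 g x| := by
  refine ContinuousLinearMap.opNorm_le_bound _ (by positivity) fun v => ?_
  rw [fderiv_eq_partialDeriv, Real.norm_eq_abs]
  calc _ ≤ |v 0 * partialDeriv 0 g x| + |v 1 * partialDeriv 1 g x| := abs_add_le _ _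
    _ = |v 0| * |partialDeriv 0 g x| + |v 1| * |partialDeriv 1 g x| := by rw [abs_mul, abs_mul]
    _ ≤ ‖v‖ * |partialDeriv 0 g x| + ‖v‖ * |partialDeriv 1 g x| := by
      gcongr <;> exact abs_apply_le_norm _ _
    _ = _ := by ring

theorem abs_partialDeriv_le (i : Fin 2) (g : Plane → ℝ) (x : Plane) :
    |partialDeriv i g x| ≤ ‖fderiv ℝ g x‖ := by
  have := (fderiv ℝ g x).le_opNorm (EuclideanSpace.single i 1)
  simpa [partialDeriv] using this

theorem slope_eq (g : Plane → ℝ) (x : Plane) :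
    slope g x = V g x 0 * partialDeriv 0 g x + V g x 1 * partialDeriv 1 g x := by
  rw [← fderiv_eq_partialDeriv, slope, ← toDual_gradient]
  simp

theorem contDiff_partialDeriv {n : ℕ} {g : Plane → ℝ} (hg : ContDiff ℝ (n + 1 : ℕ) g)
    (i : Fin 2) : ContDiff ℝ n (partialDeriv i g) := by
  have : ContDiff ℝ n (fderiv ℝ g) := hg.fderiv_right (by norm_cast)
  exact this.clm_apply contDiff_const

theorem contDiff_pd {g : Plane → ℝ} (l : List (Fin 2)) {n : ℕ}
    (hg : ContDiff ℝ (n + l.length : ℕ) g) : ContDiff ℝ n (pd l g) := by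
  induction l generalizing n with
  | nil => simpa [pd] using hg
  | cons i l ih =>
    refine contDiff_partialDeriv (ih ?_) i
    convert hg using 2
    simp; ring

/-- Differentiability and Lipschitz continuity of all partial derivatives up to order three. -/
structure Tame (g : Plane → ℝ) : Prop where
  contDiff : ContDiff ℝ 3 g
  lipschitz : ∀ l : List (Fin 2), l.length ≤ 3 → ∃ K : ℝ≥0, LipschitzWith K (pd l g)

theorem Tame.differentiable {g : Plane → ℝ} (hg : Tame g) (l : List (Fin 2))
    (hl : l.length ≤ 2) : Differentiable ℝ (pd l g) := by
  have : ContDiff ℝ (1 : ℕ) (pd l g) :=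
    contDiff_pd l (hg.contDiff.of_le (by norm_cast; omega))
  exact this.differentiable (by simp)

theorem Tame.exists_lipschitzWith {g : Plane → ℝ} (hg : Tame g) :
    ∃ K : ℝ≥0, ∀ l : List (Fin 2), l.length ≤ 3 → LipschitzWith K (pd l g) := by
  choose! K hK using hg.lipschitz
  have hfin : {l : List (Fin 2) | l.length ≤ 3}.Finite := List.finite_length_le _ _
  exact ⟨hfin.toFinset.sup K, fun l hl =>
    (hK l hl).weaken (Finset.le_sup (hfin.mem_toFinset.mpr hl))⟩

theorem Tame.bounded {g : Plane → ℝ} (hg : Tame g) (l : List (Fin 2)) (h1 : 1 ≤ l.length)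
    (hl : l.length ≤ 4) : ∃ C : ℝ, ∀ x, |pd l g x| ≤ C := by
  cases l with
  | nil => simp at h1
  | cons i l =>
    obtain ⟨K, hK⟩ := hg.lipschitz l (by simp at hl; omega)
    exact ⟨K, fun x => (abs_partialDeriv_le _ _ _).trans (norm_fderiv_le_of_lipschitz ℝ hK)⟩

theorem lipschitzWith_of_partialDeriv_le {g : Plane → ℝ} (hg : Differentiable ℝ g)
    (hb : ∀ i, ∃ C : ℝ, ∀ x, |partialDeriv i g x| ≤ C) : ∃ K : ℝ≥0, LipschitzWith K g := by
  obtain ⟨C, hC⟩ := hb 0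
  obtain ⟨D, hD⟩ := hb 1
  refine ⟨Real.toNNReal (C + D), lipschitzWith_of_nnnorm_fderiv_le hg fun x => ?_⟩
  rw [← norm_toNNReal]
  exact Real.toNNReal_le_toNNReal
    ((norm_fderiv_le_partialDeriv g x).trans (add_le_add (hC x) (hD x)))

theorem pd_eq_iteratedFDeriv {g : Plane → ℝ} (l : List (Fin 2))
    (hg : ∀ k < l.length, Differentiable ℝ (iteratedFDeriv ℝ k g)) (x : Plane) :
    pd l g x = iteratedFDeriv ℝ l.length g x
      (fun j => EuclideanSpace.single (l.get j) (1 : ℝ)) := by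
  induction l generalizing x with
  | nil => simp [pd]
  | cons i l ih =>
    have h1 : pd l g = fun y => iteratedFDeriv ℝ l.length g y
        (fun j => EuclideanSpace.single (l.get j) (1 : ℝ)) :=
      funext fun y => ih (fun k hk => hg k (by simp; omega)) y
    have h2 := DifferentiableAt.iteratedFDeriv_succ_apply_left' (n := l.length) (x := x)
      (m := fun j : Fin (l.length + 1) => EuclideanSpace.single ((i :: l).get j) (1 : ℝ))
      (hg l.length (by simp) x)
    refine Eq.trans ?_ h2.symm
    change partialDeriv i (pd l g) x = _
    rw [h1]
    rfl

/-- The fourth derivatives need not be continuous. Their boundedness makes the third ones Lipschitz,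
which is all that is used of order four. -/
theorem tame_of_boundedPartials {g : Plane → ℝ} (hd : FourTimesDifferentiable g)
    (hb : BoundedPartials g) : Tame g := by
  refine ⟨?_, fun l hl => ?_⟩
  · have : ContDiff ℝ ((3 : ℕ) : ℕ∞) g := contDiff_of_differentiable_iteratedFDeriv
      fun m hm => hd m (by norm_cast at hm; omega)
    exact_mod_cast this
  · have h1 : pd l g = fun y => iteratedFDeriv ℝ l.length g y
        (fun j => EuclideanSpace.single (l.get j) (1 : ℝ)) :=
      funext fun y => pd_eq_iteratedFDeriv l (fun k hk => hd k (by omega)) y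
    refine lipschitzWith_of_partialDeriv_le ?_ fun i => ?_
    · rw [h1]
      intro x
      have := (hd l.length (by omega) x).hasFDerivAt
      exact (((ContinuousMultilinearMap.apply ℝ (fun _ : Fin l.length => Plane) ℝ
        (fun j => EuclideanSpace.single (l.get j) (1 : ℝ))).hasFDerivAt).comp x
          this).differentiableAt
    · obtain ⟨C, hC⟩ := hb (i :: l).length (by simp) (by simp; omega) (i :: l).get
      refine ⟨C, fun x => ?_⟩
      have := hC x
      rwa [← pd_eq_iteratedFDeriv (i :: l) (fun k hk => hd k (by simp at hk; omega))] at this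

theorem DensityAssumptions.tame {f : Plane → ℝ} (hf : DensityAssumptions f) : Tame f :=
  tame_of_boundedPartials
    (fun k hk => hf.smooth.differentiable_iteratedFDeriv (by exact_mod_cast hk)) hf.bounded

theorem KernelAssumptions.tame {K : Plane → ℝ} (hK : KernelAssumptions K) : Tame K :=
  tame_of_boundedPartials hK.differentiable hK.bounded

/-! ### The jet of a function -/

/-- The values of the partial derivatives of orders one, two and three. -/
abbrev Jet : Type := (Fin 2 → ℝ) × (Fin 2 → Fin 2 → ℝ) × (Fin 2 → Fin 2 → Fin 2 → ℝ)

/-- The slope, the eigenvalue and the derivative of the slope along the curve are functions of this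
finite-dimensional vector. Stability under perturbation of `g` thus becomes continuity on `Jet`. -/
def jet (g : Plane → ℝ) (x : Plane) : Jet :=
  (fun i => pd [i] g x, fun i j => pd [i, j] g x, fun i j k => pd [i, j, k] g x)

theorem norm_jet_sub_le {f g : Plane → ℝ} {x y : Plane} {η : ℝ}
    (h : ∀ l : List (Fin 2), 1 ≤ l.length → l.length ≤ 3 → |pd l g x - pd l f y| ≤ η) :
    ‖jet g x - jet f y‖ ≤ η := by
  have hη : 0 ≤ η := (abs_nonneg _).trans (h [0] (by simp) (by simp))
  simp only [jet, Prod.mk_sub_mk, norm_prod_le_iff, pi_norm_le_iff_of_nonneg hη, Pi.sub_apply]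
  exact ⟨fun i => h _ (by simp) (by simp), fun i j => h _ (by simp) (by simp),
    fun i j k => h _ (by simp) (by simp)⟩

theorem Tame.lipschitzWith_jet {g : Plane → ℝ} (hg : Tame g) :
    ∃ K : ℝ≥0, LipschitzWith K (jet g) := by
  obtain ⟨K, hK⟩ := hg.exists_lipschitzWith
  refine ⟨K, LipschitzWith.of_dist_le_mul fun x y => ?_⟩
  rw [dist_eq_norm]
  exact norm_jet_sub_le fun l _ hl => (hK l hl).dist_le_mul x y

/-- The second order part of a jet, as a vector. -/
def Jet.second (e : Jet) : Fin 3 → ℝ := ![e.2.1 0 0, e.2.1 0 1, e.2.1 1 1]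

theorem continuous_second : Continuous Jet.second := by
  unfold Jet.second
  fun_prop

theorem secondDerivs_eq (g : Plane → ℝ) (x : Plane) : secondDerivs g x = (jet g x).second := rfl

/-- The discriminant of the characteristic polynomial, the square of the eigenvalue gap. -/
def disc (p : Fin 3 → ℝ) : ℝ := (p 2 - p 0) ^ 2 + 4 * p 1 ^ 2

theorem disc_nonneg (p : Fin 3 → ℝ) : 0 ≤ disc p := by unfold disc; positivity

theorem continuous_disc : Continuous disc := by unfold disc; fun_prop

theorem eigenvectorMap_zero (p : Fin 3 → ℝ) :
    eigenvectorMap p 0 = 2 * p 0 - 2 * p 2 + 2 * p 1 - 2 * √(disc p) := rfl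

theorem eigenvectorMap_one (p : Fin 3 → ℝ) :
    eigenvectorMap p 1 = p 2 - p 0 + 4 * p 1 - √(disc p) := rfl

theorem continuous_eigenvectorMap : Continuous eigenvectorMap := by
  unfold eigenvectorMap
  fun_prop

theorem continuous_eigenvalueMap : Continuous eigenvalueMap := by
  unfold eigenvalueMap
  fun_prop

theorem plane_norm_le (v : Plane) : ‖v‖ ≤ |v 0| + |v 1| := by
  rw [EuclideanSpace.norm_eq, Fin.sum_univ_two, Real.norm_eq_abs, Real.norm_eq_abs,
    Real.sqrt_le_left (by positivity)]
  nlinarith [mul_nonneg (abs_nonneg (v 0)) (abs_nonneg (v 1))]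

/-- As a norm of a linear function of `p`, the root is globally Lipschitz, also where the two
eigenvalues coincide. This is why `V g` has integral curves for all times without any eigenvalue
gap. -/
theorem sqrt_disc_eq_norm (p : Fin 3 → ℝ) : √(disc p) = ‖(!₂[p 2 - p 0, 2 * p 1] : Plane)‖ := by
  rw [EuclideanSpace.norm_eq, Fin.sum_univ_two]
  congr 1
  simp only [disc, Real.norm_eq_abs, sq_abs]
  simp
  ring

theorem abs_sqrt_disc_sub_le (p q : Fin 3 → ℝ) : |√(disc p) - √(disc q)| ≤ 4 * ‖p - q‖ := by
  rw [sqrt_disc_eq_norm, sqrt_disc_eq_norm]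
  refine (abs_norm_sub_norm_le _ _).trans ((plane_norm_le _).trans ?_)
  have h0 := abs_le.mp (norm_le_pi_norm (p - q) 0)
  have h1 := abs_le.mp (norm_le_pi_norm (p - q) 1)
  have h2 := abs_le.mp (norm_le_pi_norm (p - q) 2)
  simp only [Pi.sub_apply] at h0 h1 h2
  have e1 : |p 2 - p 0 - (q 2 - q 0)| ≤ 2 * ‖p - q‖ := abs_le.mpr ⟨by linarith, by linarith⟩
  have e2 : |2 * p 1 - 2 * q 1| ≤ 2 * ‖p - q‖ := abs_le.mpr ⟨by linarith, by linarith⟩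
  simp
  linarith

theorem norm_eigenvectorMap_sub_le (p q : Fin 3 → ℝ) :
    ‖eigenvectorMap p - eigenvectorMap q‖ ≤ 24 * ‖p - q‖ := by
  refine (plane_norm_le _).trans ?_
  have h0 := abs_le.mp (norm_le_pi_norm (p - q) 0)
  have h1 := abs_le.mp (norm_le_pi_norm (p - q) 1)
  have h2 := abs_le.mp (norm_le_pi_norm (p - q) 2)
  have h3 := abs_le.mp (abs_sqrt_disc_sub_le p q)
  simp only [Pi.sub_apply] at h0 h1 h2
  simp only [PiLp.sub_apply, eigenvectorMap_zero, eigenvectorMap_one]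
  have e1 : |2 * p 0 - 2 * p 2 + 2 * p 1 - 2 * √(disc p) -
      (2 * q 0 - 2 * q 2 + 2 * q 1 - 2 * √(disc q))| ≤ 14 * ‖p - q‖ :=
    abs_le.mpr ⟨by linarith, by linarith⟩
  have e2 : |p 2 - p 0 + 4 * p 1 - √(disc p) - (q 2 - q 0 + 4 * q 1 - √(disc q))| ≤
      10 * ‖p - q‖ := abs_le.mpr ⟨by linarith, by linarith⟩
  linarith

theorem norm_second_sub_le (e e' : Jet) : ‖e.second - e'.second‖ ≤ ‖e - e'‖ := by
  rw [pi_norm_le_iff_of_nonneg (norm_nonneg _)]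
  have h : ∀ i j, ‖e.2.1 i j - e'.2.1 i j‖ ≤ ‖e - e'‖ := fun i j =>
    (norm_le_pi_norm ((e - e').2.1 i) j).trans ((norm_le_pi_norm (e - e').2.1 i).trans
      ((norm_fst_le (e - e').2).trans (norm_snd_le (e - e'))))
  intro i
  fin_cases i
  · exact h 0 0
  · exact h 0 1
  · exact h 1 1

theorem norm_V_sub_le (f g : Plane → ℝ) (x y : Plane) :
    ‖V g x - V f y‖ ≤ 24 * ‖jet g x - jet f y‖ := by
  rw [V, V, secondDerivs_eq, secondDerivs_eq]
  exact (norm_eigenvectorMap_sub_le _ _).trans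
    (mul_le_mul_of_nonneg_left (norm_second_sub_le _ _) (by norm_num))

theorem Tame.lipschitzWith_V {g : Plane → ℝ} (hg : Tame g) :
    ∃ K : ℝ≥0, LipschitzWith K (V g) := by
  obtain ⟨K, hK⟩ := hg.lipschitzWith_jet
  refine ⟨24 * K, LipschitzWith.of_dist_le_mul fun x y => ?_⟩
  rw [dist_eq_norm]
  refine (norm_V_sub_le _ _ _ _).trans ?_
  have := hK.dist_le_mul x y
  rw [dist_eq_norm] at this
  push_cast
  linarith

theorem Tame.norm_V_le {g : Plane → ℝ} (hg : Tame g) : ∃ M : ℝ, ∀ x, ‖V g x‖ ≤ M := by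
  have hb : ∀ i j, ∃ C : ℝ, ∀ x, |pd [i, j] g x| ≤ C := fun i j =>
    hg.bounded [i, j] (by simp) (by simp)
  choose C hC using hb
  refine ⟨24 * (C 0 0 + C 0 1 + C 1 1), fun x => ?_⟩
  have h0 : eigenvectorMap 0 = 0 := by
    ext i; fin_cases i <;> simp [eigenvectorMap]
  have hp : ∀ i j, 0 ≤ C i j := fun i j => (abs_nonneg _).trans (hC i j 0)
  have := norm_eigenvectorMap_sub_le (secondDerivs g x) 0
  rw [h0, sub_zero, sub_zero] at this
  refine this.trans ?_
  gcongr
  have n00 := hp 0 0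
  have n01 := hp 0 1
  have n11 := hp 1 1
  rw [pi_norm_le_iff_of_nonneg (by positivity)]
  intro i
  fin_cases i
  · exact (hC 0 0 x).trans (by linarith)
  · exact (hC 0 1 x).trans (by linarith)
  · exact (hC 1 1 x).trans (by linarith)

theorem Tame.path_isIntegralCurveFrom {g : Plane → ℝ} (hg : Tame g) (x₀ : Plane) :
    IsIntegralCurveFrom (V g) x₀ (path g x₀) := by
  obtain ⟨K, hK⟩ := hg.lipschitzWith_V
  obtain ⟨M, hM⟩ := hg.norm_V_le
  have h := exists_isIntegralCurveFrom hK hM x₀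
  have : path g x₀ = h.choose := by
    ext1 t; simp only [path, integralCurve, dif_pos h]
  rw [this]
  exact h.choose_spec

theorem Tame.path_path {g : Plane → ℝ} (hg : Tame g) (x₀ : Plane) (s t : ℝ) :
    path g (path g x₀ s) t = path g x₀ (s + t) := by
  obtain ⟨K, hK⟩ := hg.lipschitzWith_V
  exact congrFun ((hg.path_isIntegralCurveFrom _).eq hK
    ((hg.path_isIntegralCurveFrom x₀).comp_add s)) t

theorem Tame.path_zero {g : Plane → ℝ} (hg : Tame g) (x₀ : Plane) : path g x₀ 0 = x₀ :=
  (hg.path_isIntegralCurveFrom x₀).1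

theorem Tame.continuous_path {g : Plane → ℝ} (hg : Tame g) (x₀ : Plane) :
    Continuous (path g x₀) := (hg.path_isIntegralCurveFrom x₀).continuous

theorem Tame.continuous_jet {g : Plane → ℝ} (hg : Tame g) : Continuous (jet g) :=
  let ⟨_, hK⟩ := hg.lipschitzWith_jet
  hK.continuous

theorem Tame.continuous_V {g : Plane → ℝ} (hg : Tame g) : Continuous (V g) :=
  let ⟨_, hK⟩ := hg.lipschitzWith_V
  hK.continuous

/-! ### The slope along integral curves -/

/-- The vector associated with a jet. -/
def Jet.vec (e : Jet) : Plane := eigenvectorMap e.second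

/-- The slope as a function of the jet. -/
def Jet.slope (e : Jet) : ℝ := e.vec 0 * e.1 0 + e.vec 1 * e.1 1

/-- The derivative of the entry `(i, j)` of the Hessian in the direction of the eigenvector. -/
def Jet.dHess (e : Jet) (i j : Fin 2) : ℝ := e.vec 0 * e.2.2 0 i j + e.vec 1 * e.2.2 1 i j

/-- The derivative of the root of the discriminant in the direction of the eigenvector. -/
def Jet.dGap (e : Jet) : ℝ :=
  ((e.2.1 1 1 - e.2.1 0 0) * (e.dHess 1 1 - e.dHess 0 0) + 4 * e.2.1 0 1 * e.dHess 0 1) /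
    √(disc e.second)

/-- The derivative of the slope in the direction of the eigenvector. -/
def Jet.dSlope (e : Jet) : ℝ :=
  ((2 * e.dHess 0 0 - 2 * e.dHess 1 1 + 2 * e.dHess 0 1 - 2 * e.dGap) * e.1 0 +
    e.vec 0 * (e.vec 0 * e.2.1 0 0 + e.vec 1 * e.2.1 1 0)) +
  ((e.dHess 1 1 - e.dHess 0 0 + 4 * e.dHess 0 1 - e.dGap) * e.1 1 +
    e.vec 1 * (e.vec 0 * e.2.1 0 1 + e.vec 1 * e.2.1 1 1))

theorem V_eq_vec (g : Plane → ℝ) (x : Plane) : V g x = (jet g x).vec := rfl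

theorem slope_eq_jet (g : Plane → ℝ) (x : Plane) : slope g x = (jet g x).slope := slope_eq g x

theorem continuous_vec : Continuous Jet.vec := continuous_eigenvectorMap.comp continuous_second

theorem continuous_vec_apply (i : Fin 2) : Continuous fun e : Jet => e.vec i :=
  (EuclideanSpace.proj i : Plane →L[ℝ] ℝ).continuous.comp continuous_vec

theorem continuous_jetSlope : Continuous Jet.slope := by
  have h0 := continuous_vec_apply 0
  have h1 := continuous_vec_apply 1
  exact (h0.mul (by fun_prop)).add (h1.mul (by fun_prop))

theorem continuousAt_dSlope {e : Jet} (he : disc e.second ≠ 0) : ContinuousAt Jet.dSlope e := by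
  have v0 := continuous_vec_apply 0
  have v1 := continuous_vec_apply 1
  have h2 : ∀ i j, Continuous fun e : Jet => e.dHess i j := by
    exact fun i j => (v0.mul (by fun_prop)).add (v1.mul (by fun_prop))
  have h3 : ContinuousAt Jet.dGap e := by
    unfold Jet.dGap
    have h4 : ContinuousAt (fun e : Jet => √(disc e.second)) e :=
      (Real.continuous_sqrt.comp (continuous_disc.comp continuous_second)).continuousAt
    refine ContinuousAt.div ?_ h4
      (Real.sqrt_ne_zero'.mpr (lt_of_le_of_ne (disc_nonneg _) he.symm))
    refine ContinuousAt.add (ContinuousAt.mul (by fun_prop) ?_) (ContinuousAt.mul (by fun_prop) ?_)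
    · exact ((h2 1 1).sub (h2 0 0)).continuousAt
    · exact (h2 0 1).continuousAt
  have aux : ∀ {a b c d v w q₀ q₁ p₀ p₁ p₂ p₃ : Jet → ℝ}, ContinuousAt a e → ContinuousAt b e →
      ContinuousAt c e → ContinuousAt d e → ContinuousAt v e → ContinuousAt w e →
      ContinuousAt q₀ e → ContinuousAt q₁ e → ContinuousAt p₀ e → ContinuousAt p₁ e →
      ContinuousAt p₂ e → ContinuousAt p₃ e → ContinuousAt (fun e =>
        ((2 * a e - 2 * b e + 2 * c e - 2 * d e) * q₀ e + v e * (v e * p₀ e + w e * p₁ e)) +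
        ((b e - a e + 4 * c e - d e) * q₁ e + w e * (v e * p₂ e + w e * p₃ e))) e := by
    intros; fun_prop
  exact aux (h2 0 0).continuousAt (h2 1 1).continuousAt (h2 0 1).continuousAt h3 v0.continuousAt
    v1.continuousAt (by fun_prop) (by fun_prop) (by fun_prop) (by fun_prop) (by fun_prop)
    (by fun_prop)

theorem Tame.hasDerivAt_pd {g : Plane → ℝ} (hg : Tame g) {l : List (Fin 2)} (hl : l.length ≤ 2)
    {γ : ℝ → Plane} {v : Plane} {t : ℝ} (hγ : HasDerivAt γ v t) :
    HasDerivAt (fun s => pd l g (γ s)) (v 0 * pd (0 :: l) g (γ t) + v 1 * pd (1 :: l) g (γ t)) t := by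
  have := (hg.differentiable l hl (γ t)).hasFDerivAt.comp_hasDerivAt t hγ
  rwa [fderiv_eq_partialDeriv] at this

theorem Tame.hasDerivAt_slope {g : Plane → ℝ} (hg : Tame g) {γ : ℝ → Plane} {t : ℝ}
    (hγ : HasDerivAt γ (V g (γ t)) t) (hd : disc (secondDerivs g (γ t)) ≠ 0) :
    HasDerivAt (fun s => slope g (γ s)) (jet g (γ t)).dSlope t := by
  have q0 := hg.hasDerivAt_pd (l := [0]) (by simp) hγ
  have q1 := hg.hasDerivAt_pd (l := [1]) (by simp) hγ
  have p00 := hg.hasDerivAt_pd (l := [0, 0]) (by simp) hγ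
  have p01 := hg.hasDerivAt_pd (l := [0, 1]) (by simp) hγ
  have p11 := hg.hasDerivAt_pd (l := [1, 1]) (by simp) hγ
  have hgap : HasDerivAt (fun s => √(disc (secondDerivs g (γ s)))) (jet g (γ t)).dGap t := by
    have h1 := (((p11.sub p00).pow 2).add ((p01.pow 2).const_mul 4)).sqrt hd
    refine h1.congr_deriv (Eq.symm ?_)
    change (_ : ℝ) / √(disc (secondDerivs g (γ t))) = _ / (2 * √(disc (secondDerivs g (γ t))))
    rw [← mul_div_mul_left _ _ (two_ne_zero (α := ℝ))]
    congr 1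
    simp [Jet.dHess, V_eq_vec, jet]
    ring
  have hv0 := (((p00.const_mul 2).sub (p11.const_mul 2)).add (p01.const_mul 2)).sub
    (hgap.const_mul 2)
  have hv1 := ((p11.sub p00).add (p01.const_mul 4)).sub hgap
  have := (hv0.mul q0).add (hv1.mul q1)
  refine this.congr_of_eventuallyEq (Eventually.of_forall fun s => ?_)
  exact slope_eq g (γ s)

/-- Both sides are the derivative at time zero of the slope along the path from `x`. This turns the
transversality assumption into the non-vanishing of a continuous function of the jet. -/
theorem Tame.inner_gradient_slope {g : Plane → ℝ} (hg : Tame g) (x : Plane)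
    (hd : disc (secondDerivs g x) ≠ 0) :
    inner ℝ (∇ (slope g) x) (V g x) = (jet g x).dSlope := by
  have hdiff : DifferentiableAt ℝ (slope g) x := by
    have h : slope g = fun x => (2 * pd [0, 0] g x - 2 * pd [1, 1] g x + 2 * pd [0, 1] g x -
        2 * √((pd [1, 1] g x - pd [0, 0] g x) ^ 2 + 4 * pd [0, 1] g x ^ 2)) * pd [0] g x +
        (pd [1, 1] g x - pd [0, 0] g x + 4 * pd [0, 1] g x -
        √((pd [1, 1] g x - pd [0, 0] g x) ^ 2 + 4 * pd [0, 1] g x ^ 2)) * pd [1] g x :=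
      funext fun x => slope_eq g x
    have q0 := hg.differentiable [0] (by simp) x
    have q1 := hg.differentiable [1] (by simp) x
    have p00 := hg.differentiable [0, 0] (by simp) x
    have p01 := hg.differentiable [0, 1] (by simp) x
    have p11 := hg.differentiable [1, 1] (by simp) x
    have hd' : DifferentiableAt ℝ (fun x =>
        (pd [1, 1] g x - pd [0, 0] g x) ^ 2 + 4 * pd [0, 1] g x ^ 2) x := by fun_prop
    have hs := hd'.sqrt hd
    rw [h]
    fun_prop
  have h0 := hg.path_isIntegralCurveFrom x
  have h1 := h0.2 0
  rw [h0.1] at h1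
  have h2 := hg.hasDerivAt_slope (γ := path g x) (t := 0) (by rw [h0.1]; exact h1)
    (by rw [h0.1]; exact hd)
  rw [h0.1] at h2
  have h3 : HasDerivAt (fun s => slope g (path g x s)) (fderiv ℝ (slope g) x (V g x)) 0 := by
    have h4 := hdiff.hasFDerivAt
    rw [← h0.1] at h4
    simpa [h0.1, Function.comp_def] using h4.comp_hasDerivAt 0 (h0.2 0)
  rw [← h3.unique h2, ← toDual_gradient]
  simp

/-- A symmetric matrix with vanishing discriminant is scalar, and a scalar matrix has only one
eigenvalue. -/
theorem disc_ne_zero {g : Plane → ℝ} (hg : Tame g) {x : Plane}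
    (h : ∃ μ ν : ℝ, μ ≠ ν ∧ Module.End.HasEigenvalue (Matrix.toLin' (hessian g x)) μ ∧
      Module.End.HasEigenvalue (Matrix.toLin' (hessian g x)) ν) :
    disc (secondDerivs g x) ≠ 0 := by
  intro hd
  -- The discriminant involves only the entry `(0, 1)`, so the entry `(1, 0)` has to be identified
  -- with it.
  have hsymm : hessian g x 1 0 = hessian g x 0 1 := by
    have hc : ContDiffAt ℝ 3 g x := hg.contDiff.contDiffAt
    have h1 : IsSymmSndFDerivAt ℝ g x := hc.isSymmSndFDerivAt (by simp; norm_cast)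
    have h2 : Differentiable ℝ (fderiv ℝ g) :=
      (hg.contDiff.fderiv_right (m := 1) (by norm_num)).differentiable (by simp)
    have h3 : ∀ i j, hessian g x i j =
        fderiv ℝ (fderiv ℝ g) x (EuclideanSpace.single i 1) (EuclideanSpace.single j 1) := by
      intro i j
      change fderiv ℝ (fun y => fderiv ℝ g y (EuclideanSpace.single j 1)) x _ = _
      rw [fderiv_clm_apply (h2 x) (differentiableAt_const _)]
      simp
    rw [h3, h3]
    exact h1 _ _
  have h1 : hessian g x 0 1 = 0 := by
    have : (hessian g x 1 1 - hessian g x 0 0) ^ 2 + 4 * hessian g x 0 1 ^ 2 = 0 := hd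
    nlinarith [sq_nonneg (hessian g x 1 1 - hessian g x 0 0), sq_nonneg (hessian g x 0 1)]
  have h2 : hessian g x 1 1 = hessian g x 0 0 := by
    have : (hessian g x 1 1 - hessian g x 0 0) ^ 2 + 4 * hessian g x 0 1 ^ 2 = 0 := hd
    nlinarith [sq_nonneg (hessian g x 1 1 - hessian g x 0 0), sq_nonneg (hessian g x 0 1)]
  have key : ∀ μ, Module.End.HasEigenvalue (Matrix.toLin' (hessian g x)) μ →
      μ = hessian g x 0 0 := by
    intro μ hμ
    obtain ⟨v, hv⟩ := hμ.exists_hasEigenvector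
    have h3 := hv.apply_eq_smul
    have e0 := congrFun h3 0
    have e1 := congrFun h3 1
    simp [Matrix.toLin'_apply, Matrix.mulVec, dotProduct, Fin.sum_univ_two, h1, h2, hsymm] at e0 e1
    by_contra hne
    refine hv.2 (funext fun i => ?_)
    fin_cases i
    · rcases e0 with h | h
      · exact absurd h.symm hne
      · exact h
    · rcases e1 with h | h
      · exact absurd h.symm hne
      · exact h
  obtain ⟨μ, ν, hne, hμ, hν⟩ := h
  exact hne ((key μ hμ).trans (key ν hν).symm)

/-! ### Perturbation of the integral curves -/

/-- On the ball of radius `R` the partial derivatives of `f` and `g` of orders one to three differ by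
at most `η`. -/
def Close (R η : ℝ) (f g : Plane → ℝ) : Prop :=
  ∀ l : List (Fin 2), 1 ≤ l.length → l.length ≤ 3 → ∀ x : Plane, ‖x‖ ≤ R →
    |pd l g x - pd l f x| ≤ η

theorem Close.mono {R η η' : ℝ} {f g : Plane → ℝ} (h : Close R η f g) (hη : η ≤ η') :
    Close R η' f g := fun l h1 h3 x hx => (h l h1 h3 x hx).trans hη

theorem Close.refl {R η : ℝ} (hη : 0 ≤ η) (f : Plane → ℝ) : Close R η f f :=
  fun l _ _ x _ => by simpa using hη

theorem Close.norm_jet_sub_le {R η : ℝ} {f g : Plane → ℝ} (h : Close R η f g) {x : Plane}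
    (hx : ‖x‖ ≤ R) : ‖jet g x - jet f x‖ ≤ η :=
  Ridge.norm_jet_sub_le fun l h1 h3 => h l h1 h3 x hx

/-- The integral curves of functions close to `f` that start in the ball of radius `r` stay in the
ball of radius `R` up to time `T`, and they depend on the function and on the starting point in a
Lipschitz way. -/
structure PathBounds (f : Plane → ℝ) (r T R Λ : ℝ) : Prop where
  nonneg : 0 ≤ Λ
  norm_le : ∀ g, Tame g → Close R 1 f g → ∀ x : Plane, ‖x‖ ≤ r → ∀ t, |t| ≤ T → ‖path g x t‖ ≤ R
  norm_sub_le : ∀ g, Tame g → Close R 1 f g → ∀ x x' : Plane, ‖x‖ ≤ r → ‖x'‖ ≤ r →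
    ∀ t A, |t| ≤ T →
    (∀ s ∈ uIcc 0 t, ‖∫ u in (0 : ℝ)..s, (V g (path f x u) - V f (path f x u))‖ ≤ A) →
    ‖path g x' t - path f x t‖ ≤ Λ * (‖x' - x‖ + A)

/-- Gronwall's inequality needs one constant for all admissible `g`. On the convex ball the third
derivatives of `g` differ by at most 1 from those of `f`, which bounds the variation of the second
derivatives of `g`. -/
theorem Tame.lipschitzOnWith_V_of_close {f : Plane → ℝ} (hf : Tame f) (R : ℝ) :
    ∃ Λ : ℝ≥0, ∀ g, Tame g → Close R 1 f g → LipschitzOnWith Λ (V g) (closedBall 0 R) := by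
  obtain ⟨K, hK⟩ := hf.exists_lipschitzWith
  refine ⟨24 * (2 * (K + 1)), fun g hg hc => LipschitzOnWith.of_dist_le_mul fun x hx y hy => ?_⟩
  have hl : ∀ l : List (Fin 2), l.length = 2 → |pd l g x - pd l g y| ≤ 2 * (K + 1) * dist x y := by
    intro l hl
    have h1 : ∀ i : Fin 2, ∀ z ∈ closedBall (0 : Plane) R, |partialDeriv i (pd l g) z| ≤ K + 1 := by
      intro i z hz
      have e1 : |pd (i :: l) f z| ≤ K := (abs_partialDeriv_le _ _ _).trans
        (norm_fderiv_le_of_lipschitz ℝ (hK l (by omega)))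
      have e2 := hc (i :: l) (by simp) (by simp; omega) z (mem_closedBall_zero_iff.mp hz)
      have e3 := abs_sub_abs_le_abs_sub (pd (i :: l) g z) (pd (i :: l) f z)
      change |pd (i :: l) g z| ≤ _
      linarith
    have h2 := (convex_closedBall (0 : Plane) R).norm_image_sub_le_of_norm_fderiv_le
      (𝕜 := ℝ) (f := pd l g) (C := 2 * (K + 1)) (fun z _ => hg.differentiable l hl.le z)
      (fun z hz => (norm_fderiv_le_partialDeriv _ _).trans
        (by linarith [h1 0 z hz, h1 1 z hz])) hy hx
    rwa [Real.norm_eq_abs, ← dist_eq_norm] at h2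
  rw [dist_eq_norm]
  refine (norm_eigenvectorMap_sub_le _ _).trans ?_
  push_cast
  rw [mul_assoc]
  gcongr
  rw [pi_norm_le_iff_of_nonneg (by positivity)]
  intro i
  fin_cases i
  · exact hl [0, 0] rfl
  · exact hl [0, 1] rfl
  · exact hl [1, 1] rfl

theorem Tame.exists_pathBounds {f : Plane → ℝ} (hf : Tame f) (r : ℝ) {T : ℝ} (hT : 0 ≤ T) :
    ∃ R Λ : ℝ, PathBounds f r T R Λ := by
  obtain ⟨M, hM⟩ := hf.norm_V_le
  have hM0 : 0 ≤ M := (norm_nonneg _).trans (hM 0)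
  -- On the ball, closeness gives `‖V g z‖ ≤ M + 24`. The additional 1 provides the strict
  -- inequality that `norm_sub_start_le` requires.
  set R := r + (M + 25) * T with hR
  obtain ⟨Λ, hΛ⟩ := hf.lipschitzOnWith_V_of_close R
  have hmem : ∀ g, Tame g → Close R 1 f g → ∀ x : Plane, ‖x‖ ≤ r → ∀ t, |t| ≤ T →
      ‖path g x t‖ ≤ R := by
    intro g hg hc x hx t ht
    have h1 := (hg.path_isIntegralCurveFrom x).norm_sub_start_le (M := M + 25) (T := T) (t := t)
      (fun z hz => by
        have hzR : ‖z‖ ≤ R := by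
          calc ‖z‖ = ‖x + (z - x)‖ := by simp
            _ ≤ ‖x‖ + ‖z - x‖ := norm_add_le _ _
            _ ≤ R := add_le_add hx hz
        have h2 := (norm_V_sub_le f g z z).trans
          (mul_le_mul_of_nonneg_left (hc.norm_jet_sub_le hzR) (by norm_num))
        have h3 := norm_sub_norm_le (V g z) (V f z)
        linarith [hM z]) ht (by positivity)
    calc ‖path g x t‖ = ‖x + (path g x t - x)‖ := by simp
      _ ≤ ‖x‖ + ‖path g x t - x‖ := norm_add_le _ _
      _ ≤ r + (M + 25) * T := by
        refine add_le_add hx (h1.trans ?_)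
        gcongr
  refine ⟨R, Real.exp (Λ * T), (Real.exp_pos _).le, hmem, ?_⟩
  intro g hg hc x x' hx hx' t A ht hA
  have hA0 : 0 ≤ A := (norm_nonneg _).trans (hA 0 left_mem_uIcc)
  have hsub : ∀ s ∈ uIcc 0 t, |s| ≤ T := by
    intro s hs
    have := abs_sub_left_of_mem_uIcc hs
    simp only [sub_zero] at this
    exact this.trans ht
  have hcont : Continuous fun u => V g (path f x u) - V f (path f x u) :=
    (hg.continuous_V.comp (hf.continuous_path x)).sub (hf.continuous_V.comp (hf.continuous_path x))
  have := (hf.path_isIntegralCurveFrom x).norm_sub_le (hg.path_isIntegralCurveFrom x')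
    hcont (hΛ g hg hc) (T := t) (A := A)
    (fun s hs => ⟨mem_closedBall_zero_iff.mpr
        (hmem f hf (Close.refl zero_le_one f) x hx s (hsub s hs)),
      mem_closedBall_zero_iff.mpr (hmem g hg hc x' hx' s (hsub s hs))⟩) hA
  refine this.trans ?_
  rw [mul_comm]
  gcongr

/-- The crude form, in which the integral of the field difference is estimated by its supremum. -/
theorem PathBounds.norm_sub_le_of_close {f : Plane → ℝ} {r T R Λ : ℝ} (h : PathBounds f r T R Λ)
    (hf : Tame f) {g : Plane → ℝ} (hg : Tame g) (h1 : Close R 1 f g) {δ : ℝ}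
    (hδ : ∀ x, ‖x‖ ≤ R → ‖V g x - V f x‖ ≤ δ) {x x' : Plane}
    (hx : ‖x‖ ≤ r) (hx' : ‖x'‖ ≤ r) {t : ℝ} (ht : |t| ≤ T) :
    ‖path g x' t - path f x t‖ ≤ Λ * (‖x' - x‖ + δ * T) := by
  have hT : 0 ≤ T := (abs_nonneg t).trans ht
  refine h.norm_sub_le g hg h1 x x' hx hx' t _ ht fun s hs => ?_
  have hs' : ∀ u ∈ uIcc 0 s, |u| ≤ T := by
    intro u hu
    have e1 := abs_sub_left_of_mem_uIcc hs
    have e2 := abs_sub_left_of_mem_uIcc hu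
    simp only [sub_zero] at e1 e2
    linarith
  have hδ0 : 0 ≤ δ := (norm_nonneg _).trans
    (hδ _ (h.norm_le f hf (Close.refl zero_le_one f) x hx 0 (by simpa using hT)))
  refine (intervalIntegral.norm_integral_le_of_norm_le_const (C := δ) fun u hu =>
    hδ _ (h.norm_le f hf (Close.refl zero_le_one f) x hx u
      (hs' u (uIoc_subset_uIcc hu)))).trans ?_
  rw [sub_zero]
  gcongr
  exact hs' s right_mem_uIcc

/-! ### Simple zeros are stable -/

/-- On the window of radius `δ₀` the function is strictly monotone with slope at least `c`, so a
small value at `θ` forces a zero `τ` nearby. The bound `c * min δ₀ δ₁` also keeps `|τ|` below `|θ| +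
δ₁`. A competitor of modulus at most `|τ|` then lies either in the window, where monotonicity
identifies it with `τ`, or in the range excluded by `hout`. -/
theorem exists_isolated_zero {σ ψ lam : ℝ → ℝ} {θ δ₀ δ₁ c : ℝ} (hδ₀ : 0 < δ₀) (hδ₁ : 0 < δ₁)
    (hc : 0 < c) (hσ : ∀ t, |t - θ| ≤ δ₀ → HasDerivAt σ (ψ t) t)
    (hψ : (∀ t, |t - θ| ≤ δ₀ → c ≤ ψ t) ∨ ∀ t, |t - θ| ≤ δ₀ → ψ t ≤ -c)
    (hlam : ∀ t, |t - θ| ≤ δ₀ → lam t < 0)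
    (hout : ∀ t, |t| ≤ |θ| + δ₁ → δ₀ ≤ |t - θ| → ¬ (σ t = 0 ∧ lam t < 0))
    (hθ : |σ θ| < c * min δ₀ δ₁) :
    ∃ τ, |τ - θ| < δ₀ ∧ σ τ = 0 ∧ lam τ < 0 ∧
      (∀ s, σ s = 0 → lam s < 0 → |s| ≤ |τ| → s = τ) ∧
      ∀ t, |t - θ| < δ₀ → c * |t - τ| ≤ |σ t| := by
  wlog hpos : ∀ t, |t - θ| ≤ δ₀ → c ≤ ψ t generalizing σ ψ
  · have hneg := hψ.resolve_left hpos
    have := this (σ := fun t => -σ t) (ψ := fun t => -ψ t) (fun t ht => (hσ t ht).neg)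
      (Or.inl fun t ht => by linarith [hneg t ht]) (by simpa using hout) (by simpa using hθ)
      (fun t ht => by linarith [hneg t ht])
    simpa using this
  have hmem : ∀ t, t ∈ Icc (θ - δ₀) (θ + δ₀) ↔ |t - θ| ≤ δ₀ := by
    intro t
    rw [abs_le, mem_Icc]
    constructor <;> rintro ⟨h1, h2⟩ <;> constructor <;> linarith
  have hcont : ContinuousOn σ (Icc (θ - δ₀) (θ + δ₀)) := fun t ht =>
    (hσ t ((hmem t).mp ht)).continuousAt.continuousWithinAt
  have hmvt : ∀ s ∈ Icc (θ - δ₀) (θ + δ₀), ∀ t ∈ Icc (θ - δ₀) (θ + δ₀), s ≤ t →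
      c * (t - s) ≤ σ t - σ s := by
    intro s hs t ht hst
    refine (convex_Icc (θ - δ₀) (θ + δ₀)).mul_sub_le_image_sub_of_le_deriv hcont
      (fun u hu => (hσ u ((hmem u).mp (interior_subset hu))).differentiableAt.differentiableWithinAt)
      (fun u hu => ?_) s hs t ht hst
    rw [(hσ u ((hmem u).mp (interior_subset hu))).deriv]
    exact hpos u ((hmem u).mp (interior_subset hu))
  set u := min δ₀ δ₁ with hu
  have hu0 : 0 < u := lt_min hδ₀ hδ₁
  have hud : u ≤ δ₀ := min_le_left _ _
  have hm0 : θ ∈ Icc (θ - δ₀) (θ + δ₀) := ⟨by linarith, by linarith⟩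
  have hm1 : θ - u ∈ Icc (θ - δ₀) (θ + δ₀) := ⟨by linarith, by linarith⟩
  have hm2 : θ + u ∈ Icc (θ - δ₀) (θ + δ₀) := ⟨by linarith, by linarith⟩
  have h1 := hmvt _ hm1 _ hm0 (by linarith)
  have h2 := hmvt _ hm0 _ hm2 (by linarith)
  have h3 := abs_lt.mp hθ
  obtain ⟨τ, hτ, hτ0⟩ : (0 : ℝ) ∈ σ '' Ioo (θ - u) (θ + u) := by
    refine intermediate_value_Ioo (by linarith) (hcont.mono (Icc_subset_Icc hm1.1 hm2.2)) ⟨?_, ?_⟩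
    · nlinarith
    · nlinarith
  have hτu : |τ - θ| < u := abs_lt.mpr ⟨by linarith [hτ.1], by linarith [hτ.2]⟩
  have hτδ : |τ - θ| < δ₀ := hτu.trans_le hud
  have hineq : ∀ t, |t - θ| < δ₀ → c * |t - τ| ≤ |σ t| := by
    intro t ht
    rcases le_total t τ with h | h
    · have := hmvt t ((hmem t).mpr ht.le) τ ((hmem τ).mpr hτδ.le) h
      rw [abs_of_nonpos (by linarith : t - τ ≤ 0)]
      have := neg_le_abs (σ t)
      linarith
    · have := hmvt τ ((hmem τ).mpr hτδ.le) t ((hmem t).mpr ht.le) h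
      rw [abs_of_nonneg (by linarith : 0 ≤ t - τ)]
      have := le_abs_self (σ t)
      linarith
  refine ⟨τ, hτδ, hτ0, hlam τ hτδ.le, fun s hs hsl hsτ => ?_, hineq⟩
  by_cases hsδ : |s - θ| < δ₀
  · have := hineq s hsδ
    rw [hs, abs_zero] at this
    have : |s - τ| ≤ 0 := by nlinarith [abs_nonneg (s - τ)]
    linarith [abs_nonpos_iff.mp this]
  · refine absurd ⟨hs, hsl⟩ (hout s ?_ (not_lt.mp hsδ))
    have e1 : |τ| ≤ |θ| + |τ - θ| := by
      calc |τ| = |θ + (τ - θ)| := by ring_nf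
        _ ≤ _ := abs_add_le _ _
    have : u ≤ δ₁ := min_le_right _ _
    linarith

theorem existsUnique_isArgminAbs {S : Set ℝ} {τ : ℝ} (h : τ ∈ S)
    (h' : ∀ s ∈ S, |s| ≤ |τ| → s = τ) : ∃! t, IsArgminAbs S t := by
  refine ⟨τ, ⟨h, fun s hs => ?_⟩, fun s hs => h' s hs.1 (hs.2 τ h)⟩
  by_contra hlt
  rw [h' s hs (not_le.mp hlt).le] at hlt
  exact hlt le_rfl

theorem isArgminAbs_theta {g : Plane → ℝ} {x : Plane}
    (h : ∃ t, IsArgminAbs (filamentTimes g x) t) : IsArgminAbs (filamentTimes g x) (theta g x) := by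
  rw [theta, dif_pos h]
  exact h.choose_spec

theorem theta_eq {g : Plane → ℝ} {x : Plane} {τ : ℝ} (h : τ ∈ filamentTimes g x)
    (h' : ∀ s ∈ filamentTimes g x, |s| ≤ |τ| → s = τ) : theta g x = τ := by
  have := isArgminAbs_theta (existsUnique_isArgminAbs h h').exists
  exact h' _ this.1 (this.2 τ h)

/-! ### Consequences of the assumptions on the filament -/

namespace FilamentAssumptions

variable {f : Plane → ℝ} {H L : Set Plane} {a : ℝ}

theorem argmin_theta (hL : FilamentAssumptions f H L a) {x : Plane}
    (hx : x ∈ startingSet f L a) : IsArgminAbs (filamentTimes f x) (theta f x) :=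
  isArgminAbs_theta (hL.unique x hx).exists

theorem path_theta_mem (hL : FilamentAssumptions f H L a) {x : Plane}
    (hx : x ∈ startingSet f L a) : path f x (theta f x) ∈ L := by
  rw [hL.eq_image]
  exact ⟨x, hx, rfl⟩

/-- A starting point was reached from some `y ∈ L` in a time `|t| ≤ a`; going back for the time `-t`
meets the filament point `y`. -/
theorem abs_theta_le (hL : FilamentAssumptions f H L a) (hf : Tame f) {x : Plane}
    (hx : x ∈ startingSet f L a) : |theta f x| ≤ a := by
  obtain ⟨y, hy, t, ht, rfl⟩ := hx
  have h1 : -t ∈ filamentTimes f (path f y t) := by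
    change IsFilamentPoint f _
    rw [hf.path_path, add_neg_cancel, hf.path_zero]
    exact hL.filament y hy
  have := (hL.argmin_theta ⟨y, hy, t, ht, rfl⟩).2 _ h1
  rw [abs_neg] at this
  exact this.trans (abs_le.mpr ht)

theorem subset_startingSet (hL : FilamentAssumptions f H L a) (hf : Tame f) :
    L ⊆ startingSet f L a := fun y hy =>
  ⟨y, hy, 0, ⟨by linarith [hL.pos], hL.pos.le⟩, (hf.path_zero y).symm⟩

theorem path_eq (hf : Tame f) (x : Plane) (s : ℝ) :
    path f x s = path f (path f x (theta f x)) (s - theta f x) := by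
  rw [hf.path_path]
  congr 1
  ring

theorem exists_norm_le (hL : FilamentAssumptions f H L a) (hH : RegionAssumptions f H) :
    ∃ r : ℝ, ∀ x ∈ startingSet f L a, ‖x‖ ≤ r := by
  obtain ⟨r, hr⟩ := hH.compact.isBounded.exists_norm_le
  exact ⟨r, fun x hx => hr x (hL.starting_subset hx)⟩

/-- It is the image of `L ×ˢ Icc (-a) a` under the flow, which is jointly continuous because it is
continuous in time and Lipschitz in the start, uniformly in time. -/
theorem isCompact_startingSet (hL : FilamentAssumptions f H L a) (hf : Tame f)
    (hH : RegionAssumptions f H) : IsCompact (startingSet f L a) := by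
  obtain ⟨r, hr⟩ := hL.exists_norm_le hH
  obtain ⟨R, Λ, hB⟩ := hf.exists_pathBounds r hL.pos.le
  have hc : ContinuousOn (Function.uncurry (path f)) (L ×ˢ Icc (-a) a) := by
    refine continuousOn_prod_of_continuousOn_lipschitzOnWith _ (Real.toNNReal Λ)
      (fun x _ => (hf.continuous_path x).continuousOn) (fun t ht => ?_)
    refine LipschitzOnWith.of_dist_le_mul fun x hx x' hx' => ?_
    rw [Real.coe_toNNReal _ hB.nonneg, dist_eq_norm, dist_eq_norm]
    simpa using hB.norm_sub_le f hf (Close.refl zero_le_one f) x' x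
      (hr _ (hL.subset_startingSet hf hx')) (hr _ (hL.subset_startingSet hf hx)) t 0
      (abs_le.mpr ht) (by simp)
  have := (hL.compact.prod isCompact_Icc).image_of_continuousOn hc
  convert this using 1
  ext x
  simp only [startingSet, mem_ofPred_eq, mem_image, mem_prod, Prod.exists, Function.uncurry]
  constructor
  · rintro ⟨y, hy, t, ht, rfl⟩
    exact ⟨y, t, ⟨hy, ht⟩, rfl⟩
  · rintro ⟨y, t, ⟨hy, ht⟩, rfl⟩
    exact ⟨y, hy, t, ht, rfl⟩

/-- Near a given starting point, every function close to `f` has a unique filament time of minimal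
modulus, and this time is controlled by the slope. -/
theorem exists_local_zero (hL : FilamentAssumptions f H L a) (hf : Tame f)
    (hH : RegionAssumptions f H) {r R Λ : ℝ} (hr : ∀ x ∈ startingSet f L a, ‖x‖ ≤ r)
    (hB : PathBounds f r (a + 1) R Λ) {x : Plane} (hx : x ∈ startingSet f L a) :
    ∃ δ₀ c η : ℝ, 0 < c ∧ 0 < η ∧ ∀ x' ∈ startingSet f L a, ‖x' - x‖ < η →
      ∀ g, Tame g → Close R η f g → ∃ τ, |τ - theta f x| < δ₀ ∧ τ ∈ filamentTimes g x' ∧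
        (∀ s ∈ filamentTimes g x', |s| ≤ |τ| → s = τ) ∧
        ∀ t, |t - theta f x| < δ₀ → c * |t - τ| ≤ |slope g (path g x' t)| := by
  set θ := theta f x with hθ
  have ha : |θ| ≤ a := hL.abs_theta_le hf hx
  have hyL : path f x θ ∈ L := hL.path_theta_mem hx
  set e : ℝ → Jet := fun t => jet f (path f x t) with he
  have hec : Continuous e := hf.continuous_jet.comp (hf.continuous_path x)
  have hdisc : disc (e θ).second ≠ 0 :=
    disc_ne_zero hf (hH.distinct_eigenvalues _ (hL.subset hyL))
  have hd0 : (e θ).dSlope ≠ 0 := by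
    have := hL.transversal _ hyL
    rwa [hf.inner_gradient_slope _ hdisc] at this
  have hslope0 : (e θ).slope = 0 := by
    rw [← slope_eq_jet]; exact (hL.filament _ hyL).1
  have hlam0 : eigenvalueMap (e θ).second < 0 := (hL.filament _ hyL).2
  -- a neighbourhood of the jet at the filament point
  set c := |(e θ).dSlope| / 2 with hcdef
  have hcpos : 0 < c := by positivity
  have hnear : ∀ᶠ e' in 𝓝 (e θ), disc e'.second ≠ 0 ∧ |e'.dSlope - (e θ).dSlope| < c ∧
      eigenvalueMap e'.second < 0 := by
    have h1 := (continuous_disc.comp continuous_second).continuousAt.eventually_ne hdisc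
    have h2 := (continuousAt_dSlope hdisc).eventually
      (ball_mem_nhds (e θ).dSlope hcpos)
    have h3 := (continuous_eigenvalueMap.comp
      continuous_second).continuousAt.eventually_lt continuousAt_const hlam0
    filter_upwards [h1, h2, h3] with e' h1 h2 h3
    exact ⟨h1, by simpa [dist_eq_norm] using h2, h3⟩
  obtain ⟨ρ, hρ, hρU⟩ := Metric.eventually_nhds_iff.mp hnear
  obtain ⟨δ₀', hδ₀', hδρ⟩ := Metric.continuousAt_iff.mp hec.continuousAt (ρ / 2) (half_pos hρ)
  obtain ⟨δ₀, hδ₀, hδ₀lt⟩ := exists_between (lt_min hδ₀' one_pos)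
  have hδ₀1 : δ₀ < 1 := hδ₀lt.trans_le (min_le_right _ _)
  have hδ₀2 : δ₀ < δ₀' := hδ₀lt.trans_le (min_le_left _ _)
  -- away from the filament time there are no filament points
  set m : Jet → ℝ := fun e' => max |e'.slope| (eigenvalueMap e'.second) with hm
  have hmc : Continuous m := (continuous_jetSlope.abs).max
    (continuous_eigenvalueMap.comp continuous_second)
  -- `m ≤ 0` means that the slope vanishes and the eigenvalue is non-positive. A negative eigenvalue
  -- would give a second minimizer, possibly `-θ`, against `unique`; a zero eigenvalue contradicts
  -- `nondegenerate` on the traversed set.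
  have hmpos : ∀ t, |t| ≤ |θ| → t ≠ θ → 0 < m (e t) := by
    intro t ht hne
    by_contra hle
    have h1 : |(e t).slope| ≤ 0 := (le_max_left _ _).trans (not_lt.mp hle)
    have h2 : eigenvalueMap (e t).second ≤ 0 := (le_max_right _ _).trans (not_lt.mp hle)
    have h3 : slope f (path f x t) = 0 := by
      rw [slope_eq_jet]; exact abs_nonpos_iff.mp h1
    rcases h2.lt_or_eq with h4 | h4
    · have h5 : t ∈ filamentTimes f x := ⟨h3, h4⟩
      refine hne ((hL.unique x hx).unique ⟨h5, fun s hs => ?_⟩ (hL.argmin_theta hx))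
      exact ht.trans ((hL.argmin_theta hx).2 s hs)
    · exact hL.nondegenerate _ (Or.inr ⟨x, hx, t, ht, rfl⟩) ⟨h4, h3⟩
  have hO : IsOpen ({t | 0 < m (e t)} ∪ ball θ δ₀) :=
    (isOpen_lt continuous_const (hmc.comp hec)).union isOpen_ball
  have hsub : Icc (-|θ|) |θ| ⊆ {t | 0 < m (e t)} ∪ ball θ δ₀ := by
    intro t ht
    by_cases h : t = θ
    · exact Or.inr (by simpa [h] using hδ₀)
    · exact Or.inl (hmpos t (abs_le.mpr ht) h)
  -- The perturbed zero may have a slightly larger modulus than `θ`, so filament points must be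
  -- excluded a little beyond `|θ|`.
  obtain ⟨δ₁', hδ₁', hthick⟩ := isCompact_Icc.exists_cthickening_subset_open hO hsub
  set δ₁ := min δ₁' 1 with hδ₁
  have hδ₁0 : 0 < δ₁ := lt_min hδ₁' one_pos
  have hδ₁1 : δ₁ ≤ 1 := min_le_right _ _
  have hcov : ∀ t, |t| ≤ |θ| + δ₁ → δ₀ ≤ |t - θ| → 0 < m (e t) := by
    intro t ht htδ
    have h1 : t ∈ cthickening δ₁' (Icc (-|θ|) |θ|) := by
      refine mem_cthickening_of_dist_le t (max (-|θ|) (min t |θ|)) _ _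
        ⟨le_max_left _ _, max_le (by linarith [abs_nonneg θ]) (min_le_right _ _)⟩ ?_
      have := abs_le.mp ht
      have hle : δ₁ ≤ δ₁' := min_le_left _ _
      rw [Real.dist_eq, abs_le]
      constructor
      · rcases le_total (-|θ|) (min t |θ|) with h | h
        · rw [max_eq_right h]; linarith [min_le_left t |θ|]
        · rw [max_eq_left h]; linarith
      · rcases le_total t |θ| with h | h
        · rw [min_eq_left h]; linarith [le_max_right (-|θ|) t]
        · rw [min_eq_right h]; linarith [le_max_right (-|θ|) |θ|]
    rcases hthick h1 with h | h
    · exact h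
    · rw [mem_ball, Real.dist_eq] at h
      exact absurd h (not_lt.mpr htδ)
  have hS : IsCompact (Icc (-(|θ| + δ₁)) (|θ| + δ₁) ∩ {t | δ₀ ≤ |t - θ|}) :=
    isCompact_Icc.inter_right (isClosed_le continuous_const (by fun_prop))
  obtain ⟨ρ₂, hρ₂, hthick₂⟩ := (hS.image hec).exists_thickening_subset_open
    (isOpen_lt continuous_const hmc) (s := _) (t := {e' | 0 < m e'}) (by
      rintro _ ⟨t, ⟨ht, htδ⟩, rfl⟩
      exact hcov t (abs_le.mpr ht) htδ)
  obtain ⟨ρ₃, hρ₃, hslope⟩ := Metric.continuousAt_iff.mp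
    (continuous_jetSlope.continuousAt (x := e θ)) (c * min δ₀ δ₁)
    (mul_pos hcpos (lt_min hδ₀ hδ₁0))
  -- The three thresholds serve, in this order, the window around `θ`, the exclusion outside it, and
  -- the smallness of the slope at `θ`.
  set ρ' := min (ρ / 2) (min ρ₂ ρ₃) with hρ'
  have hρ'0 : 0 < ρ' := lt_min (half_pos hρ) (lt_min hρ₂ hρ₃)
  obtain ⟨K, hK⟩ := hf.lipschitzWith_jet
  have hT : 0 < a + 1 := by linarith [hL.pos]
  -- The change of the jet along the path is at most `D * η`: `η` from changing the function at a
  -- fixed point, and `K` times the displacement of the path, caused by the new start (`η`) and the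
  -- new field (`24 * η` over a time `a + 1`).
  set D : ℝ := 1 + K * (Λ * (1 + 24 * (a + 1))) with hD
  have hD0 : 0 < D := by
    have := hB.nonneg
    positivity
  set η := min 1 (ρ' / (2 * D)) with hη
  have hη0 : 0 < η := lt_min one_pos (by positivity)
  refine ⟨δ₀, c, η, hcpos, hη0, fun x' hx' hxx' g hg hc => ?_⟩
  have hc1 : Close R 1 f g := hc.mono (min_le_left _ _)
  set e' : ℝ → Jet := fun t => jet g (path g x' t) with he'
  have hclose : ∀ t, |t| ≤ a + 1 → ‖e' t - e t‖ < ρ' := by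
    intro t ht
    have h1 := hB.norm_sub_le_of_close hf hg hc1 (δ := 24 * η)
      (fun z hz => (norm_V_sub_le f g z z).trans
        (mul_le_mul_of_nonneg_left (hc.norm_jet_sub_le hz) (by norm_num)))
      (hr x hx) (hr x' hx') ht
    have h2 := hc.norm_jet_sub_le (hB.norm_le g hg hc1 x' (hr x' hx') t ht)
    have h3 := hK.dist_le_mul (path g x' t) (path f x t)
    rw [dist_eq_norm, dist_eq_norm] at h3
    have h4 : ‖e' t - e t‖ ≤ D * η := by
      calc ‖e' t - e t‖ = ‖(jet g (path g x' t) - jet f (path g x' t)) +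
            (jet f (path g x' t) - jet f (path f x t))‖ := by simp [he, he']
        _ ≤ η + K * (Λ * (η + 24 * η * (a + 1))) := by
          refine (norm_add_le _ _).trans (add_le_add h2 (h3.trans ?_))
          refine mul_le_mul_of_nonneg_left (h1.trans ?_) K.2
          exact mul_le_mul_of_nonneg_left (by linarith) hB.nonneg
        _ = D * η := by rw [hD]; ring
    have h5 : η ≤ ρ' / (2 * D) := min_le_right _ _
    have h6 : D * (ρ' / (2 * D)) = ρ' / 2 := by field_simp
    have h7 : D * η ≤ D * (ρ' / (2 * D)) := mul_le_mul_of_nonneg_left h5 hD0.le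
    linarith
  have htime : ∀ t, |t - θ| ≤ δ₀ → |t| ≤ a + 1 := by
    intro t ht
    have : |t| ≤ |t - θ| + |θ| := by
      calc |t| = |t - θ + θ| := by ring_nf
        _ ≤ _ := abs_add_le _ _
    linarith
  have hin : ∀ t, |t - θ| ≤ δ₀ → disc (e' t).second ≠ 0 ∧
      |(e' t).dSlope - (e θ).dSlope| < c ∧ eigenvalueMap (e' t).second < 0 := by
    intro t ht
    refine hρU ?_
    have h1 := hclose t (htime t ht)
    have h2 : dist (e t) (e θ) < ρ / 2 := hδρ (by rw [Real.dist_eq]; linarith)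
    have h3 : ρ' ≤ ρ / 2 := min_le_left _ _
    rw [← dist_eq_norm] at h1
    linarith [dist_triangle (e' t) (e t) (e θ)]
  obtain ⟨τ, h1, h2, h3, h4, h5⟩ := exists_isolated_zero (σ := fun t => slope g (path g x' t))
    (ψ := fun t => (e' t).dSlope) (lam := fun t => lambda2 g (path g x' t)) (θ := θ) hδ₀ hδ₁0 hcpos
    (fun t ht => hg.hasDerivAt_slope ((hg.path_isIntegralCurveFrom x').2 t) (hin t ht).1)
    (by
      rcases lt_or_gt_of_ne hd0 with h | h
      · right
        intro t ht
        have := abs_lt.mp (hin t ht).2.1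
        have hc' : c = -(e θ).dSlope / 2 := by rw [hcdef, abs_of_neg h]
        linarith
      · left
        intro t ht
        have := abs_lt.mp (hin t ht).2.1
        have hc' : c = (e θ).dSlope / 2 := by rw [hcdef, abs_of_pos h]
        linarith)
    (fun t ht => (hin t ht).2.2)
    (fun t ht htδ hcon => by
      have h1 := hclose t (by linarith)
      have h2 : e' t ∈ thickening ρ₂ (e '' (Icc (-(|θ| + δ₁)) (|θ| + δ₁) ∩ {t | δ₀ ≤ |t - θ|})) := by
        refine mem_thickening_iff.mpr ⟨e t, ⟨t, ⟨abs_le.mp ht, htδ⟩, rfl⟩, ?_⟩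
        rw [dist_eq_norm]
        exact h1.trans_le ((min_le_right _ _).trans (min_le_left _ _))
      have h3 : 0 < m (e' t) := hthick₂ h2
      have h4 : (e' t).slope = 0 := by rw [← slope_eq_jet]; exact hcon.1
      have h5 : eigenvalueMap (e' t).second < 0 := hcon.2
      rw [hm] at h3
      simp only [h4, abs_zero] at h3
      rw [max_eq_left h5.le] at h3
      exact lt_irrefl _ h3)
    (by
      have h1 := hclose θ (by linarith)
      have h2 := hslope (x := e' θ) (by
        rw [dist_eq_norm]
        exact h1.trans_le ((min_le_right _ _).trans (min_le_right _ _)))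
      rw [hslope0, Real.dist_eq, sub_zero, ← slope_eq_jet] at h2
      exact h2)
  exact ⟨τ, h1, ⟨h2, h3⟩, fun s hs => h4 s hs.1 hs.2, h5⟩

/-- Every function close to `f` has unique filament times of minimal modulus, and they differ from
those of `f` by at most a constant times the slope. -/
theorem exists_theta_sub_le (hL : FilamentAssumptions f H L a) (hf : Tame f)
    (hH : RegionAssumptions f H) {r R Λ : ℝ} (hr : ∀ x ∈ startingSet f L a, ‖x‖ ≤ r)
    (hB : PathBounds f r (a + 1) R Λ) :
    ∃ η C : ℝ, 0 < η ∧ ∀ x ∈ startingSet f L a, ∀ g, Tame g → Close R η f g →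
      (∃! t, IsArgminAbs (filamentTimes g x) t) ∧
      |theta g x - theta f x| ≤ C * |slope g (path g x (theta f x))| := by
  -- The property passes to subsets and to unions of two sets, hence from a neighbourhood of each
  -- point to the compact set.
  refine (hL.isCompact_startingSet hf hH).induction_on (p := fun S => ∃ η C : ℝ, 0 < η ∧
    ∀ x ∈ S, ∀ g, Tame g → Close R η f g → (∃! t, IsArgminAbs (filamentTimes g x) t) ∧
      |theta g x - theta f x| ≤ C * |slope g (path g x (theta f x))|) ?_ ?_ ?_ ?_
  · exact ⟨1, 0, one_pos, by simp⟩
  · rintro s t hst ⟨η, C, hη, h⟩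
    exact ⟨η, C, hη, fun x hx => h x (hst hx)⟩
  · rintro s t ⟨η, C, hη, h⟩ ⟨η', C', hη', h'⟩
    refine ⟨min η η', max C C', lt_min hη hη', ?_⟩
    rintro x (hx | hx) g hg hc
    · obtain ⟨h1, h2⟩ := h x hx g hg (hc.mono (min_le_left _ _))
      exact ⟨h1, h2.trans (by gcongr; exact le_max_left _ _)⟩
    · obtain ⟨h1, h2⟩ := h' x hx g hg (hc.mono (min_le_right _ _))
      exact ⟨h1, h2.trans (by gcongr; exact le_max_right _ _)⟩
  · intro x hx
    obtain ⟨δ₀, c, η, hc, hη, hloc⟩ := hL.exists_local_zero hf hH hr hB hx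
    refine ⟨startingSet f L a ∩ ball x η,
      inter_mem_nhdsWithin _ (ball_mem_nhds x hη), η, c⁻¹, hη, ?_⟩
    rintro x' ⟨hx', hx'x⟩ g hg hcl
    rw [mem_ball, dist_eq_norm] at hx'x
    obtain ⟨τ, h1, h2, h3, h4⟩ := hloc x' hx' hx'x g hg hcl
    -- The local statement for `f` itself places `theta f x'` in the window, so no separate
    -- continuity of `theta f` is needed.
    obtain ⟨τ', h1', h2', h3', h4'⟩ := hloc x' hx' hx'x f hf (Close.refl hη.le f)
    refine ⟨existsUnique_isArgminAbs h2 h3, ?_⟩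
    rw [theta_eq h2 h3, theta_eq h2' h3', abs_sub_comm, ← div_eq_inv_mul, le_div_iff₀ hc, mul_comm]
    exact h4 τ' h1'

end FilamentAssumptions

/-! ### Comparison of the slopes -/

theorem partialDeriv_eq_zero_of_gradient {g : Plane → ℝ} {x : Plane} (h : ∇ g x = 0) (i : Fin 2) :
    partialDeriv i g x = 0 := by
  rw [partialDeriv, ← toDual_gradient, h]
  simp

/-- The product difference is split so that the error of the eigenvector is multiplied by the
gradient of `f` alone. At a critical point of `f` one may take `B = 0`, and this error disappears.
-/
theorem abs_slope_sub_le {f g : Plane → ℝ} {y z : Plane} {A B δ δ' : ℝ} (hA : ‖V g z‖ ≤ A)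
    (hB : ∀ i, |partialDeriv i f y| ≤ B)
    (h1 : ∀ i, |partialDeriv i g z - partialDeriv i f y| ≤ δ) (h2 : ‖V g z - V f y‖ ≤ δ') :
    |slope g z - slope f y| ≤ 2 * (A * δ + B * δ') := by
  have hB0 : 0 ≤ B := (abs_nonneg _).trans (hB 0)
  have hA0 : 0 ≤ A := (norm_nonneg _).trans hA
  have key : ∀ i, |V g z i * partialDeriv i g z - V f y i * partialDeriv i f y| ≤
      A * δ + B * δ' := by
    intro i
    have e : V g z i * partialDeriv i g z - V f y i * partialDeriv i f y =
        V g z i * (partialDeriv i g z - partialDeriv i f y) +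
        partialDeriv i f y * (V g z - V f y) i := by simp; ring
    rw [e]
    refine (abs_add_le _ _).trans ?_
    rw [abs_mul, abs_mul]
    gcongr
    · exact (abs_apply_le_norm _ _).trans hA
    · exact h1 i
    · exact hB i
    · exact (abs_apply_le_norm _ _).trans h2
  rw [slope_eq, slope_eq]
  calc _ = |(V g z 0 * partialDeriv 0 g z - V f y 0 * partialDeriv 0 f y) +
        (V g z 1 * partialDeriv 1 g z - V f y 1 * partialDeriv 1 f y)| := by ring_nf
    _ ≤ _ := (abs_add_le _ _).trans (by linarith [key 0, key 1])

/-! ### Linearization of the eigenvector map -/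

/-- The first order expansion of the norm has a quadratic remainder. -/
theorem abs_norm_sub_norm_sub_inner_le {q q' : Plane} {s : ℝ} (hs : 0 < s) (hq : s ≤ ‖q‖) :
    |‖q'‖ - ‖q‖ - inner ℝ q (q' - q) / ‖q‖| ≤ ‖q' - q‖ ^ 2 / s := by
  have hq0 : 0 < ‖q‖ := hs.trans_le hq
  -- The numerator is the defect in the Cauchy–Schwarz inequality; its double equals `‖q' - q‖ ^ 2 -
  -- (‖q'‖ - ‖q‖) ^ 2`.
  have h1 : ‖q'‖ - ‖q‖ - inner ℝ q (q' - q) / ‖q‖ = (‖q'‖ * ‖q‖ - inner ℝ q q') / ‖q‖ := by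
    rw [inner_sub_right, real_inner_self_eq_norm_sq]
    field_simp
    ring
  have h2 := real_inner_le_norm q q'
  have h3 := norm_sub_sq_real q' q
  rw [real_inner_comm] at h3
  have h4 : 0 ≤ (‖q'‖ * ‖q‖ - inner ℝ q q') / ‖q‖ :=
    div_nonneg (by linarith) hq0.le
  rw [h1, abs_of_nonneg h4]
  gcongr
  nlinarith [sq_nonneg (‖q'‖ - ‖q‖)]

/-- The vector whose norm is the root of the discriminant. -/
def gapVec (p : Fin 3 → ℝ) : Plane := !₂[p 2 - p 0, 2 * p 1]

theorem norm_gapVec (p : Fin 3 → ℝ) : ‖gapVec p‖ = √(disc p) := (sqrt_disc_eq_norm p).symm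

theorem norm_gapVec_sub_le (p q : Fin 3 → ℝ) : ‖gapVec p - gapVec q‖ ≤ 4 * ‖p - q‖ := by
  refine (plane_norm_le _).trans ?_
  have h0 := abs_le.mp (norm_le_pi_norm (p - q) 0)
  have h1 := abs_le.mp (norm_le_pi_norm (p - q) 1)
  have h2 := abs_le.mp (norm_le_pi_norm (p - q) 2)
  simp only [Pi.sub_apply] at h0 h1 h2
  have e1 : |p 2 - p 0 - (q 2 - q 0)| ≤ 2 * ‖p - q‖ := abs_le.mpr ⟨by linarith, by linarith⟩
  have e2 : |2 * p 1 - 2 * q 1| ≤ 2 * ‖p - q‖ := abs_le.mpr ⟨by linarith, by linarith⟩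
  simp [gapVec]
  linarith

/-- The normalized vector `gapVec`, with the norm cut off below at `s`. -/
def gapDir (s : ℝ) (p : Fin 3 → ℝ) (i : Fin 2) : ℝ := gapVec p i / max s ‖gapVec p‖

theorem abs_gapDir_le {s : ℝ} (hs : 0 < s) (p : Fin 3 → ℝ) (i : Fin 2) : |gapDir s p i| ≤ 1 := by
  have : 0 < max s ‖gapVec p‖ := lt_max_of_lt_left hs
  rw [gapDir, abs_div, abs_of_pos this, div_le_one this]
  exact (abs_apply_le_norm _ _).trans (le_max_right _ _)

/-- Dividing by at least `s` makes the direction globally Lipschitz, so that it can serve as a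
weight in the empirical path integrals. Where the eigenvalue gap exceeds `s` the cut-off is
inactive. -/
theorem abs_gapDir_sub_le {s : ℝ} (hs : 0 < s) (p q : Fin 3 → ℝ) (i : Fin 2) :
    |gapDir s p i - gapDir s q i| ≤ 8 / s * ‖p - q‖ := by
  have hp : 0 < max s ‖gapVec p‖ := lt_max_of_lt_left hs
  have hq : 0 < max s ‖gapVec q‖ := lt_max_of_lt_left hs
  have e : gapDir s p i - gapDir s q i = (gapVec p - gapVec q) i / max s ‖gapVec p‖ +
      gapDir s q i * ((max s ‖gapVec q‖ - max s ‖gapVec p‖) / max s ‖gapVec p‖) := by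
    simp only [gapDir, PiLp.sub_apply]
    field_simp
    ring
  have h1 : |(gapVec p - gapVec q) i| ≤ 4 * ‖p - q‖ :=
    (abs_apply_le_norm _ _).trans (norm_gapVec_sub_le p q)
  have h2 : |max s ‖gapVec q‖ - max s ‖gapVec p‖| ≤ 4 * ‖p - q‖ := by
    refine (abs_max_sub_max_le_max _ _ _ _).trans ?_
    rw [sub_self, abs_zero, max_eq_right (abs_nonneg _)]
    refine (abs_norm_sub_norm_le (gapVec q) (gapVec p)).trans ?_
    rw [norm_sub_rev]
    exact norm_gapVec_sub_le p q
  rw [e]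
  calc _ ≤ |(gapVec p - gapVec q) i| / max s ‖gapVec p‖ +
        |gapDir s q i| * (|max s ‖gapVec q‖ - max s ‖gapVec p‖| / max s ‖gapVec p‖) := by
        refine (abs_add_le _ _).trans ?_
        rw [abs_mul, abs_div, abs_div, abs_of_pos hp]
    _ ≤ 4 * ‖p - q‖ / s + 1 * (4 * ‖p - q‖ / s) := by
        gcongr
        · exact le_max_left _ _
        · exact abs_gapDir_le hs q i
        · exact le_max_left _ _
    _ = _ := by ring

theorem abs_sqrt_disc_sub_sub_le {s : ℝ} (hs : 0 < s) {p p' : Fin 3 → ℝ} (hp : s ≤ √(disc p)) :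
    |√(disc p') - √(disc p) - (gapDir s p 0 * ((p' 2 - p 2) - (p' 0 - p 0)) +
      gapDir s p 1 * (2 * (p' 1 - p 1)))| ≤ 16 / s * ‖p' - p‖ ^ 2 := by
  rw [← norm_gapVec, ← norm_gapVec]
  rw [← norm_gapVec] at hp
  have h1 := abs_norm_sub_norm_sub_inner_le (q' := gapVec p') hs hp
  have h2 : inner ℝ (gapVec p) (gapVec p' - gapVec p) / ‖gapVec p‖ =
      gapDir s p 0 * ((p' 2 - p 2) - (p' 0 - p 0)) + gapDir s p 1 * (2 * (p' 1 - p 1)) := by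
    rw [gapDir, gapDir, max_eq_right hp]
    simp [PiLp.inner_apply, Fin.sum_univ_two, gapVec]
    ring
  rw [h2] at h1
  refine h1.trans ?_
  have h3 := norm_gapVec_sub_le p' p
  have h4 : ‖gapVec p' - gapVec p‖ ^ 2 ≤ (4 * ‖p' - p‖) ^ 2 := by gcongr
  rw [div_mul_eq_mul_div]
  gcongr
  linarith

/-- The linearization of the eigenvector field, integrated along a curve. -/
theorem norm_integral_V_sub_le {f g : Plane → ℝ} (hf : Tame f) (hg : Tame g) {γ : ℝ → Plane}
    (hγ : Continuous γ) {s δ ε t : ℝ} (hs : 0 < s)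
    (hgap : ∀ u ∈ uIcc 0 t, s ≤ √(disc (secondDerivs f (γ u))))
    (hδ : ∀ u ∈ uIcc 0 t, ‖secondDerivs g (γ u) - secondDerivs f (γ u)‖ ≤ δ)
    (h1 : ∀ j, |∫ u in (0 : ℝ)..t, (secondDerivs g (γ u) j - secondDerivs f (γ u) j)| ≤ ε)
    (hw : ∀ i j, |∫ u in (0 : ℝ)..t, gapDir s (secondDerivs f (γ u)) i *
      (secondDerivs g (γ u) j - secondDerivs f (γ u) j)| ≤ ε) :
    ‖∫ u in (0 : ℝ)..t, (V g (γ u) - V f (γ u))‖ ≤ 24 * ε + 48 / s * δ ^ 2 * |t| := by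
  set d : Fin 3 → ℝ → ℝ := fun j u => secondDerivs g (γ u) j - secondDerivs f (γ u) j with hd
  set w : Fin 2 → ℝ → ℝ := fun i u => gapDir s (secondDerivs f (γ u)) i with hw'
  have hc2 : ∀ {k : Plane → ℝ}, Tame k → Continuous fun u => secondDerivs k (γ u) := fun hk =>
    continuous_second.comp (hk.continuous_jet.comp hγ)
  have hcd : ∀ j, Continuous (d j) := fun j =>
    ((continuous_apply j).comp (hc2 hg)).sub ((continuous_apply j).comp (hc2 hf))
  have hcgap : ∀ i, Continuous fun p : Fin 3 → ℝ => gapDir s p i := by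
    intro i
    have hl : LipschitzWith (Real.toNNReal (8 / s)) fun p : Fin 3 → ℝ => gapDir s p i := by
      refine LipschitzWith.of_dist_le_mul fun p q => ?_
      rw [Real.coe_toNNReal _ (by positivity), dist_eq_norm, dist_eq_norm]
      exact abs_gapDir_sub_le hs p q i
    exact hl.continuous
  have hcw : ∀ i, Continuous (w i) := fun i => (hcgap i).comp (hc2 hf)
  set root : ℝ → ℝ := fun u => √(disc (secondDerivs g (γ u))) - √(disc (secondDerivs f (γ u)))
    with hroot
  have hcroot : Continuous root :=
    (Real.continuous_sqrt.comp (continuous_disc.comp (hc2 hg))).sub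
      (Real.continuous_sqrt.comp (continuous_disc.comp (hc2 hf)))
  -- The root is the only nonlinear part of the eigenvector map. Its linear part is integrated
  -- against the weights, and only the quadratic remainder is estimated pointwise.
  set rem : ℝ → ℝ := fun u => root u - (w 0 u * (d 2 u - d 0 u) + w 1 u * (2 * d 1 u)) with hrem
  have hcrem : Continuous rem := by
    have := hcw 0; have := hcw 1; have := hcd 0; have := hcd 1; have := hcd 2
    fun_prop
  have hremI : |∫ u in (0 : ℝ)..t, rem u| ≤ 16 / s * δ ^ 2 * |t| := by
    have := intervalIntegral.norm_integral_le_of_norm_le_const (a := 0) (b := t) (f := rem)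
      (C := 16 / s * δ ^ 2) (fun u hu => by
        have hu' := uIoc_subset_uIcc hu
        refine (abs_sqrt_disc_sub_sub_le hs (hgap u hu')).trans ?_
        gcongr
        exact hδ u hu')
    simpa using this
  have I1 : ∀ j, IntervalIntegrable (d j) volume 0 t := fun j => (hcd j).intervalIntegrable _ _
  have I2 : ∀ i j, IntervalIntegrable (fun u => w i u * d j u) volume 0 t := fun i j =>
    ((hcw i).mul (hcd j)).intervalIntegrable _ _
  have I3 : IntervalIntegrable rem volume 0 t := hcrem.intervalIntegrable _ _
  have hrootI : ∫ u in (0 : ℝ)..t, root u = (∫ u in (0 : ℝ)..t, rem u) +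
      (∫ u in (0 : ℝ)..t, w 0 u * d 2 u) - (∫ u in (0 : ℝ)..t, w 0 u * d 0 u) +
      2 * ∫ u in (0 : ℝ)..t, w 1 u * d 1 u := by
    rw [← intervalIntegral.integral_const_mul, ← intervalIntegral.integral_add I3 (I2 0 2),
      ← intervalIntegral.integral_sub (I3.add (I2 0 2)) (I2 0 0),
      ← intervalIntegral.integral_add ((I3.add (I2 0 2)).sub (I2 0 0)) ((I2 1 1).const_mul 2)]
    congr 1; ext1 u
    simp only [hrem]
    ring
  have hrootB : |∫ u in (0 : ℝ)..t, root u| ≤ 4 * ε + 16 / s * δ ^ 2 * |t| := by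
    have a1 := abs_le.mp (hw 0 2)
    have a2 := abs_le.mp (hw 0 0)
    have a3 := abs_le.mp (hw 1 1)
    have a4 := abs_le.mp hremI
    rw [hrootI]
    exact abs_le.mpr ⟨by linarith [a1.1, a2.2, a3.1, a4.1], by linarith [a1.2, a2.1, a3.2, a4.2]⟩
  have hcV : Continuous fun u => V g (γ u) - V f (γ u) :=
    (hg.continuous_V.comp hγ).sub (hf.continuous_V.comp hγ)
  have hcomp : ∀ i : Fin 2, (∫ u in (0 : ℝ)..t, (V g (γ u) - V f (γ u))) i =
      ∫ u in (0 : ℝ)..t, (V g (γ u) - V f (γ u)) i := fun i =>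
    ((EuclideanSpace.proj i : Plane →L[ℝ] ℝ).intervalIntegral_comp_comm
      (hcV.intervalIntegrable 0 t)).symm
  have I4 : IntervalIntegrable root volume 0 t := hcroot.intervalIntegrable _ _
  have e0 : ∫ u in (0 : ℝ)..t, (V g (γ u) - V f (γ u)) 0 = 2 * (∫ u in (0 : ℝ)..t, d 0 u) -
      2 * (∫ u in (0 : ℝ)..t, d 2 u) + 2 * (∫ u in (0 : ℝ)..t, d 1 u) -
      2 * ∫ u in (0 : ℝ)..t, root u := by
    simp only [← intervalIntegral.integral_const_mul]
    rw [← intervalIntegral.integral_sub ((I1 0).const_mul 2) ((I1 2).const_mul 2),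
      ← intervalIntegral.integral_add (((I1 0).const_mul 2).sub ((I1 2).const_mul 2))
        ((I1 1).const_mul 2), ← intervalIntegral.integral_sub
        ((((I1 0).const_mul 2).sub ((I1 2).const_mul 2)).add ((I1 1).const_mul 2))
        (I4.const_mul 2)]
    congr 1; ext1 u
    simp only [PiLp.sub_apply, V, eigenvectorMap_zero, hd, hroot]
    ring
  have e1 : ∫ u in (0 : ℝ)..t, (V g (γ u) - V f (γ u)) 1 = (∫ u in (0 : ℝ)..t, d 2 u) -
      (∫ u in (0 : ℝ)..t, d 0 u) + 4 * (∫ u in (0 : ℝ)..t, d 1 u) -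
      ∫ u in (0 : ℝ)..t, root u := by
    simp only [← intervalIntegral.integral_const_mul]
    rw [← intervalIntegral.integral_sub (I1 2) (I1 0),
      ← intervalIntegral.integral_add ((I1 2).sub (I1 0)) ((I1 1).const_mul 4),
      ← intervalIntegral.integral_sub (((I1 2).sub (I1 0)).add ((I1 1).const_mul 4)) I4]
    congr 1; ext1 u
    simp only [PiLp.sub_apply, V, eigenvectorMap_one, hd, hroot]
    ring
  have b0 := abs_le.mp (h1 0)
  have b1 := abs_le.mp (h1 1)
  have b2 := abs_le.mp (h1 2)
  have b3 := abs_le.mp hrootB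
  refine (plane_norm_le _).trans ?_
  rw [hcomp, hcomp, e0, e1]
  have c0 : |2 * (∫ u in (0 : ℝ)..t, d 0 u) - 2 * (∫ u in (0 : ℝ)..t, d 2 u) +
      2 * (∫ u in (0 : ℝ)..t, d 1 u) - 2 * ∫ u in (0 : ℝ)..t, root u| ≤
      14 * ε + 2 * (16 / s * δ ^ 2 * |t|) :=
    abs_le.mpr ⟨by linarith [b0.1, b2.2, b1.1, b3.2], by linarith [b0.2, b2.1, b1.2, b3.1]⟩
  have c1 : |(∫ u in (0 : ℝ)..t, d 2 u) - (∫ u in (0 : ℝ)..t, d 0 u) +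
      4 * (∫ u in (0 : ℝ)..t, d 1 u) - ∫ u in (0 : ℝ)..t, root u| ≤
      10 * ε + 16 / s * δ ^ 2 * |t| :=
    abs_le.mpr ⟨by linarith [b0.2, b2.1, b1.1, b3.2], by linarith [b0.1, b2.2, b1.2, b3.1]⟩
  have c2 : 14 * ε + 2 * (16 / s * δ ^ 2 * |t|) + (10 * ε + 16 / s * δ ^ 2 * |t|) =
    24 * ε + 48 / s * δ ^ 2 * |t| := by ring
  linarith

/-! ### The deterministic bound for the filament times -/

theorem norm_secondDerivs_sub_le {f g : Plane → ℝ} {x : Plane} {δ : ℝ}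
    (h : ∀ i j, |pd [i, j] g x - pd [i, j] f x| ≤ δ) :
    ‖secondDerivs g x - secondDerivs f x‖ ≤ δ := by
  rw [pi_norm_le_iff_of_nonneg ((abs_nonneg _).trans (h 0 0))]
  intro k
  fin_cases k
  · exact h 0 0
  · exact h 0 1
  · exact h 1 1

theorem Tame.lipschitzWith_gapDir {f : Plane → ℝ} (hf : Tame f) {s : ℝ} (hs : 0 < s) (i : Fin 2) :
    ∃ K : ℝ≥0, LipschitzWith K fun x => gapDir s (secondDerivs f x) i := by
  obtain ⟨J, hJ⟩ := hf.lipschitzWith_jet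
  refine ⟨Real.toNNReal (8 / s) * J, LipschitzWith.of_dist_le_mul fun x y => ?_⟩
  have h1 := hJ.dist_le_mul x y
  rw [dist_eq_norm] at h1
  rw [Real.dist_eq, secondDerivs_eq, secondDerivs_eq, NNReal.coe_mul,
    Real.coe_toNNReal _ (by positivity), mul_assoc]
  exact (abs_gapDir_sub_le hs _ _ i).trans
    (mul_le_mul_of_nonneg_left ((norm_second_sub_le _ _).trans h1) (by positivity))

namespace FilamentAssumptions

variable {f : Plane → ℝ} {H L : Set Plane} {a : ℝ}

/-- The path from `x` is a time shift of the path from its filament point `y ∈ L`. An integral over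
a piece between the times `0` and `θ` is a difference of two integrals that start at `y` and run for
a time at most `a`, whence the factor 2. Path integrals are thus only needed for curves started on
`L`, where `mean_speed` applies. -/
theorem norm_integral_path_le (hf : Tame f) (hL : FilamentAssumptions f H L a)
    {g : Plane → ℝ} (hg : Tame g) {A : ℝ} (hA : ∀ y ∈ L, ∀ t, |t| ≤ a →
      ‖∫ u in (0 : ℝ)..t, (V g (path f y u) - V f (path f y u))‖ ≤ A) {x : Plane}
    (hx : x ∈ startingSet f L a) {s : ℝ} (hs : s ∈ uIcc 0 (theta f x)) :
    ‖∫ u in (0 : ℝ)..s, (V g (path f x u) - V f (path f x u))‖ ≤ 2 * A := by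
  set θ := theta f x
  set y := path f x θ
  set F : ℝ → Plane := fun u => V g (path f y u) - V f (path f y u)
  have hF : Continuous F := (hg.continuous_V.comp (hf.continuous_path y)).sub
    (hf.continuous_V.comp (hf.continuous_path y))
  have hy := hL.path_theta_mem hx
  have hθ := hL.abs_theta_le hf hx
  have e : ∀ u, V g (path f x u) - V f (path f x u) = F (u - θ) := fun u => by
    rw [path_eq hf x u]
  simp only [e]
  rw [intervalIntegral.integral_comp_sub_right, zero_sub,
    ← intervalIntegral.integral_interval_sub_left (hF.intervalIntegrable 0 _)
      (hF.intervalIntegrable 0 _)]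
  refine (norm_sub_le _ _).trans ?_
  have h1 := hA y hy (s - θ) (by
    rw [abs_sub_comm]
    exact (abs_sub_right_of_mem_uIcc hs).trans (by simpa using hθ))
  have h2 := hA y hy (-θ) (by simpa using hθ)
  linarith

/-- The eigenvalue gap is bounded below on the starting set. -/
theorem exists_gap_le (hL : FilamentAssumptions f H L a) (hf : Tame f)
    (hH : RegionAssumptions f H) : ∃ s : ℝ, 0 < s ∧ ∀ x ∈ startingSet f L a,
      s ≤ √(disc (secondDerivs f x)) := by
  have hc : Continuous fun x => √(disc (secondDerivs f x)) :=
    Real.continuous_sqrt.comp (continuous_disc.comp (continuous_second.comp hf.continuous_jet))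
  rcases (startingSet f L a).eq_empty_or_nonempty with h | h
  · exact ⟨1, one_pos, by simp [h]⟩
  · obtain ⟨x₀, hx₀, hmin⟩ := (hL.isCompact_startingSet hf hH).exists_isMinOn h hc.continuousOn
    have := disc_ne_zero hf (hH.distinct_eigenvalues _ (hL.starting_subset hx₀))
    exact ⟨_, Real.sqrt_pos.mpr (lt_of_le_of_ne (disc_nonneg _) this.symm), hmin⟩

set_option maxHeartbeats 1000000 in
/-- The bounds on the uniform deviations of the filament times in terms of the deviations of the
partial derivatives, and of their integrals along the integral curves. -/
theorem deterministic_bound (hL : FilamentAssumptions f H L a) (hf : Tame f)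
    (hH : RegionAssumptions f H) :
    ∃ (R η C : ℝ) (w : Fin 3 → Plane → ℝ), 0 < η ∧ 0 ≤ C ∧
      (∀ k x, |w k x| ≤ 1) ∧ (∀ k, ∃ K : ℝ≥0, LipschitzWith K (w k)) ∧
      (∀ y ∈ L, ∀ t, |t| ≤ a → ‖path f y t‖ ≤ R) ∧
      ∀ g, Tame g → Close R η f g →
        (∀ x ∈ startingSet f L a, ∃! t, IsArgminAbs (filamentTimes g x) t) ∧
        ∀ δ₁ δ₂ : ℝ, (∀ i x, ‖x‖ ≤ R → |pd [i] g x - pd [i] f x| ≤ δ₁) →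
          (∀ i j x, ‖x‖ ≤ R → |pd [i, j] g x - pd [i, j] f x| ≤ δ₂) →
          (∀ x ∈ startingSet f L a, |theta g x - theta f x| ≤ C * (δ₁ + δ₂)) ∧
          ((∀ x ∈ startingSet f L a, ∇ f (path f x (theta f x)) = 0) →
            ∀ ε : ℝ, (∀ y ∈ L, ∀ t, |t| ≤ a → ∀ k i j, |∫ u in (0 : ℝ)..t, w k (path f y u) *
              (pd [i, j] g (path f y u) - pd [i, j] f (path f y u))| ≤ ε) →
            ∀ x ∈ startingSet f L a, |theta g x - theta f x| ≤ C * (δ₁ + ε + δ₂ ^ 2)) := by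
  obtain ⟨r, hr⟩ := hL.exists_norm_le hH
  have ha := hL.pos
  obtain ⟨R, Λ, hB⟩ := hf.exists_pathBounds r (T := a + 1) (by linarith)
  obtain ⟨η, C, hη, hθ⟩ := hL.exists_theta_sub_le hf hH hr hB
  obtain ⟨M, hM⟩ := hf.norm_V_le
  have hM0 : 0 ≤ M := (norm_nonneg _).trans (hM 0)
  obtain ⟨K, hK⟩ := hf.exists_lipschitzWith
  obtain ⟨K', hK'⟩ := hf.lipschitzWith_V
  obtain ⟨B₀, hB₀⟩ := hf.bounded [0] (by simp) (by simp)
  obtain ⟨B₁, hB₁⟩ := hf.bounded [1] (by simp) (by simp)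
  have hB00 : 0 ≤ B₀ := (abs_nonneg _).trans (hB₀ 0)
  have hB10 : 0 ≤ B₁ := (abs_nonneg _).trans (hB₁ 0)
  have hpart : ∀ i x, |partialDeriv i f x| ≤ B₀ + B₁ := by
    intro i x
    fin_cases i
    · exact (hB₀ x).trans (by linarith)
    · exact (hB₁ x).trans (by linarith)
  obtain ⟨s, hs, hgap⟩ := hL.exists_gap_le hf hH
  -- The first two weights come from the derivative of the root; the constant weight accounts for
  -- the linear part of the eigenvector map.
  set w : Fin 3 → Plane → ℝ := ![fun x => gapDir s (secondDerivs f x) 0,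
    fun x => gapDir s (secondDerivs f x) 1, fun _ => 1] with hw
  have hwL := hf.lipschitzWith_gapDir hs
  set A₁ := M + 24 with hA₁
  -- `Q` belongs to the crude bound, with displacement at most `Λ * (24 * δ₂ * (a + 1))`; `E` below
  -- bounds the displacement by `E * (ε + δ₂ ^ 2)` in the refined one. Their combination serves as
  -- one constant for both.
  set Q : ℝ := 2 * (A₁ * (K * (Λ * (a + 1) * 24)) + A₁ + (B₀ + B₁) * (24 + K' * (Λ * (a + 1) * 24)))
    with hQ
  set E : ℝ := Λ * (48 + 96 / s * a) with hE
  have hΛ := hB.nonneg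
  have hE0 : 0 ≤ E := by positivity
  have hQ0 : 0 ≤ Q := by positivity
  refine ⟨R, min 1 η, |C| * (Q + 2 * A₁ * (1 + K * E)), w, lt_min one_pos hη, by positivity, ?_, ?_,
    ?_, ?_⟩
  · intro k x
    fin_cases k
    · exact abs_gapDir_le hs _ 0
    · exact abs_gapDir_le hs _ 1
    · simp [hw]
  · intro k
    fin_cases k
    · exact hwL 0
    · exact hwL 1
    · exact ⟨0, LipschitzWith.const 1⟩
  · intro y hy t ht
    exact hB.norm_le f hf (Close.refl zero_le_one f) y (hr _ (hL.subset_startingSet hf hy)) t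
      (by linarith)
  intro g hg hc
  have hc1 : Close R 1 f g := hc.mono (min_le_left _ _)
  have hcη : Close R η f g := hc.mono (min_le_right _ _)
  refine ⟨fun x hx => (hθ x hx g hg hcη).1, fun δ₁ δ₂ h1 h2 => ?_⟩
  have hVg : ∀ z, ‖z‖ ≤ R → ‖V g z‖ ≤ A₁ := by
    intro z hz
    have h3 := (norm_V_sub_le f g z z).trans
      (mul_le_mul_of_nonneg_left (hc1.norm_jet_sub_le hz) (by norm_num))
    linarith [norm_sub_norm_le (V g z) (V f z), hM z]
  have hVδ : ∀ z, ‖z‖ ≤ R → ‖V g z - V f z‖ ≤ 24 * δ₂ := fun z hz =>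
    (norm_eigenvectorMap_sub_le _ _).trans (mul_le_mul_of_nonneg_left
      (norm_secondDerivs_sub_le fun i j => h2 i j z hz) (by norm_num))
  have hslope : ∀ x ∈ startingSet f L a, ∀ B : ℝ,
      (∀ i, |partialDeriv i f (path f x (theta f x))| ≤ B) →
      ∀ D, ‖path g x (theta f x) - path f x (theta f x)‖ ≤ D →
      |slope g (path g x (theta f x))| ≤
        2 * (A₁ * (δ₁ + K * D) + B * (24 * δ₂ + K' * D)) := by
    intro x hx B hB' D hD
    have hz := hB.norm_le g hg hc1 x (hr x hx) (theta f x)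
      ((hL.abs_theta_le hf hx).trans (by linarith))
    set z := path g x (theta f x)
    set y := path f x (theta f x)
    have h3 : slope f y = 0 := (hL.filament _ (hL.path_theta_mem hx)).1
    have := abs_slope_sub_le (f := f) (g := g) (y := y) (z := z) (δ := δ₁ + K * D)
      (δ' := 24 * δ₂ + K' * D) (hVg z hz) hB' (fun i => by
        have e1 := h1 i z hz
        have e2 := (hK [i] (by simp)).dist_le_mul z y
        rw [Real.dist_eq, dist_eq_norm] at e2
        calc _ = |(pd [i] g z - pd [i] f z) + (pd [i] f z - pd [i] f y)| := by simp [pd]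
          _ ≤ _ := (abs_add_le _ _).trans (add_le_add e1 (e2.trans (by gcongr))))
      (by
        have e2 := hK'.dist_le_mul z y
        rw [dist_eq_norm, dist_eq_norm] at e2
        calc _ = ‖(V g z - V f z) + (V f z - V f y)‖ := by simp
          _ ≤ _ := (norm_add_le _ _).trans (add_le_add (hVδ z hz) (e2.trans (by gcongr))))
    rwa [h3, sub_zero] at this
  have hfin : ∀ x ∈ startingSet f L a, ∀ S, |slope g (path g x (theta f x))| ≤ S →
      |theta g x - theta f x| ≤ |C| * S := by
    intro x hx S hS
    refine (hθ x hx g hg hcη).2.trans ?_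
    exact (mul_le_mul_of_nonneg_right (le_abs_self C) (abs_nonneg _)).trans
      (mul_le_mul_of_nonneg_left hS (abs_nonneg C))
  constructor
  · intro x hx
    have hz := hr x hx
    have hR0 : ‖path f x 0‖ ≤ R := hB.norm_le f hf (Close.refl zero_le_one f) x hz 0
      (by simpa using by linarith)
    have hδ₁ : 0 ≤ δ₁ := (abs_nonneg _).trans (h1 0 _ hR0)
    have hδ₂ : 0 ≤ δ₂ := (abs_nonneg _).trans (h2 0 0 _ hR0)
    have h3 := hB.norm_sub_le_of_close hf hg hc1 hVδ hz hz (t := theta f x)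
      ((hL.abs_theta_le hf hx).trans (by linarith))
    rw [sub_self, norm_zero, zero_add] at h3
    refine (hfin x hx _ (hslope x hx (B₀ + B₁) (fun i => hpart i _) _ h3)).trans ?_
    rw [mul_assoc |C|]
    refine mul_le_mul_of_nonneg_left ?_ (abs_nonneg C)
    have e1 : 2 * (A₁ * (δ₁ + K * (Λ * (24 * δ₂ * (a + 1)))) +
        (B₀ + B₁) * (24 * δ₂ + K' * (Λ * (24 * δ₂ * (a + 1))))) ≤ Q * (δ₁ + δ₂) := by
      have : Q * (δ₁ + δ₂) - 2 * (A₁ * (δ₁ + K * (Λ * (24 * δ₂ * (a + 1)))) +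
        (B₀ + B₁) * (24 * δ₂ + K' * (Λ * (24 * δ₂ * (a + 1))))) =
        2 * (A₁ * (K * (Λ * (a + 1) * 24)) + (B₀ + B₁) * (24 + K' * (Λ * (a + 1) * 24))) * δ₁ +
          2 * A₁ * δ₂ := by rw [hQ]; ring
      have : 0 ≤ 2 * (A₁ * (K * (Λ * (a + 1) * 24)) +
        (B₀ + B₁) * (24 + K' * (Λ * (a + 1) * 24))) * δ₁ + 2 * A₁ * δ₂ := by positivity
      linarith
    refine e1.trans ?_
    gcongr
    exact le_add_of_nonneg_right (by positivity)
  · intro hgrad ε hε x hx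
    have hz := hr x hx
    have hR0 : ‖path f x 0‖ ≤ R := hB.norm_le f hf (Close.refl zero_le_one f) x hz 0
      (by simpa using by linarith)
    have hδ₁ : 0 ≤ δ₁ := (abs_nonneg _).trans (h1 0 _ hR0)
    have hyL := hL.path_theta_mem hx
    have hε0 : 0 ≤ ε := (abs_nonneg _).trans (hε _ hyL 0 (by simpa using ha.le) 0 0 0)
    have hA : ∀ y ∈ L, ∀ t, |t| ≤ a →
        ‖∫ u in (0 : ℝ)..t, (V g (path f y u) - V f (path f y u))‖ ≤
          24 * ε + 48 / s * δ₂ ^ 2 * a := by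
      intro y hy t ht
      have hu : ∀ u ∈ uIcc 0 t, |u| ≤ a := by
        intro u hu
        have := abs_sub_left_of_mem_uIcc hu
        simp only [sub_zero] at this
        linarith
      have hcomp : ∀ j : Fin 3, ∃ i k : Fin 2, ∀ (g : Plane → ℝ) x,
          secondDerivs g x j = pd [i, k] g x := by
        intro j
        fin_cases j
        · exact ⟨0, 0, fun _ _ => rfl⟩
        · exact ⟨0, 1, fun _ _ => rfl⟩
        · exact ⟨1, 1, fun _ _ => rfl⟩
      refine (norm_integral_V_sub_le hf hg (hf.continuous_path y) (δ := δ₂) (ε := ε) hs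
        (fun u hu' => hgap _ ⟨y, hy, u, abs_le.mp (hu u hu'), rfl⟩)
        (fun u hu' => norm_secondDerivs_sub_le fun i j => h2 i j _
          (hB.norm_le f hf (Close.refl zero_le_one f) y (hr _ (hL.subset_startingSet hf hy)) u
            (by linarith [hu u hu']))) ?_ ?_).trans ?_
      · intro j
        obtain ⟨i, k, hik⟩ := hcomp j
        simp only [hik]
        simpa [hw] using hε y hy t ht 2 i k
      · intro b j
        obtain ⟨i, k, hik⟩ := hcomp j
        simp only [hik]
        fin_cases b
        · exact hε y hy t ht 0 i k
        · exact hε y hy t ht 1 i k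
      · gcongr
    have h3 := hB.norm_sub_le g hg hc1 x x hz hz (theta f x) _
      ((hL.abs_theta_le hf hx).trans (by linarith))
      (fun u hu => norm_integral_path_le hf hL hg hA hx hu)
    rw [sub_self, norm_zero, zero_add] at h3
    have h4 : Λ * (2 * (24 * ε + 48 / s * δ₂ ^ 2 * a)) ≤ E * (ε + δ₂ ^ 2) := by
      have e1 : E * (ε + δ₂ ^ 2) - Λ * (2 * (24 * ε + 48 / s * δ₂ ^ 2 * a)) =
        Λ * (96 / s * a) * ε + Λ * 48 * δ₂ ^ 2 := by rw [hE]; ring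
      have e2 : 0 ≤ Λ * (96 / s * a) * ε + Λ * 48 * δ₂ ^ 2 := by positivity
      linarith
    refine (hfin x hx _ (hslope x hx 0 (fun i => by
      rw [partialDeriv_eq_zero_of_gradient (hgrad x hx), abs_zero]) _ (h3.trans h4))).trans ?_
    rw [mul_assoc |C|]
    refine mul_le_mul_of_nonneg_left ?_ (abs_nonneg C)
    have e1 : 2 * (A₁ * (δ₁ + K * (E * (ε + δ₂ ^ 2))) + 0 * (24 * δ₂ + K' * (E * (ε + δ₂ ^ 2)))) ≤
        2 * A₁ * (1 + K * E) * (δ₁ + ε + δ₂ ^ 2) := by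
      have e2 : 2 * A₁ * (1 + K * E) * (δ₁ + ε + δ₂ ^ 2) - 2 * (A₁ * (δ₁ + K * (E * (ε + δ₂ ^ 2))) +
        0 * (24 * δ₂ + K' * (E * (ε + δ₂ ^ 2)))) = 2 * A₁ * (K * E * δ₁ + (ε + δ₂ ^ 2)) := by ring
      have e3 : 0 ≤ 2 * A₁ * (K * E * δ₁ + (ε + δ₂ ^ 2)) := by positivity
      linarith
    refine e1.trans ?_
    gcongr
    exact le_add_of_nonneg_left hQ0

end FilamentAssumptions

/-! ### An exponential inequality -/

theorem integrable_of_abs_le {α : Type*} [MeasurableSpace α] {ν : Measure α} [IsFiniteMeasure ν]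
    {ξ : α → ℝ} (hm : Measurable ξ) {b : ℝ} (hb : ∀ x, |ξ x| ≤ b) : Integrable ξ ν :=
  Integrable.of_bound hm.aestronglyMeasurable b (Eventually.of_forall hb)

/-- The centred variable is at most `2 * b`, so the exponent stays in `[-1, 1]`, where `exp y ≤ 1 +
y + y ^ 2`. The linear term has mean zero, the variance is at most the second moment, and `1 + u ≤
exp u` finishes. -/
theorem integral_exp_le {α : Type*} [MeasurableSpace α] {ν : Measure α} [IsProbabilityMeasure ν]
    {ξ : α → ℝ} (hm : Measurable ξ) {b v t : ℝ} (hb : ∀ x, |ξ x| ≤ b) (hv : ∫ x, ξ x ^ 2 ∂ν ≤ v)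
    (ht : |t| * (2 * b) ≤ 1) :
    ∫ x, Real.exp (t * (ξ x - ∫ y, ξ y ∂ν)) ∂ν ≤ Real.exp (t ^ 2 * v) := by
  set m := ∫ y, ξ y ∂ν with hm'
  have hint : Integrable ξ ν := integrable_of_abs_le hm hb
  have hint2 : Integrable (fun x => ξ x ^ 2) ν :=
    integrable_of_abs_le (hm.pow_const 2) (b := b ^ 2) fun x => by
      rw [abs_pow]; exact pow_le_pow_left₀ (abs_nonneg _) (hb x) 2
  have hmb : |m| ≤ b := by
    simpa using norm_integral_le_of_norm_le_const (μ := ν) (f := ξ) (Eventually.of_forall hb)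
  have hy : ∀ x, |t * (ξ x - m)| ≤ 1 := by
    intro x
    rw [abs_mul]
    refine le_trans ?_ ht
    gcongr
    linarith [abs_sub (ξ x) m, hb x]
  have hpt : ∀ x, Real.exp (t * (ξ x - m)) ≤ 1 + t * (ξ x - m) + (t * (ξ x - m)) ^ 2 := by
    intro x
    have := (abs_le.mp (Real.abs_exp_sub_one_sub_id_le (hy x))).2
    linarith
  have e : ∀ x, 1 + t * (ξ x - m) + (t * (ξ x - m)) ^ 2 =
      (1 - t * m + t ^ 2 * m ^ 2) + (t - 2 * t ^ 2 * m) * ξ x + t ^ 2 * ξ x ^ 2 := fun x => by ring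
  have hi1 : Integrable (fun x => (1 - t * m + t ^ 2 * m ^ 2) + (t - 2 * t ^ 2 * m) * ξ x +
      t ^ 2 * ξ x ^ 2) ν :=
    ((integrable_const _).add (hint.const_mul _)).add (hint2.const_mul _)
  calc ∫ x, Real.exp (t * (ξ x - m)) ∂ν
      ≤ ∫ x, ((1 - t * m + t ^ 2 * m ^ 2) + (t - 2 * t ^ 2 * m) * ξ x + t ^ 2 * ξ x ^ 2) ∂ν := by
        refine integral_mono ?_ hi1 fun x => (hpt x).trans (e x).le
        refine integrable_of_abs_le (by fun_prop) (b := Real.exp 1) fun x => ?_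
        rw [abs_of_pos (Real.exp_pos _), Real.exp_le_exp]
        exact (le_abs_self _).trans (hy x)
    _ = (1 - t * m + t ^ 2 * m ^ 2) + (t - 2 * t ^ 2 * m) * m + t ^ 2 * ∫ x, ξ x ^ 2 ∂ν := by
        have i1 : Integrable (fun x => (1 - t * m + t ^ 2 * m ^ 2) + (t - 2 * t ^ 2 * m) * ξ x) ν :=
          (integrable_const _).add (hint.const_mul _)
        rw [integral_add i1 (hint2.const_mul _),
          integral_add (integrable_const _) (hint.const_mul _), integral_const_mul,
          integral_const_mul]
        simp [hm']
    _ ≤ t ^ 2 * v + 1 := by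
        have h1 : t ^ 2 * ∫ x, ξ x ^ 2 ∂ν ≤ t ^ 2 * v := by gcongr
        nlinarith [sq_nonneg (t * m)]
    _ ≤ _ := Real.add_one_le_exp _

/-- The law of the observations. -/
def densityMeasure (f : Plane → ℝ) : Measure Plane :=
  volume.withDensity fun x => ENNReal.ofReal (f x)

namespace IsSample

variable {Ω : Type*} [MeasurableSpace Ω] {P : Measure Ω}
  {X : ℕ → Ω → Plane} {f : Plane → ℝ}

theorem isProbabilityMeasure [IsProbabilityMeasure P] (hX : IsSample P X f) :
    IsProbabilityMeasure (densityMeasure f) := by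
  rw [densityMeasure, ← hX.law 0]
  exact Measure.isProbabilityMeasure_map (hX.measurable 0).aemeasurable

theorem integral_comp (hX : IsSample P X f) (i : ℕ) {φ : Plane → ℝ} (hφ : Measurable φ) :
    ∫ ω, φ (X i ω) ∂P = ∫ x, φ x ∂(densityMeasure f) := by
  rw [densityMeasure, ← hX.law i,
    integral_map (hX.measurable i).aemeasurable hφ.aestronglyMeasurable]

/-- Chernoff's bound: by independence the moment generating function of the sum is a product of
factors bounded by `integral_exp_le`. The parameter `t` is left free, to be optimized later. -/
theorem measure_le_sum_le [IsProbabilityMeasure P] (hX : IsSample P X f) {ξ : Plane → ℝ} (hm : Measurable ξ)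
    {b v t ε : ℝ} (hb : ∀ x, |ξ x| ≤ b) (hv : ∫ x, ξ x ^ 2 ∂(densityMeasure f) ≤ v)
    (ht0 : 0 ≤ t) (ht : t * (2 * b) ≤ 1) (n : ℕ) :
    P.real {ω | ε ≤ ∑ i ∈ Finset.range n, (ξ (X i ω) - ∫ x, ξ x ∂(densityMeasure f))} ≤
      Real.exp (-t * ε + n * (t ^ 2 * v)) := by
  have := hX.isProbabilityMeasure
  set m := ∫ x, ξ x ∂(densityMeasure f)
  set Y : ℕ → Ω → ℝ := fun i ω => ξ (X i ω) - m with hY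
  have hYm : ∀ i, Measurable (Y i) := fun i => (hm.comp (hX.measurable i)).sub_const m
  have hind : iIndepFun Y P := hX.indep.comp (fun _ x => ξ x - m) fun _ => hm.sub_const m
  have hsum : (fun ω => ∑ i ∈ Finset.range n, (ξ (X i ω) - m)) = ∑ i ∈ Finset.range n, Y i := by
    ext ω; simp [hY]
  have hmgf : ∀ i, mgf (Y i) P t ≤ Real.exp (t ^ 2 * v) := by
    intro i
    have h1 : mgf (Y i) P t = ∫ x, Real.exp (t * (ξ x - m)) ∂(densityMeasure f) := by
      rw [mgf, ← hX.integral_comp i (φ := fun x => Real.exp (t * (ξ x - m))) (by fun_prop)]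
    rw [h1]
    exact integral_exp_le hm hb hv (by rwa [abs_of_nonneg ht0])
  have hbd : ∀ i ω, |Y i ω| ≤ b + |m| := fun i ω =>
    (abs_sub _ _).trans (add_le_add (hb _) le_rfl)
  have hint : Integrable (fun ω => Real.exp (t * (∑ i ∈ Finset.range n, Y i) ω)) P := by
    refine integrable_of_abs_le ?_ (b := Real.exp (t * (n * (b + |m|)))) fun ω => ?_
    · have : Measurable (∑ i ∈ Finset.range n, Y i) := by
        rw [← hsum]
        exact Finset.measurable_sum _ fun i _ => hYm i
      exact Real.measurable_exp.comp (this.const_mul t)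
    · rw [abs_of_pos (Real.exp_pos _), Real.exp_le_exp, Finset.sum_apply]
      refine mul_le_mul_of_nonneg_left ?_ ht0
      calc ∑ i ∈ Finset.range n, Y i ω ≤ ∑ i ∈ Finset.range n, (b + |m|) :=
            Finset.sum_le_sum fun i _ => (le_abs_self _).trans (hbd i ω)
        _ = _ := by rw [Finset.sum_const, Finset.card_range, nsmul_eq_mul]
  have h2 := measure_ge_le_exp_mul_mgf (μ := P) (X := ∑ i ∈ Finset.range n, Y i) ε ht0 hint
  rw [hind.mgf_sum hYm] at h2
  have h3 : ∏ i ∈ Finset.range n, mgf (Y i) P t ≤ Real.exp (t ^ 2 * v) ^ n := by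
    calc _ ≤ ∏ i ∈ Finset.range n, Real.exp (t ^ 2 * v) :=
          Finset.prod_le_prod (fun i _ => mgf_nonneg) fun i _ => hmgf i
      _ = _ := by simp
  rw [← hsum] at h2
  refine h2.trans ?_
  rw [Real.exp_add, ← Real.exp_nat_mul] at *
  gcongr

theorem measure_le_abs_sum_le [IsProbabilityMeasure P] (hX : IsSample P X f) {ξ : Plane → ℝ} (hm : Measurable ξ)
    {b v t ε : ℝ} (hb : ∀ x, |ξ x| ≤ b) (hv : ∫ x, ξ x ^ 2 ∂(densityMeasure f) ≤ v)
    (ht0 : 0 ≤ t) (ht : t * (2 * b) ≤ 1) (n : ℕ) :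
    P {ω | ε ≤ |∑ i ∈ Finset.range n, (ξ (X i ω) - ∫ x, ξ x ∂(densityMeasure f))|} ≤
      ENNReal.ofReal (2 * Real.exp (-t * ε + n * (t ^ 2 * v))) := by
  have h1 := hX.measure_le_sum_le hm hb hv ht0 ht n (ε := ε)
  have h2 := hX.measure_le_sum_le hm.neg (by simpa using hb) (by simpa using hv) ht0 ht n (ε := ε)
  have hsub : {ω | ε ≤ |∑ i ∈ Finset.range n, (ξ (X i ω) - ∫ x, ξ x ∂(densityMeasure f))|} ⊆
      {ω | ε ≤ ∑ i ∈ Finset.range n, (ξ (X i ω) - ∫ x, ξ x ∂(densityMeasure f))} ∪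
      {ω | ε ≤ ∑ i ∈ Finset.range n, ((-ξ) (X i ω) - ∫ x, (-ξ) x ∂(densityMeasure f))} := by
    intro ω hω
    rw [mem_ofPred_eq] at hω
    rcases le_abs.mp hω with h | h
    · exact Or.inl h
    · right
      change ε ≤ _
      refine h.trans_eq ?_
      rw [← Finset.sum_neg_distrib]
      refine Finset.sum_congr rfl fun i _ => ?_
      simp only [Pi.neg_apply, integral_neg]
      ring
  refine (measure_mono hsub).trans ((measure_union_le _ _).trans ?_)
  rw [two_mul, ENNReal.ofReal_add (Real.exp_pos _).le (Real.exp_pos _).le]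
  exact add_le_add ((ENNReal.le_ofReal_iff_toReal_le (measure_ne_top _ _) (Real.exp_pos _).le).mpr h1)
    ((ENNReal.le_ofReal_iff_toReal_le (measure_ne_top _ _) (Real.exp_pos _).le).mpr h2)

end IsSample

/-! ### Finite nets -/

/-- The three coordinates are cut into cells of side `ρ / 2`, and one point of `T` is taken from
each occupied cell. The net must lie in `T`, because the bounds on the functions are assumed there
only. -/
theorem exists_finite_net {T : Set (Plane × ℝ)} (hT : Bornology.IsBounded T) :
    ∃ C : ℝ, ∀ ρ : ℝ, 0 < ρ → ρ ≤ 1 → ∃ F : Finset (Plane × ℝ), (F : Set (Plane × ℝ)) ⊆ T ∧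
      (F.card : ℝ) ≤ C / ρ ^ 3 ∧ ∀ p ∈ T, ∃ q ∈ F, dist p q ≤ ρ := by
  obtain ⟨r, hr⟩ := hT.exists_norm_le
  refine ⟨(4 * |r| + 5) ^ 3, fun ρ hρ hρ1 => ?_⟩
  set c : Plane × ℝ → ℤ × ℤ × ℤ := fun p =>
    (⌊p.1 0 * (2 / ρ)⌋, ⌊p.1 1 * (2 / ρ)⌋, ⌊p.2 * (2 / ρ)⌋) with hc
  set N : ℕ := ⌈|r| * (2 / ρ)⌉₊ + 1 with hN
  set I : Finset ℤ := Finset.Icc (-(N : ℤ)) N with hI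
  have hfloor : ∀ x : ℝ, |x| ≤ |r| → ⌊x * (2 / ρ)⌋ ∈ I := by
    intro x hx
    have h1 : |x * (2 / ρ)| ≤ ⌈|r| * (2 / ρ)⌉₊ := by
      rw [abs_mul, abs_of_pos (by positivity : 0 < 2 / ρ)]
      exact (mul_le_mul_of_nonneg_right hx (by positivity)).trans (Nat.le_ceil _)
    have h2 := abs_le.mp h1
    rw [hI, Finset.mem_Icc]
    constructor
    · rw [Int.le_floor]; push_cast [hN]; linarith
    · have : ⌊x * (2 / ρ)⌋ ≤ (⌈|r| * (2 / ρ)⌉₊ : ℤ) := by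
        rw [← Int.cast_le (R := ℝ)]
        exact (Int.floor_le _).trans (by exact_mod_cast h2.2)
      rw [hN]; push_cast; linarith
  have himg : c '' T ⊆ ((I ×ˢ I ×ˢ I : Finset (ℤ × ℤ × ℤ)) : Set (ℤ × ℤ × ℤ)) := by
    rintro _ ⟨p, hp, rfl⟩
    have hpr : ‖p‖ ≤ |r| := (hr p hp).trans (le_abs_self r)
    have h1 : ‖p.1‖ ≤ |r| := (norm_fst_le p).trans hpr
    have h2 : |p.2| ≤ |r| := (norm_snd_le p).trans hpr
    simp only [Finset.mem_coe, Finset.mem_product, hc]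
    exact ⟨hfloor _ ((abs_apply_le_norm _ _).trans h1), hfloor _ ((abs_apply_le_norm _ _).trans h1),
      hfloor _ h2⟩
  obtain ⟨T', hT', hbij⟩ := Set.exists_subset_bijOn T c
  have hfin : T'.Finite := by
    refine Set.Finite.of_finite_image ?_ hbij.injOn
    rw [hbij.image_eq]
    exact (Finset.finite_toSet _).subset himg
  refine ⟨hfin.toFinset, by simpa using hT', ?_, fun p hp => ?_⟩
  · have h1 : hfin.toFinset.card ≤ (I ×ˢ I ×ˢ I).card := by
      refine Finset.card_le_card_of_injOn c (fun p hp => ?_) (by simpa using hbij.injOn)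
      exact himg ⟨p, hT' (by simpa using hp), rfl⟩
    have h2 : (I.card : ℝ) ≤ (4 * |r| + 5) / ρ := by
      have e1 : I.card = 2 * N + 1 := by
        rw [hI, Int.card_Icc]; omega
      have e2 : (⌈|r| * (2 / ρ)⌉₊ : ℝ) ≤ |r| * (2 / ρ) + 1 :=
        (Nat.ceil_lt_add_one (by positivity)).le
      rw [e1, le_div_iff₀ hρ]
      push_cast [hN]
      have e3 : |r| * (2 / ρ) * ρ = 2 * |r| := by field_simp
      nlinarith
    have h3 : ((I ×ˢ I ×ˢ I).card : ℝ) = (I.card : ℝ) ^ 3 := by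
      rw [Finset.card_product, Finset.card_product]; push_cast; ring
    calc (hfin.toFinset.card : ℝ) ≤ ((I ×ˢ I ×ˢ I).card : ℝ) := by exact_mod_cast h1
      _ = (I.card : ℝ) ^ 3 := h3
      _ ≤ ((4 * |r| + 5) / ρ) ^ 3 := by gcongr
      _ = _ := by rw [div_pow]
  · obtain ⟨q, hq, hqc⟩ := hbij.surjOn ⟨p, hp, rfl⟩
    refine ⟨q, by simpa using hq, ?_⟩
    simp only [hc, Prod.mk.injEq] at hqc
    have hdiff : ∀ x y : ℝ, ⌊y * (2 / ρ)⌋ = ⌊x * (2 / ρ)⌋ → |x - y| ≤ ρ / 2 := by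
      intro x y h
      have := Int.abs_sub_lt_one_of_floor_eq_floor h.symm
      rw [← sub_mul, abs_mul, abs_of_pos (by positivity : 0 < 2 / ρ), ← lt_div_iff₀ (by positivity)]
        at this
      rw [one_div_div] at this
      exact this.le
    rw [dist_eq_norm, Prod.norm_def]
    refine max_le ?_ ?_
    · refine (plane_norm_le _).trans ?_
      have h0 := hdiff _ _ hqc.1
      have h1 := hdiff _ _ hqc.2.1
      simp only [Prod.fst_sub, PiLp.sub_apply]
      linarith
    · have h2 := hdiff _ _ hqc.2.2
      rw [Prod.snd_sub, Real.norm_eq_abs]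
      linarith

/-! ### Uniform deviations of empirical means -/

theorem IsSample.tendsto_measure_uniform_deviation {Ω : Type*} [MeasurableSpace Ω] {P : Measure Ω}
    [IsProbabilityMeasure P] {X : ℕ → Ω → Plane} {f : Plane → ℝ} (hX : IsSample P X f)
    {T : Set (Plane × ℝ)} (hT : Bornology.IsBounded T) {ξ : ℕ → Plane × ℝ → Plane → ℝ}
    {b v Λ : ℕ → ℝ} (hm : ∀ n, ∀ p ∈ T, Measurable (ξ n p))
    (hb : ∀ᶠ n in atTop, ∀ p ∈ T, ∀ x, |ξ n p x| ≤ b n)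
    (hv : ∀ᶠ n in atTop, ∀ p ∈ T, ∫ x, ξ n p x ^ 2 ∂(densityMeasure f) ≤ v n)
    (hlip : ∀ᶠ n in atTop, ∀ p ∈ T, ∀ q ∈ T, ∀ x, |ξ n p x - ξ n q x| ≤ Λ n * dist p q)
    (hΛ : ∀ᶠ n : ℕ in atTop, Λ n ≤ n) (hv1 : ∀ᶠ n in atTop, 1 ≤ v n)
    (hbv : ∀ᶠ n : ℕ in atTop, 4 * b n ^ 2 * Real.log n ≤ n * v n) :
    Tendsto (fun n : ℕ => P {ω | ¬ ∀ p ∈ T, |1 / (n : ℝ) * ∑ i ∈ Finset.range n, ξ n p (X i ω) -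
      ∫ x, ξ n p x ∂(densityMeasure f)| ≤ 10 * √(v n * Real.log n / n)}) atTop (𝓝 0) := by
  have := hX.isProbabilityMeasure
  obtain ⟨C, hC⟩ := exists_finite_net hT
  have hlim : Tendsto (fun n : ℕ => ENNReal.ofReal (2 * C * (n : ℝ)⁻¹)) atTop (𝓝 0) := by
    have h1 : Tendsto (fun n : ℕ => 2 * C * (n : ℝ)⁻¹) atTop (𝓝 0) := by
      simpa using (tendsto_inv_atTop_nhds_zero_nat (𝕜 := ℝ)).const_mul (2 * C)
    simpa using ENNReal.tendsto_ofReal h1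
  refine tendsto_of_tendsto_of_tendsto_of_le_of_le' tendsto_const_nhds hlim
    (Eventually.of_forall fun _ => zero_le) ?_
  filter_upwards [hb, hv, hlip, hΛ, hv1, hbv, eventually_ge_atTop 3] with n hb hv hlip hΛ hv1 hbv hn
  have hn0 : (0 : ℝ) < n := by positivity
  have hn3 : (3 : ℝ) ≤ n := by exact_mod_cast hn
  have hlog : 1 ≤ Real.log n := by
    rw [Real.le_log_iff_exp_le hn0]
    exact (Real.exp_one_lt_d9.le.trans (by norm_num)).trans hn3
  set α := √(v n * Real.log n / n) with hα
  have hα1 : 1 / (n : ℝ) ≤ α := by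
    rw [hα]
    refine Real.le_sqrt_of_sq_le ?_
    rw [div_pow, one_pow, div_le_div_iff₀ (by positivity) hn0]
    have h1 : 1 ≤ v n * Real.log n := one_le_mul_of_one_le_of_one_le hv1 hlog
    nlinarith
  -- With Lipschitz constants at most `n`, this mesh changes the functions by at most `1 / n ≤ α`,
  -- once in the empirical mean and once in the expectation. That explains `10 * α` against `8 * α`
  -- on the net. The net has at most `C * n ^ 6` points.
  set ρ : ℝ := 1 / (n : ℝ) ^ 2 with hρ
  have hρ0 : 0 < ρ := by positivity
  obtain ⟨F, hFT, hFc, hF⟩ := hC ρ hρ0 (by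
    rw [hρ, div_le_one (by positivity)]; nlinarith)
  -- This choice gives `t * (n * α) = log n` and `n * t ^ 2 * v n = log n`, so the exponent is `-8 *
  -- log n + log n`. Each net point fails with probability at most `2 * n⁻¹ ^ 7`, which beats the
  -- size of the net. The hypothesis `hbv` says exactly that `t * (2 * b n) ≤ 1`.
  set t := √(Real.log n / (n * v n)) with ht
  have hv0 : 0 < v n := by linarith
  have hsub : {ω | ¬ ∀ p ∈ T, |1 / (n : ℝ) * ∑ i ∈ Finset.range n, ξ n p (X i ω) -
      ∫ x, ξ n p x ∂(densityMeasure f)| ≤ 10 * α} ⊆ ⋃ q ∈ F, {ω | n * (8 * α) ≤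
      |∑ i ∈ Finset.range n, (ξ n q (X i ω) - ∫ x, ξ n q x ∂(densityMeasure f))|} := by
    intro ω hω
    simp only [mem_iUnion]
    by_contra hcon
    push Not at hcon
    refine hω fun p hp => ?_
    obtain ⟨q, hq, hpq⟩ := hF p hp
    have hqT := hFT hq
    have hdev : |∑ i ∈ Finset.range n, (ξ n q (X i ω) - ∫ x, ξ n q x ∂(densityMeasure f))| <
        n * (8 * α) := not_le.mp (hcon q hq)
    have hmean : 1 / (n : ℝ) * ∑ i ∈ Finset.range n, ξ n q (X i ω) -
        ∫ x, ξ n q x ∂(densityMeasure f) = 1 / (n : ℝ) *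
        ∑ i ∈ Finset.range n, (ξ n q (X i ω) - ∫ x, ξ n q x ∂(densityMeasure f)) := by
      rw [Finset.sum_sub_distrib, mul_sub]
      simp [hn0.ne']
    have h1 : |1 / (n : ℝ) * ∑ i ∈ Finset.range n, ξ n q (X i ω) -
        ∫ x, ξ n q x ∂(densityMeasure f)| ≤ 8 * α := by
      rw [hmean, abs_mul, abs_of_pos (by positivity : 0 < 1 / (n : ℝ)), one_div_mul_eq_div,
        div_le_iff₀ hn0, mul_comm]
      exact hdev.le
    have hpt : ∀ x, |ξ n p x - ξ n q x| ≤ 1 / n := by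
      intro x
      refine (hlip p hp q hqT x).trans ?_
      calc Λ n * dist p q ≤ n * ρ := mul_le_mul hΛ hpq dist_nonneg hn0.le
        _ = 1 / n := by rw [hρ]; field_simp
    have h2 : |1 / (n : ℝ) * ∑ i ∈ Finset.range n, ξ n p (X i ω) -
        1 / (n : ℝ) * ∑ i ∈ Finset.range n, ξ n q (X i ω)| ≤ 1 / n := by
      rw [← mul_sub, ← Finset.sum_sub_distrib, abs_mul, abs_of_pos (by positivity : 0 < 1 / (n : ℝ))]
      calc _ ≤ 1 / (n : ℝ) * ∑ i ∈ Finset.range n, (1 / n : ℝ) := by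
            gcongr
            exact (Finset.abs_sum_le_sum_abs _ _).trans (Finset.sum_le_sum fun i _ => hpt _)
        _ = 1 / n := by simp; field_simp
    have h3 : |(∫ x, ξ n p x ∂(densityMeasure f)) - ∫ x, ξ n q x ∂(densityMeasure f)| ≤ 1 / n := by
      rw [← integral_sub (integrable_of_abs_le (hm n p hp) (hb p hp))
        (integrable_of_abs_le (hm n q hqT) (hb q hqT))]
      simpa using norm_integral_le_of_norm_le_const (μ := densityMeasure f)
        (f := fun x => ξ n p x - ξ n q x) (Eventually.of_forall hpt)
    have h1' := abs_le.mp h1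
    have h2' := abs_le.mp h2
    have h3' := abs_le.mp h3
    exact abs_le.mpr ⟨by linarith [h1'.1, h2'.1, h3'.2], by linarith [h1'.2, h2'.2, h3'.1]⟩
  have ht0 : 0 ≤ t := Real.sqrt_nonneg _
  have ht2 : t ^ 2 = Real.log n / (n * v n) := Real.sq_sqrt (by positivity)
  have htα : t * (n * α) = Real.log n := by
    have h1 : √(Real.log n / (n * v n)) * √(v n * Real.log n / n) = Real.log n / n := by
      rw [← Real.sqrt_mul (by positivity)]
      rw [show Real.log n / (n * v n) * (v n * Real.log n / n) = (Real.log n / n) ^ 2 by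
        field_simp]
      exact Real.sqrt_sq (by positivity)
    calc t * (n * α) = n * (t * α) := by ring
      _ = Real.log n := by rw [ht, hα, h1]; field_simp
  have hone : ∀ q ∈ F, P {ω | n * (8 * α) ≤
      |∑ i ∈ Finset.range n, (ξ n q (X i ω) - ∫ x, ξ n q x ∂(densityMeasure f))|} ≤
      ENNReal.ofReal (2 * ((n : ℝ) ^ 7)⁻¹) := by
    intro q hq
    have hqT := hFT hq
    have hb0 : 0 ≤ b n := (abs_nonneg _).trans (hb q hqT 0)
    have htb : t * (2 * b n) ≤ 1 := by
      have : (t * (2 * b n)) ^ 2 ≤ 1 := by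
        rw [mul_pow, ht2, div_mul_eq_mul_div, div_le_one (by positivity)]
        linarith
      exact (sq_le_one_iff₀ (by positivity)).mp this
    refine (hX.measure_le_abs_sum_le (hm n q hqT) (hb q hqT) (hv q hqT) ht0 htb n).trans ?_
    refine ENNReal.ofReal_le_ofReal (le_of_eq ?_)
    have e1 : -t * (n * (8 * α)) + n * (t ^ 2 * v n) = -(7 * Real.log n) := by
      have e2 : n * (t ^ 2 * v n) = Real.log n := by rw [ht2]; field_simp
      rw [e2]
      linear_combination (-8 : ℝ) * htα
    rw [e1, Real.exp_neg]
    congr 2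
    rw [show (7 : ℝ) * Real.log n = ((7 : ℕ) : ℝ) * Real.log n by norm_num, Real.exp_nat_mul,
      Real.exp_log hn0]
  calc _ ≤ P (⋃ q ∈ F, {ω | n * (8 * α) ≤
      |∑ i ∈ Finset.range n, (ξ n q (X i ω) - ∫ x, ξ n q x ∂(densityMeasure f))|}) :=
        measure_mono hsub
    _ ≤ ∑ q ∈ F, ENNReal.ofReal (2 * ((n : ℝ) ^ 7)⁻¹) :=
        (measure_biUnion_finset_le _ _).trans (Finset.sum_le_sum hone)
    _ = ENNReal.ofReal (F.card * (2 * ((n : ℝ) ^ 7)⁻¹)) := by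
        rw [Finset.sum_const, nsmul_eq_mul, ENNReal.ofReal_mul (by positivity)]
        simp
    _ ≤ _ := by
        refine ENNReal.ofReal_le_ofReal ?_
        calc (F.card : ℝ) * (2 * ((n : ℝ) ^ 7)⁻¹) ≤ C / ρ ^ 3 * (2 * ((n : ℝ) ^ 7)⁻¹) := by gcongr
          _ = 2 * C * (n : ℝ)⁻¹ := by rw [hρ]; field_simp

/-! ### Partial derivatives of kernel density estimators -/

theorem partialDeriv_comm {g : Plane → ℝ} (hg : ContDiff ℝ 2 g) (i j : Fin 2) :
    partialDeriv i (partialDeriv j g) = partialDeriv j (partialDeriv i g) := by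
  ext x
  have h1 : IsSymmSndFDerivAt ℝ g x := hg.contDiffAt.isSymmSndFDerivAt (by simp)
  have h2 : Differentiable ℝ (fderiv ℝ g) :=
    (hg.fderiv_right (m := 1) (by norm_num)).differentiable (by simp)
  have h3 : ∀ i j, partialDeriv i (partialDeriv j g) x =
      fderiv ℝ (fderiv ℝ g) x (EuclideanSpace.single i 1) (EuclideanSpace.single j 1) := by
    intro i j
    change fderiv ℝ (fun y => fderiv ℝ g y (EuclideanSpace.single j 1)) x _ = _
    rw [fderiv_clm_apply (h2 x) (differentiableAt_const _)]
    simp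
  rw [h3, h3]
  exact h1 _ _

/-- Repeated integration by parts removes the outermost derivative from the kernel and puts it
innermost on the other factor; the symmetry of second derivatives restores the order. -/
theorem pd_partialDeriv (l : List (Fin 2)) {g : Plane → ℝ}
    (hg : ContDiff ℝ (l.length + 1 : ℕ) g) (i : Fin 2) :
    pd l (partialDeriv i g) = partialDeriv i (pd l g) := by
  induction l with
  | nil => rfl
  | cons j l ih =>
    have h1 : ContDiff ℝ (2 : ℕ) (pd l g) := contDiff_pd l (by
      convert hg using 2; simp; ring)
    change partialDeriv j (pd l (partialDeriv i g)) = partialDeriv i (partialDeriv j (pd l g))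
    rw [ih (hg.of_le (by simp)), partialDeriv_comm (by exact_mod_cast h1)]

theorem hasFDerivAt_comp_scale {φ : Plane → ℝ} (hφ : Differentiable ℝ φ) (c : ℝ) (y u : Plane) :
    HasFDerivAt (fun y => φ (c • (y - u))) (c • fderiv ℝ φ (c • (y - u))) y := by
  have h1 : HasFDerivAt (fun y : Plane => c • (y - u)) (c • ContinuousLinearMap.id ℝ Plane) y :=
    ((hasFDerivAt_id y).sub_const u).const_smul c
  convert! (hφ (c • (y - u))).hasFDerivAt.comp y h1 using 1
  ext v; simp

theorem partialDeriv_kde {φ : Plane → ℝ} (hφ : Differentiable ℝ φ) (h : ℝ) (n : ℕ)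
    (x : ℕ → Plane) (i : Fin 2) (y : Plane) :
    partialDeriv i (kde φ h n x) y = h⁻¹ * kde (partialDeriv i φ) h n x y := by
  have h1 : HasFDerivAt (kde φ h n x) ((1 / (n * h ^ 2) : ℝ) • ∑ j ∈ Finset.range n,
      h⁻¹ • fderiv ℝ φ (h⁻¹ • (y - x j))) y :=
    (HasFDerivAt.fun_sum fun j _ => hasFDerivAt_comp_scale hφ h⁻¹ y (x j)).const_mul _
  rw [partialDeriv, h1.fderiv, kde]
  simp only [partialDeriv, _root_.smul_apply, _root_.sum_apply, smul_eq_mul]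
  rw [← Finset.mul_sum]
  ring

theorem partialDeriv_const_mul {φ : Plane → ℝ} (hφ : Differentiable ℝ φ) (c : ℝ) (i : Fin 2)
    (y : Plane) : partialDeriv i (fun y => c * φ y) y = c * partialDeriv i φ y := by
  rw [partialDeriv, fderiv_const_mul (hφ y)]
  simp [partialDeriv]

theorem differentiable_kde {φ : Plane → ℝ} (hφ : Differentiable ℝ φ) (h : ℝ) (n : ℕ)
    (x : ℕ → Plane) : Differentiable ℝ (kde φ h n x) := fun y =>
  ((HasFDerivAt.fun_sum fun j _ =>
    hasFDerivAt_comp_scale hφ h⁻¹ y (x j)).const_mul _).differentiableAt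

theorem pd_kde {K : Plane → ℝ} (hK : Tame K) (h : ℝ) (n : ℕ) (x : ℕ → Plane)
    (l : List (Fin 2)) (hl : l.length ≤ 3) (y : Plane) :
    pd l (kde K h n x) y = h⁻¹ ^ l.length * kde (pd l K) h n x y := by
  induction l generalizing y with
  | nil => simp [pd]
  | cons i l ih =>
    have hl' : l.length ≤ 2 := by simp at hl; omega
    have h1 : pd l (kde K h n x) = fun y => h⁻¹ ^ l.length * kde (pd l K) h n x y :=
      funext fun y => ih (by omega) y
    have h2 := hK.differentiable l hl'
    change partialDeriv i (pd l (kde K h n x)) y = _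
    rw [h1, partialDeriv_const_mul (differentiable_kde h2 h n x), partialDeriv_kde h2]
    simp only [List.length_cons, pow_succ, pd]
    ring

theorem contDiff_kde {φ : Plane → ℝ} {k : ℕ∞} (hφ : ContDiff ℝ k φ) (h : ℝ) (n : ℕ)
    (x : ℕ → Plane) : ContDiff ℝ k (kde φ h n x) := by
  unfold kde
  have h1 : ∀ i, ContDiff ℝ k fun y : Plane => h⁻¹ • (y - x i) := fun i => by fun_prop
  exact contDiff_const.mul (ContDiff.sum fun i _ => hφ.comp (h1 i))

theorem lipschitzWith_const_mul {φ : Plane → ℝ} {K : ℝ≥0} (hφ : LipschitzWith K φ) (c : ℝ) :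
    LipschitzWith (Real.toNNReal |c| * K) fun y => c * φ y := by
  refine LipschitzWith.of_dist_le_mul fun y z => ?_
  rw [Real.dist_eq, ← mul_sub, abs_mul, NNReal.coe_mul, Real.coe_toNNReal _ (abs_nonneg c), mul_assoc]
  exact mul_le_mul_of_nonneg_left (hφ.dist_le_mul y z) (abs_nonneg c)

theorem abs_comp_scale_sub_le {φ : Plane → ℝ} {K : ℝ≥0} (hφ : LipschitzWith K φ) {c : ℝ}
    (hc : 0 ≤ c) (y z u v : Plane) :
    |φ (c • (y - u)) - φ (c • (z - v))| ≤ K * (c * (dist y z + dist u v)) := by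
  have h1 := hφ.dist_le_mul (c • (y - u)) (c • (z - v))
  rw [Real.dist_eq] at h1
  refine h1.trans ?_
  rw [dist_smul₀, Real.norm_of_nonneg hc]
  gcongr
  exact dist_sub_sub_le _ _ _ _

theorem exists_lipschitzWith_kde {φ : Plane → ℝ} {K : ℝ≥0} (hφ : LipschitzWith K φ) {h : ℝ}
    (hh : 0 < h) (n : ℕ) (x : ℕ → Plane) : ∃ K' : ℝ≥0, LipschitzWith K' (kde φ h n x) := by
  have h1 : LipschitzWith (n * (K * Real.toNNReal h⁻¹)) fun y =>
      ∑ i ∈ Finset.range n, φ (h⁻¹ • (y - x i)) := by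
    refine LipschitzWith.of_dist_le_mul fun y z => ?_
    rw [Real.dist_eq, ← Finset.sum_sub_distrib]
    refine (Finset.abs_sum_le_sum_abs _ _).trans ((Finset.sum_le_sum fun i _ =>
      abs_comp_scale_sub_le hφ (inv_pos.mpr hh).le y z (x i) (x i)).trans (le_of_eq ?_))
    push_cast
    rw [Real.coe_toNNReal _ (inv_pos.mpr hh).le]
    simp
    ring
  exact ⟨_, lipschitzWith_const_mul h1 (1 / (n * h ^ 2))⟩

/-- Makes the deterministic theory applicable to every realization of the estimator. The Lipschitz
constants may depend on `n` and `h`, since only closeness to `f` enters the quantitative bounds. -/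
theorem tame_kde {K : Plane → ℝ} (hK : Tame K) {h : ℝ} (hh : 0 < h) (n : ℕ) (x : ℕ → Plane) :
    Tame (kde K h n x) := by
  refine ⟨?_, fun l hl => ?_⟩
  · have := contDiff_kde (k := (3 : ℕ)) (by exact_mod_cast hK.contDiff) h n x
    exact_mod_cast this
  · obtain ⟨K', hK'⟩ := hK.lipschitz l hl
    obtain ⟨K'', hK''⟩ := exists_lipschitzWith_kde hK' hh n x
    have : pd l (kde K h n x) = fun y => h⁻¹ ^ l.length * kde (pd l K) h n x y :=
      funext fun y => pd_kde hK h n x l hl y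
    rw [this]
    exact ⟨_, lipschitzWith_const_mul hK'' _⟩

/-! ### The bias -/

theorem hasCompactSupport_pd {K : Plane → ℝ} (hK : HasCompactSupport K) (l : List (Fin 2)) :
    HasCompactSupport (pd l K) := by
  induction l with
  | nil => exact hK
  | cons i l ih => exact ih.fderiv_apply ℝ (EuclideanSpace.single i 1)

theorem tsupport_pd_subset (K : Plane → ℝ) (l : List (Fin 2)) :
    tsupport (pd l K) ⊆ tsupport K := by
  induction l with
  | nil => exact subset_rfl
  | cons i l ih => exact (tsupport_fderiv_apply_subset ℝ (EuclideanSpace.single i 1)).trans ih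

theorem Tame.continuous_pd {g : Plane → ℝ} (hg : Tame g) (l : List (Fin 2)) (hl : l.length ≤ 3) :
    Continuous (pd l g) :=
  let ⟨_, hK⟩ := hg.lipschitz l hl
  hK.continuous

theorem integrable_mul_comp {φ g : Plane → ℝ} (hφ : Continuous φ) (hs : HasCompactSupport φ)
    (hg : Continuous g) (y : Plane) (h : ℝ) : Integrable fun z => φ z * g (y - h • z) := by
  refine Continuous.integrable_of_hasCompactSupport (by fun_prop) ?_
  exact hs.mul_right

theorem integral_partialDeriv_mul {φ g : Plane → ℝ} (hφ : Differentiable ℝ φ)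
    (hs : HasCompactSupport φ) (hφ' : ∀ i, Continuous (partialDeriv i φ)) (hg : ContDiff ℝ 1 g)
    (y : Plane) (h : ℝ) (i : Fin 2) :
    ∫ z, partialDeriv i φ z * g (y - h • z) = h * ∫ z, φ z * partialDeriv i g (y - h • z) := by
  have hgd : Differentiable ℝ g := hg.differentiable (by simp)
  set G : Plane → ℝ := fun z => g (y - h • z) with hG
  have hGd : ∀ z, HasFDerivAt G (-(h • fderiv ℝ g (y - h • z))) z := by
    intro z
    have h1 : HasFDerivAt (fun z : Plane => y - h • z) (-(h • ContinuousLinearMap.id ℝ Plane)) z :=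
      ((hasFDerivAt_id z).const_smul h).const_sub y
    convert! (hgd (y - h • z)).hasFDerivAt.comp z h1 using 1
    ext v; simp
  have hGp : ∀ z, fderiv ℝ G z (EuclideanSpace.single i 1) = -(h * partialDeriv i g (y - h • z)) := by
    intro z
    rw [(hGd z).fderiv]
    simp [partialDeriv]
  have hpc : Continuous (partialDeriv i g) := (contDiff_partialDeriv (n := 0)
    (by simpa using hg) i).continuous
  have hi := integrable_mul_comp hφ.continuous hs hpc y h
  have h1 := integral_mul_fderiv_eq_neg_fderiv_mul_of_integrable (𝕜 := ℝ) (μ := volume)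
    (f := φ) (g := G) (v := EuclideanSpace.single i (1 : ℝ))
    (integrable_mul_comp (hφ' i) (hs.fderiv_apply ℝ _) hg.continuous y h)
    (by
      simp only [hGp]
      convert! hi.const_mul (-h) using 1
      ext z; ring)
    (integrable_mul_comp hφ.continuous hs hg.continuous y h) (fun z _ => hφ z)
    (fun z _ => (hGd z).differentiableAt)
  simp only [hGp] at h1
  rw [← integral_const_mul]
  have h2 : ∫ z, partialDeriv i φ z * g (y - h • z) =
    - ∫ z, φ z * -(h * partialDeriv i g (y - h • z)) := by rw [h1, neg_neg]; rfl
  rw [h2, ← integral_neg]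
  congr 1; ext z; ring

theorem integral_pd_mul {K g : Plane → ℝ} (hK : Tame K) (hs : HasCompactSupport K)
    (l : List (Fin 2)) (hl : l.length ≤ 3) (hg : ContDiff ℝ l.length g) (y : Plane) (h : ℝ) :
    ∫ z, pd l K z * g (y - h • z) = h ^ l.length * ∫ z, K z * pd l g (y - h • z) := by
  induction l generalizing g with
  | nil => simp [pd]
  | cons i l ih =>
    have hl' : l.length ≤ 2 := by simp at hl; omega
    have h1 := integral_partialDeriv_mul (hK.differentiable l hl') (hasCompactSupport_pd hs l)
      (fun i => hK.continuous_pd (i :: l) (by simpa using hl)) (hg.of_le (by simp)) y h i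
    change ∫ z, partialDeriv i (pd l K) z * g (y - h • z) = _
    rw [h1, ih (by omega) (contDiff_partialDeriv (by exact_mod_cast hg) i),
      pd_partialDeriv l (by exact_mod_cast hg), ← mul_assoc, List.length_cons, pow_succ']
    rfl

/-- The change of variables in the expectation of a kernel density estimator. -/
theorem integral_comp_scale (F : Plane → ℝ) (y : Plane) {h : ℝ} (hh : 0 < h) :
    ∫ u, F u = h ^ 2 * ∫ z, F (y - h • z) := by
  have h1 := Measure.integral_comp_smul (volume : Measure Plane) (fun z => F (y - z)) h
  rw [h1, integral_sub_left_eq_self F volume y]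
  simp
  field_simp

theorem integral_densityMeasure {f : Plane → ℝ} (hf : Measurable f) (h0 : ∀ x, 0 ≤ f x)
    (φ : Plane → ℝ) : ∫ u, φ u ∂(densityMeasure f) = ∫ u, φ u * f u := by
  rw [densityMeasure, integral_withDensity_eq_integral_toReal_smul (by fun_prop) (by simp)]
  congr 1; ext u
  rw [ENNReal.toReal_ofReal (h0 u), smul_eq_mul, mul_comm]

/-- After rescaling, integration by parts moves all derivatives from the kernel to `f`, and the
powers of `h` cancel. The expectation of a derivative of the estimator is therefore a local average
of that derivative of `f`. -/
theorem integral_pd_scale {K f : Plane → ℝ} (hK : Tame K) (hs : HasCompactSupport K)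
    (hf : ContDiff ℝ 3 f) (h0 : ∀ x, 0 ≤ f x) (l : List (Fin 2)) (hl : l.length ≤ 3)
    (y : Plane) {h : ℝ} (hh : 0 < h) :
    ∫ u, h⁻¹ ^ (2 + l.length) * pd l K (h⁻¹ • (y - u)) ∂(densityMeasure f) =
      ∫ z, K z * pd l f (y - h • z) := by
  rw [integral_densityMeasure hf.continuous.measurable h0, integral_comp_scale _ y hh]
  have h1 : ∀ z : Plane, h⁻¹ ^ (2 + l.length) * pd l K (h⁻¹ • (y - (y - h • z))) *
      f (y - h • z) = h⁻¹ ^ (2 + l.length) * (pd l K z * f (y - h • z)) := by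
    intro z
    rw [sub_sub_cancel, smul_smul, inv_mul_cancel₀ hh.ne', one_smul]
    ring
  simp only [h1]
  rw [integral_const_mul, integral_pd_mul hK hs l hl (hf.of_le (by exact_mod_cast hl)) y h,
    ← mul_assoc, ← mul_assoc]
  have : h ^ 2 * h⁻¹ ^ (2 + l.length) * h ^ l.length = 1 := by
    rw [inv_pow, pow_add]; field_simp
  rw [this, one_mul]

namespace KernelAssumptions

variable {K : Plane → ℝ}

theorem hasCompactSupport (hK : KernelAssumptions K) : HasCompactSupport K := by
  rw [HasCompactSupport, hK.support]
  exact isCompact_closedBall _ _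

theorem pd_eq_zero (hK : KernelAssumptions K) (l : List (Fin 2)) {z : Plane} (hz : 1 < ‖z‖) :
    pd l K z = 0 := by
  refine image_eq_zero_of_notMem_tsupport fun hmem => ?_
  have := tsupport_pd_subset K l hmem
  rw [hK.support, mem_closedBall_zero_iff] at this
  linarith

theorem exists_abs_pd_le (hK : KernelAssumptions K) (l : List (Fin 2)) (hl : l.length ≤ 3) :
    ∃ C : ℝ, ∀ z, |pd l K z| ≤ C :=
  (hK.tame.continuous_pd l hl).bounded_above_of_compact_support
    (hasCompactSupport_pd hK.hasCompactSupport l)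

/-- Averaging with a probability density on the unit ball. -/
theorem abs_integral_mul_le (hK : KernelAssumptions K) {F : Plane → ℝ} {C : ℝ}
    (hF : ∀ z, ‖z‖ ≤ 1 → |F z| ≤ C) : |∫ z, K z * F z| ≤ C := by
  have h1 : ∀ z, ‖K z * F z‖ ≤ K z * C := by
    intro z
    rw [Real.norm_eq_abs, abs_mul, abs_of_nonneg (hK.density.1 z)]
    rcases le_or_gt ‖z‖ 1 with hz | hz
    · exact mul_le_mul_of_nonneg_left (hF z hz) (hK.density.1 z)
    · have : K z = 0 := hK.pd_eq_zero [] hz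
      simp [this]
  have h2 := norm_integral_le_of_norm_le (hK.density.2.1.mul_const C) (Eventually.of_forall h1)
  rwa [integral_mul_const, hK.density.2.2, one_mul, Real.norm_eq_abs] at h2

theorem integral_mul_sub (hK : KernelAssumptions K) {g : Plane → ℝ} (hg : Continuous g)
    (y : Plane) (h : ℝ) :
    (∫ z, K z * g (y - h • z)) - g y = ∫ z, K z * (g (y - h • z) - g y) := by
  have hKc : Continuous K := hK.tame.continuous_pd [] (by simp)
  have h1 := integrable_mul_comp hKc hK.hasCompactSupport hg y h
  simp only [mul_sub]
  rw [integral_sub h1 (hK.density.2.1.mul_const _), integral_mul_const, hK.density.2.2, one_mul]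

/-- The bias bound for third derivatives, where a vanishing error suffices and no further derivative
is available to exploit symmetry. -/
theorem abs_integral_sub_le_of_lipschitz (hK : KernelAssumptions K) {g : Plane → ℝ} {C : ℝ≥0}
    (hg : LipschitzWith C g) (y : Plane) {h : ℝ} (hh : 0 < h) :
    |(∫ z, K z * g (y - h • z)) - g y| ≤ C * h := by
  rw [hK.integral_mul_sub hg.continuous]
  refine hK.abs_integral_mul_le fun z hz => ?_
  have h1 := hg.dist_le_mul (y - h • z) y
  rw [Real.dist_eq, dist_eq_norm, sub_sub_cancel_left, norm_neg, norm_smul,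
    Real.norm_of_nonneg hh.le] at h1
  refine h1.trans ?_
  gcongr
  exact mul_le_of_le_one_right hh.le hz

/-- The function `w ↦ g (y - w) + g (y + w)` has derivative `Dg (y + w) - Dg (y - w)`, of norm at
most `2 * C * ‖2 • w‖`; the mean value inequality gives the factor `4 * C`. -/
theorem abs_second_difference_le {g : Plane → ℝ} (hg : Differentiable ℝ g) {C : ℝ≥0}
    (hC : ∀ i, LipschitzWith C (partialDeriv i g)) (y v : Plane) :
    |g (y - v) + g (y + v) - 2 * g y| ≤ 4 * C * ‖v‖ ^ 2 := by
  have hd : ∀ a b : Plane, ‖fderiv ℝ g a - fderiv ℝ g b‖ ≤ 2 * C * ‖a - b‖ := by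
    intro a b
    refine ContinuousLinearMap.opNorm_le_bound _ (by positivity) fun u => ?_
    rw [_root_.sub_apply, fderiv_eq_partialDeriv, fderiv_eq_partialDeriv]
    have h0 := (hC 0).dist_le_mul a b
    have h1 := (hC 1).dist_le_mul a b
    rw [Real.dist_eq, dist_eq_norm] at h0 h1
    calc _ = |u 0 * (partialDeriv 0 g a - partialDeriv 0 g b) +
          u 1 * (partialDeriv 1 g a - partialDeriv 1 g b)| := by
            rw [Real.norm_eq_abs]; ring_nf
      _ ≤ |u 0| * |partialDeriv 0 g a - partialDeriv 0 g b| +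
          |u 1| * |partialDeriv 1 g a - partialDeriv 1 g b| := by
            rw [← abs_mul, ← abs_mul]; exact abs_add_le _ _
      _ ≤ ‖u‖ * (C * ‖a - b‖) + ‖u‖ * (C * ‖a - b‖) := by
            gcongr <;> exact abs_apply_le_norm _ _
      _ = _ := by ring
  set q : Plane → ℝ := fun w => g (y - w) + g (y + w) with hq
  have hqd : ∀ w, HasFDerivAt q (-fderiv ℝ g (y - w) + fderiv ℝ g (y + w)) w := by
    intro w
    have h1 : HasFDerivAt (fun w : Plane => y - w) (-ContinuousLinearMap.id ℝ Plane) w :=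
      (hasFDerivAt_id w).const_sub y
    have h2 : HasFDerivAt (fun w : Plane => y + w) (ContinuousLinearMap.id ℝ Plane) w :=
      (hasFDerivAt_id w).const_add y
    have h3 := (hg (y - w)).hasFDerivAt.comp w h1
    have h4 := (hg (y + w)).hasFDerivAt.comp w h2
    convert! h3.add h4 using 1
    ext u; simp
  have := (convex_closedBall (0 : Plane) ‖v‖).norm_image_sub_le_of_norm_hasFDerivWithin_le
    (f := q) (C := 4 * C * ‖v‖) (x := 0) (y := v) (fun w _ => (hqd w).hasFDerivWithinAt)
    (fun w hw => by
      rw [neg_add_eq_sub]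
      refine (hd _ _).trans ?_
      have e : y + w - (y - w) = (2 : ℝ) • w := by rw [two_smul]; abel
      rw [e, norm_smul, Real.norm_of_nonneg (by norm_num)]
      have := mem_closedBall_zero_iff.mp hw
      nlinarith [C.2]) (by simp) (by simp)
  rw [sub_zero, Real.norm_eq_abs] at this
  calc |g (y - v) + g (y + v) - 2 * g y| = |q v - q 0| := by simp [hq]; ring_nf
    _ ≤ _ := this
    _ = _ := by ring

/-- By the symmetry of `K`, the average may be taken over `z` and `-z` together. The first-order
terms cancel and a second difference remains. -/
theorem abs_integral_sub_le_of_lipschitz_deriv (hK : KernelAssumptions K) {g : Plane → ℝ}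
    (hg : Differentiable ℝ g) {C : ℝ≥0} (hC : ∀ i, LipschitzWith C (partialDeriv i g)) (y : Plane)
    {h : ℝ} (hh : 0 < h) : |(∫ z, K z * g (y - h • z)) - g y| ≤ 2 * C * h ^ 2 := by
  have hKc : Continuous K := hK.tame.continuous_pd [] (by simp)
  have hsym : ∫ z, K z * g (y + h • z) = ∫ z, K z * g (y - h • z) := by
    rw [← integral_neg_eq_self]
    congr 1; ext z
    rw [hK.symmetric, smul_neg, ← sub_eq_add_neg]
  have i1 := integrable_mul_comp hKc hK.hasCompactSupport hg.continuous y h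
  have i2 := integrable_mul_comp hKc hK.hasCompactSupport hg.continuous y (-h)
  simp only [neg_smul, sub_neg_eq_add] at i2
  have h1 : 2 * ((∫ z, K z * g (y - h • z)) - g y) =
      ∫ z, K z * (g (y - h • z) + g (y + h • z) - 2 * g y) := by
    simp only [mul_sub, mul_add]
    have i3 : Integrable fun z => K z * g (y - h • z) + K z * g (y + h • z) := i1.add i2
    rw [integral_sub i3 (hK.density.2.1.mul_const _), integral_add i1 i2, hsym,
      integral_mul_const, hK.density.2.2]
    ring
  have h2 := hK.abs_integral_mul_le (F := fun z => g (y - h • z) + g (y + h • z) - 2 * g y)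
    (C := 4 * C * h ^ 2) fun z hz => by
      refine (abs_second_difference_le hg hC y (h • z)).trans ?_
      rw [norm_smul, Real.norm_of_nonneg hh.le]
      gcongr
      exact mul_le_of_le_one_right hh.le hz
  rw [← h1, abs_mul, abs_two] at h2
  linarith

end KernelAssumptions

/-! ### Bandwidths -/

namespace BandwidthAssumptions

variable {h : ℕ → ℝ}

theorem eventually_le_one (hh : BandwidthAssumptions h) : ∀ᶠ n in atTop, h n ≤ 1 :=
  (hh.to_zero.eventually (gt_mem_nhds one_pos)).mono fun _ => le_of_lt

theorem eventually_one_le_log : ∀ᶠ n : ℕ in atTop, 1 ≤ Real.log n :=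
  (Real.tendsto_log_atTop.comp tendsto_natCast_atTop_atTop).eventually_ge_atTop 1

/-- All growth conditions of the deviation inequality have this form. Since `n * h n ^ 8` dominates
every multiple of `log n`, up to eight powers of `(h n)⁻¹` can be absorbed by `n`. -/
theorem eventually_mul_log_le (hh : BandwidthAssumptions h) (C : ℝ) {j k : ℕ} (hjk : k ≤ j + 8) :
    ∀ᶠ n : ℕ in atTop, C * (h n)⁻¹ ^ k * Real.log n ≤ n * (h n)⁻¹ ^ j := by
  filter_upwards [hh.eventually_le_one, eventually_one_le_log, hh.lower.eventually_ge_atTop |C|]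
    with n h1 hlog hlow
  have h0 := hh.pos n
  have hinv : 1 ≤ (h n)⁻¹ := (one_le_inv₀ h0).mpr h1
  rw [le_div_iff₀ (by positivity)] at hlow
  have hlog3 : Real.log n ≤ Real.log n ^ 3 := le_self_pow₀ hlog (by norm_num)
  have e2 : (n : ℝ) * h n ^ 8 * (h n)⁻¹ ^ (j + 8) = n * (h n)⁻¹ ^ j := by
    rw [pow_add, inv_pow, inv_pow]
    field_simp
  have e4 : |C| * Real.log n ≤ n * h n ^ 8 :=
    (mul_le_mul_of_nonneg_left hlog3 (abs_nonneg C)).trans hlow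
  calc C * (h n)⁻¹ ^ k * Real.log n ≤ |C| * (h n)⁻¹ ^ k * Real.log n := by
        gcongr; exact le_abs_self C
    _ = |C| * Real.log n * (h n)⁻¹ ^ k := by ring
    _ ≤ (n * h n ^ 8) * (h n)⁻¹ ^ (j + 8) := by gcongr
    _ = _ := e2

theorem eventually_mul_le (hh : BandwidthAssumptions h) (C : ℝ) {k : ℕ} (hk : k ≤ 8) :
    ∀ᶠ n : ℕ in atTop, C * (h n)⁻¹ ^ k ≤ n := by
  filter_upwards [hh.eventually_mul_log_le |C| (j := 0) (k := k) (by simpa using hk),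
    eventually_one_le_log] with n h1 hlog
  have h0 := hh.pos n
  rw [pow_zero, mul_one] at h1
  have e1 : 0 ≤ |C| * (h n)⁻¹ ^ k := by positivity
  calc C * (h n)⁻¹ ^ k ≤ |C| * (h n)⁻¹ ^ k := by gcongr; exact le_abs_self C
    _ ≤ |C| * (h n)⁻¹ ^ k * Real.log n := le_mul_of_one_le_right e1 hlog
    _ ≤ n := h1

end BandwidthAssumptions

/-! ### Fluctuations of the derivatives of the estimator about their means -/

theorem pd_kde_eq_mean {K : Plane → ℝ} (hK : Tame K) (c : ℝ) (n : ℕ) (x : ℕ → Plane)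
    {l : List (Fin 2)} (hl : l.length ≤ 3) (y : Plane) : pd l (kde K c n x) y =
      1 / (n : ℝ) * ∑ i ∈ Finset.range n, c⁻¹ ^ (2 + l.length) * pd l K (c⁻¹ • (y - x i)) := by
  rw [pd_kde hK _ _ _ _ hl, kde, ← Finset.mul_sum, pow_add, inv_pow c 2, ← one_div_mul_one_div_rev]
  ring

/-- The rate `√(log n / (n hⁿᵏ))`. -/
def rate (h : ℕ → ℝ) (k n : ℕ) : ℝ := √(Real.log n / (n * h n ^ k))

section Sample

variable {Ω : Type*} [MeasurableSpace Ω] {P : Measure Ω} [IsProbabilityMeasure P]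
  {X : ℕ → Ω → Plane} {f K : Plane → ℝ} {h : ℕ → ℝ}

/-- Uniform deviations of empirical means of functions whose size is a power of the bandwidth. -/
theorem IsSample.tendsto_measure_deviation_rate (hX : IsSample P X f)
    (hh : BandwidthAssumptions h) {T : Set (Plane × ℝ)} (hT : Bornology.IsBounded T)
    {ξ : ℕ → Plane × ℝ → Plane → ℝ} {B D Λ : ℝ} {kb kv kΛ : ℕ} (hk : 2 * kb ≤ kv + 8)
    (hkΛ : kΛ ≤ 8) (hm : ∀ n, ∀ p ∈ T, Measurable (ξ n p))
    (hb : ∀ n, h n ≤ 1 → ∀ p ∈ T, ∀ x, |ξ n p x| ≤ B * (h n)⁻¹ ^ kb)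
    (hv : ∀ n, h n ≤ 1 → ∀ p ∈ T, ∫ x, ξ n p x ^ 2 ∂(densityMeasure f) ≤ D * (h n)⁻¹ ^ kv)
    (hlip : ∀ n, h n ≤ 1 → ∀ p ∈ T, ∀ q ∈ T, ∀ x,
      |ξ n p x - ξ n q x| ≤ Λ * (h n)⁻¹ ^ kΛ * dist p q) :
    ∃ M : ℝ, Tendsto (fun n : ℕ => P {ω | ¬ ∀ p ∈ T, |1 / (n : ℝ) * ∑ i ∈ Finset.range n,
      ξ n p (X i ω) - ∫ x, ξ n p x ∂(densityMeasure f)| ≤ M * rate h kv n}) atTop (𝓝 0) := by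
  -- The deviation inequality needs a variance bound of at least 1.
  set D' := max D 1 with hD'
  refine ⟨10 * √D', ?_⟩
  have h1 := hX.tendsto_measure_uniform_deviation hT (ξ := ξ) (b := fun n => B * (h n)⁻¹ ^ kb)
    (v := fun n => D' * (h n)⁻¹ ^ kv) (Λ := fun n => Λ * (h n)⁻¹ ^ kΛ) hm
    (hh.eventually_le_one.mono hb)
    (hh.eventually_le_one.mono fun n hn p hp => (hv n hn p hp).trans (by
      have := hh.pos n
      gcongr
      exact le_max_left _ _))
    (hh.eventually_le_one.mono hlip) (hh.eventually_mul_le Λ hkΛ)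
    (hh.eventually_le_one.mono fun n hn =>
      one_le_mul_of_one_le_of_one_le (le_max_right _ _)
        (one_le_pow₀ ((one_le_inv₀ (hh.pos n)).mpr hn)))
    ((hh.eventually_mul_log_le (4 * B ^ 2) hk).mono fun n hn => by
      have := hh.pos n
      calc 4 * (B * (h n)⁻¹ ^ kb) ^ 2 * Real.log n = 4 * B ^ 2 * (h n)⁻¹ ^ (2 * kb) * Real.log n := by
            rw [mul_pow, ← pow_mul, mul_comm kb 2]; ring
        _ ≤ n * (h n)⁻¹ ^ kv := hn
        _ ≤ n * (D' * (h n)⁻¹ ^ kv) := by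
            gcongr
            exact le_mul_of_one_le_left (by positivity) (le_max_right _ _))
  convert h1 using 6 with n
  have e : 10 * √D' * rate h kv n = 10 * √(D' * (h n)⁻¹ ^ kv * Real.log n / n) := by
    rw [rate, mul_assoc, ← Real.sqrt_mul (by positivity)]
    congr 2
    rw [inv_pow]
    have := (hh.pos n).ne'
    rcases eq_or_ne (n : ℝ) 0 with h0 | h0
    · simp [h0]
    · field_simp
  rw [e]

/-- The mass that the law of the observations assigns to a rescaled kernel. -/
theorem exists_integral_abs_scale_le {φ : Plane → ℝ} (hφ : Continuous φ)
    (hs : HasCompactSupport φ) (h1 : ∀ z, 1 < ‖z‖ → φ z = 0) (hf : Continuous f)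
    (h0 : ∀ x, 0 ≤ f x) (R : ℝ) :
    ∃ D : ℝ, 0 ≤ D ∧ ∀ y : Plane, ‖y‖ ≤ R → ∀ c : ℝ, 0 < c → c ≤ 1 →
      ∫ u, |φ (c⁻¹ • (y - u))| ∂(densityMeasure f) ≤ D * c ^ 2 := by
  obtain ⟨F, hF⟩ := (isCompact_closedBall (0 : Plane) (R + 1)).exists_bound_of_continuousOn
    hf.continuousOn
  have hi : Integrable fun z => |φ z| := (hφ.integrable_of_hasCompactSupport hs).abs
  refine ⟨|F| * ∫ z, |φ z|, mul_nonneg (abs_nonneg F) (integral_nonneg fun _ => abs_nonneg _),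
    fun y hy c hc hc1 => ?_⟩
  rw [integral_densityMeasure hf.measurable h0, integral_comp_scale _ y hc]
  have e : ∀ z : Plane, |φ (c⁻¹ • (y - (y - c • z)))| = |φ z| := by
    intro z
    rw [sub_sub_cancel, smul_smul, inv_mul_cancel₀ hc.ne', one_smul]
  simp only [e]
  rw [mul_comm, ← integral_const_mul]
  refine mul_le_mul_of_nonneg_right ?_ (sq_nonneg c)
  refine integral_mono_of_nonneg (Eventually.of_forall fun z => mul_nonneg (abs_nonneg _) (h0 _))
    (hi.const_mul _) (Eventually.of_forall fun z => ?_)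
  change |φ z| * f (y - c • z) ≤ |F| * |φ z|
  rcases le_or_gt ‖z‖ 1 with hz | hz
  · rw [mul_comm]
    gcongr
    have hmem : y - c • z ∈ closedBall (0 : Plane) (R + 1) := by
      rw [mem_closedBall_zero_iff]
      refine (norm_sub_le _ _).trans (add_le_add hy ?_)
      rw [norm_smul, Real.norm_of_nonneg hc.le]
      nlinarith [norm_nonneg z]
    exact (le_abs_self _).trans ((hF _ hmem).trans (le_abs_self F))
  · simp [h1 z hz]

/-- The partial derivatives of the kernel density estimator are uniformly close to their means. -/
theorem tendsto_measure_pd_kde_sub_mean (hX : IsSample P X f) (hh : BandwidthAssumptions h)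
    (hf : DensityAssumptions f) (hK : KernelAssumptions K) (R : ℝ) (l : List (Fin 2))
    (hl : l.length ≤ 3) :
    ∃ M : ℝ, Tendsto (fun n : ℕ => P {ω | ¬ ∀ y : Plane, ‖y‖ ≤ R →
      |pd l (kde K (h n) n fun i => X i ω) y - ∫ z, K z * pd l f (y - h n • z)| ≤
        M * rate h (2 + 2 * l.length) n}) atTop (𝓝 0) := by
  have hKc := hK.tame.continuous_pd l hl
  have hKs := hasCompactSupport_pd hK.hasCompactSupport l
  have := hX.isProbabilityMeasure
  obtain ⟨B, hB⟩ := hK.exists_abs_pd_le l hl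
  have hB0 : 0 ≤ B := (abs_nonneg _).trans (hB 0)
  obtain ⟨Λ, hΛ⟩ := hK.tame.lipschitz l hl
  obtain ⟨D, hD0, hD⟩ := exists_integral_abs_scale_le hKc hKs (fun z => hK.pd_eq_zero l)
    hf.smooth.continuous hf.density.1 R
  -- The second coordinate is a dummy: the same deviation theorem serves points here and pairs of a
  -- start and a time for the path integrals.
  set T : Set (Plane × ℝ) := closedBall 0 R ×ˢ {0} with hT
  set ξ : ℕ → Plane × ℝ → Plane → ℝ := fun n p u =>
    (h n)⁻¹ ^ (2 + l.length) * pd l K ((h n)⁻¹ • (p.1 - u)) with hξ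
  have hm : ∀ n p, Measurable (ξ n p) := by
    intro n p
    have : Continuous (ξ n p) := by
      simp only [hξ]
      fun_prop
    exact this.measurable
  obtain ⟨M, hM⟩ := hX.tendsto_measure_deviation_rate hh
    (T := T) (isBounded_closedBall.prod Bornology.isBounded_singleton) (ξ := ξ) (B := B) (D := B * D) (Λ := Λ)
    -- In the second moment, the squared size gives `4 + 2 * l.length` negative powers of `h`, of
    -- which the area of the rescaled support removes two. Differentiating in `y` costs one more
    -- power than the size.
    (kb := 2 + l.length) (kv := 2 + 2 * l.length) (kΛ := 3 + l.length) (by omega) (by omega)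
    (fun n p _ => hm n p)
    (fun n _ p _ x => by
      have h0 := hh.pos n
      simp only [hξ]
      rw [abs_mul, abs_of_pos (by positivity), mul_comm B]
      gcongr
      exact hB _)
    (fun n hn p hp => by
      have h0 := hh.pos n
      have hpR : ‖p.1‖ ≤ R := mem_closedBall_zero_iff.mp hp.1
      have hmeas : Measurable fun u => |pd l K ((h n)⁻¹ • (p.1 - u))| := by
        have : Continuous fun u => |pd l K ((h n)⁻¹ • (p.1 - u))| := by fun_prop
        exact this.measurable
      have hint : Integrable (fun u => |pd l K ((h n)⁻¹ • (p.1 - u))|) (densityMeasure f) :=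
        integrable_of_abs_le hmeas (b := B) fun u => by rw [abs_abs]; exact hB _
      calc ∫ x, ξ n p x ^ 2 ∂(densityMeasure f)
          ≤ ∫ u, (h n)⁻¹ ^ (4 + 2 * l.length) * B * |pd l K ((h n)⁻¹ • (p.1 - u))|
              ∂(densityMeasure f) := by
            refine integral_mono_of_nonneg (Eventually.of_forall fun _ => sq_nonneg _)
              (hint.const_mul _) (Eventually.of_forall fun u => ?_)
            simp only [hξ]
            rw [mul_pow, ← pow_mul, ← sq_abs (pd l K _), sq |pd l K _|, mul_assoc]
            rw [show (2 + l.length) * 2 = 4 + 2 * l.length by ring]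
            gcongr
            exact hB _
        _ ≤ (h n)⁻¹ ^ (4 + 2 * l.length) * B * (D * h n ^ 2) := by
            rw [integral_const_mul]
            gcongr
            exact hD _ hpR _ h0 hn
        _ = B * D * (h n)⁻¹ ^ (2 + 2 * l.length) := by
            rw [show 4 + 2 * l.length = 2 + (2 + 2 * l.length) by ring, pow_add, inv_pow]
            field_simp)
    (fun n hn p _ q _ x => by
      have h0 := hh.pos n
      simp only [hξ]
      rw [← mul_sub, abs_mul, abs_of_pos (by positivity)]
      have h1 := abs_comp_scale_sub_le hΛ (inv_pos.mpr h0).le p.1 q.1 x x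
      rw [dist_self, add_zero] at h1
      calc _ ≤ (h n)⁻¹ ^ (2 + l.length) * (Λ * ((h n)⁻¹ * dist p.1 q.1)) := by gcongr
        _ ≤ (h n)⁻¹ ^ (2 + l.length) * (Λ * ((h n)⁻¹ * dist p q)) := by
            gcongr
            exact (le_max_left _ _)
        _ = _ := by rw [show 3 + l.length = 2 + l.length + 1 by ring, pow_succ]; ring)
  refine ⟨M, ?_⟩
  convert hM using 4 with n
  ext ω
  refine not_congr ⟨fun H p hp => ?_, fun H y hy => ?_⟩
  · have h1 := H p.1 (mem_closedBall_zero_iff.mp hp.1)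
    rwa [pd_kde_eq_mean hK.tame _ _ _ hl, ← integral_pd_scale hK.tame hK.hasCompactSupport
      (hf.smooth.of_le (by norm_num)) hf.density.1 l hl p.1 (hh.pos n)] at h1
  · have h1 := H (y, 0) ⟨mem_closedBall_zero_iff.mpr hy, rfl⟩
    rwa [pd_kde_eq_mean hK.tame _ _ _ hl, ← integral_pd_scale hK.tame hK.hasCompactSupport
      (hf.smooth.of_le (by norm_num)) hf.density.1 l hl y (hh.pos n)]

end Sample

/-! ### Integrals along the curves -/

/-- The times at which the integrand is non-zero form a set of diameter, hence of measure, at most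
`d`. This is used for a curve crossing the small support of a rescaled kernel. -/
theorem abs_intervalIntegral_le_mul_diam {g : ℝ → ℝ} {B d t : ℝ} (hd : 0 ≤ d)
    (hB : ∀ s, |g s| ≤ B)
    (hdiam : ∀ s ∈ uIoc 0 t, ∀ u ∈ uIoc 0 t, g s ≠ 0 → g u ≠ 0 → |s - u| ≤ d) :
    |∫ s in (0 : ℝ)..t, g s| ≤ B * d := by
  have hB0 : 0 ≤ B := (abs_nonneg _).trans (hB 0)
  set A : Set ℝ := {s | s ∈ uIoc 0 t ∧ g s ≠ 0} with hA
  have hAvol : volume A ≤ ENNReal.ofReal d := by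
    refine (Real.volume_le_diam A).trans (Metric.ediam_le fun s hs u hu => ?_)
    rw [edist_dist, Real.dist_eq]
    exact ENNReal.ofReal_le_ofReal (hdiam s hs.1 u hu.1 hs.2 hu.2)
  have h1 : ∫ s in uIoc 0 t, g s = ∫ s in A, g s :=
    setIntegral_eq_of_subset_of_forall_sdiff_eq_zero measurableSet_uIoc (fun s hs => hs.1)
      fun s hs => by
        by_contra h
        exact hs.2 ⟨hs.1, h⟩
  rw [← Real.norm_eq_abs, intervalIntegral.norm_integral_eq_norm_integral_uIoc, h1]
  refine (norm_setIntegral_le_of_norm_le_const (hAvol.trans_lt ENNReal.ofReal_lt_top)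
    fun s _ => hB s).trans ?_
  gcongr
  exact ENNReal.toReal_le_of_le_ofReal hd hAvol

section Fubini

variable {F : ℝ → Plane → ℝ} {B : ℝ} {ν : Measure Plane} [IsFiniteMeasure ν]

theorem integrable_uncurry_of_bounded (hF : Continuous (Function.uncurry F))
    (hB : ∀ s u, |F s u| ≤ B) (t : ℝ) :
    Integrable (Function.uncurry F) ((volume.restrict (uIoc 0 t)).prod ν) := by
  have : IsFiniteMeasure (volume.restrict (uIoc 0 t)) := by
    rw [uIoc]; infer_instance
  exact integrable_of_abs_le hF.measurable fun p => hB p.1 p.2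

theorem integral_abs_intervalIntegral_le (hF : Continuous (Function.uncurry F))
    (hB : ∀ s u, |F s u| ≤ B) {D t : ℝ} (hD : ∀ s ∈ uIoc 0 t, ∫ u, |F s u| ∂ν ≤ D) :
    ∫ u, |∫ s in (0 : ℝ)..t, F s u| ∂ν ≤ D * |t| := by
  have hi := (integrable_uncurry_of_bounded (ν := ν) (F := fun s u => |F s u|) (B := B) hF.abs
    (fun s u => by rw [abs_abs]; exact hB s u) t)
  calc ∫ u, |∫ s in (0 : ℝ)..t, F s u| ∂ν
      ≤ ∫ u, (∫ s in uIoc 0 t, |F s u|) ∂ν :=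
        integral_mono_of_nonneg (Eventually.of_forall fun _ => abs_nonneg _)
          hi.integral_prod_right (Eventually.of_forall fun u =>
            intervalIntegral.norm_integral_le_integral_norm_uIoc (f := fun s => F s u)
              (a := 0) (b := t))
    _ = ∫ s in uIoc 0 t, ∫ u, |F s u| ∂ν := (integral_integral_swap hi).symm
    _ ≤ D * volume.real (uIoc 0 t) := by
        refine (Real.le_norm_self _).trans ?_
        refine norm_setIntegral_le_of_norm_le_const (s := uIoc 0 t) measure_Ioc_lt_top
          fun s hs => ?_
        rw [Real.norm_of_nonneg (integral_nonneg fun _ => abs_nonneg _)]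
        exact hD s hs
    _ = D * |t| := by
        rw [uIoc, Real.volume_real_Ioc_of_le min_le_max, max_sub_min_eq_abs, sub_zero]

end Fubini

/-- The integral of `V f` along the curve is the increment of the curve, so `mean_speed` is a lower
Lipschitz bound. In particular the curve does not return to places it has passed. -/
theorem FilamentAssumptions.exists_mul_abs_sub_le_norm {f : Plane → ℝ} {H L : Set Plane} {a : ℝ}
    (hL : FilamentAssumptions f H L a) (hf : Tame f) : ∃ c : ℝ, 0 < c ∧ ∀ y ∈ L, ∀ s u : ℝ,
      |s| ≤ a → |u| ≤ a → c * |s - u| ≤ ‖path f y s - path f y u‖ := by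
  obtain ⟨c, hc, hspeed⟩ := hL.mean_speed
  refine ⟨c, hc, fun y hy => ?_⟩
  have hlt : ∀ s u : ℝ, |s| ≤ a → |u| ≤ a → s < u →
      c * |s - u| ≤ ‖path f y s - path f y u‖ := by
    intro s u hs hu hsu
    have h1 := hspeed y hy s u (abs_le.mp hs).1 hsu (abs_le.mp hu).2
    rw [intervalIntegral.integral_eq_sub_of_hasDerivAt
      (fun r _ => (hf.path_isIntegralCurveFrom y).2 r)
      ((hf.continuous_V.comp (hf.continuous_path y)).intervalIntegrable _ _), norm_smul,
      Real.norm_of_nonneg (inv_nonneg.mpr (sub_nonneg.mpr hsu.le)),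
      le_inv_mul_iff₀ (sub_pos.mpr hsu)] at h1
    rw [abs_sub_comm, abs_of_pos (sub_pos.mpr hsu), norm_sub_rev, mul_comm]
    exact h1
  intro s u hs hu
  rcases lt_trichotomy s u with h | rfl | h
  · exact hlt s u hs hu h
  · simp
  · rw [abs_sub_comm, norm_sub_rev]
    exact hlt u s hu hs h

section Sample

variable {Ω : Type*} [MeasurableSpace Ω] {P : Measure Ω} [IsProbabilityMeasure P]
  {X : ℕ → Ω → Plane} {f K : Plane → ℝ} {h : ℕ → ℝ} {H L : Set Plane} {a : ℝ}

/-- The integrals of the second order partial derivatives of the kernel density estimator along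
the integral curves deviate less from their means than these derivatives do. -/
theorem tendsto_measure_path_integral (hX : IsSample P X f) (hh : BandwidthAssumptions h)
    (hf : DensityAssumptions f) (hK : KernelAssumptions K) (hL : FilamentAssumptions f H L a)
    {w : Plane → ℝ} (hw1 : ∀ x, |w x| ≤ 1) {Kw : ℝ≥0} (hw : LipschitzWith Kw w)
    {l : List (Fin 2)} (hl : l.length = 2) :
    ∃ M : ℝ, Tendsto (fun n : ℕ => P {ω | ¬ ∀ y ∈ L, ∀ t : ℝ, |t| ≤ a →
      |∫ s in (0 : ℝ)..t, w (path f y s) * (pd l (kde K (h n) n fun i => X i ω) (path f y s) -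
        ∫ z, K z * pd l f (path f y s - h n • z))| ≤ M * rate h 5 n}) atTop (𝓝 0) := by
  have hl3 : l.length ≤ 3 := by omega
  have hKc := hK.tame.continuous_pd l hl3
  have hKs := hasCompactSupport_pd hK.hasCompactSupport l
  have := hX.isProbabilityMeasure
  have ha := hL.pos
  obtain ⟨B, hB⟩ := hK.exists_abs_pd_le l hl3
  have hB0 : 0 ≤ B := (abs_nonneg _).trans (hB 0)
  obtain ⟨Λ, hΛ⟩ := hK.tame.lipschitz l hl3
  obtain ⟨r, hr⟩ := hL.compact.isBounded.exists_norm_le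
  obtain ⟨R, Λp, hp⟩ := hf.tame.exists_pathBounds r ha.le
  have hR : ∀ y ∈ L, ∀ t, |t| ≤ a → ‖path f y t‖ ≤ R := fun y hy =>
    hp.norm_le f hf.tame (Close.refl zero_le_one f) y (hr y hy)
  have hΛp0 := hp.nonneg
  have hflow : ∀ y ∈ L, ∀ y' ∈ L, ∀ t, |t| ≤ a → dist (path f y t) (path f y' t) ≤
      Λp * dist y y' := by
    intro y hy y' hy' t ht
    have := hp.norm_sub_le f hf.tame (Close.refl zero_le_one f) y' y (hr y' hy') (hr y hy) t 0 ht
      (fun s _ => by simp)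
    rwa [add_zero, ← dist_eq_norm, ← dist_eq_norm] at this
  obtain ⟨D, hD0, hD⟩ := exists_integral_abs_scale_le hKc hKs (fun z => hK.pd_eq_zero l)
    hf.smooth.continuous hf.density.1 R
  obtain ⟨c, hc, hspeed⟩ := hL.exists_mul_abs_sub_le_norm hf.tame
  have hwc := hw.continuous
  set F : ℕ → Plane → ℝ → Plane → ℝ := fun n y s u =>
    w (path f y s) * ((h n)⁻¹ ^ 4 * pd l K ((h n)⁻¹ • (path f y s - u))) with hF
  have hFc : ∀ n y, Continuous (Function.uncurry (F n y)) := by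
    intro n y
    have := hf.tame.continuous_path y
    simp only [hF, Function.uncurry_def]
    fun_prop
  have hFB : ∀ n y s u, |F n y s u| ≤ (h n)⁻¹ ^ 4 * B := by
    intro n y s u
    have h0 := hh.pos n
    simp only [hF]
    rw [abs_mul, abs_mul, abs_of_pos (a := (h n)⁻¹ ^ 4) (by positivity), ← one_mul (_ * B)]
    gcongr
    exacts [hw1 _, hB _]
  have hFi : ∀ n y s, Integrable (F n y s) (densityMeasure f) := fun n y s =>
    integrable_of_abs_le ((hFc n y).comp (Continuous.prodMk_right s)).measurable (hFB n y s)
  have hsub : ∀ {t : ℝ}, |t| ≤ a → ∀ s ∈ uIoc 0 t, |s| ≤ a := by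
    intro t ht s hs
    have := abs_sub_left_of_mem_uIcc (uIoc_subset_uIcc hs)
    rw [sub_zero, sub_zero] at this
    exact this.trans ht
  set T : Set (Plane × ℝ) := L ×ˢ {t | |t| ≤ a} with hT
  have hTb : Bornology.IsBounded T := by
    refine hL.compact.isBounded.prod ((isBounded_closedBall (x := (0 : ℝ)) (r := a)).subset ?_)
    intro t ht
    simpa using ht
  set ξ : ℕ → Plane × ℝ → Plane → ℝ := fun n p u => ∫ s in (0 : ℝ)..p.2, F n p.1 s u with hξ
  have hξm : ∀ n p, Measurable (ξ n p) := fun n p =>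
    (intervalIntegral.continuous_parametric_intervalIntegral_of_continuous'
      (f := fun u s => F n p.1 s u) ((hFc n p.1).comp continuous_swap) _ _).measurable
  have hξb : ∀ n, ∀ p ∈ T, ∀ u, |ξ n p u| ≤ 2 * B / c * (h n)⁻¹ ^ 3 := by
    intro n p hp u
    have h0 := hh.pos n
    -- Two times at which the kernel around `u` is non-zero correspond to points at distance at most
    -- `2 * h n`, so they differ by at most `2 * h n / c`. This reduces the size from `h⁻¹ ^ 4` to
    -- `h⁻¹ ^ 3`.
    have h1 := abs_intervalIntegral_le_mul_diam (g := fun s => F n p.1 s u) (t := p.2)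
      (d := 2 * h n / c) (by positivity) (fun s => hFB n p.1 s u) fun s hs s' hs' hne hne' => by
        have hnear : ∀ s, F n p.1 s u ≠ 0 → ‖path f p.1 s - u‖ ≤ h n := by
          intro s hne
          by_contra! hlt
          refine hne ?_
          simp only [hF]
          rw [hK.pd_eq_zero l, mul_zero, mul_zero]
          rw [norm_smul, Real.norm_of_nonneg (inv_pos.mpr h0).le, ← div_eq_inv_mul]
          exact (one_lt_div h0).mpr hlt
        rw [le_div_iff₀ hc, mul_comm]
        refine (hspeed p.1 hp.1 s s' (hsub hp.2 s hs) (hsub hp.2 s' hs')).trans ?_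
        have h2 := norm_sub_le (path f p.1 s - u) (path f p.1 s' - u)
        rw [sub_sub_sub_cancel_right] at h2
        linarith [hnear s hne, hnear s' hne']
    refine h1.trans (le_of_eq ?_)
    rw [pow_succ (h n)⁻¹ 3]
    field_simp
  have hξ1 : ∀ n, h n ≤ 1 → ∀ p ∈ T, ∫ u, |ξ n p u| ∂(densityMeasure f) ≤
      a * D * (h n)⁻¹ ^ 2 := by
    intro n hn p hp
    have h0 := hh.pos n
    refine (integral_abs_intervalIntegral_le (hFc n p.1) (hFB n p.1) (D := D * (h n)⁻¹ ^ 2)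
      fun s hs => ?_).trans ?_
    · have h1 := hD (path f p.1 s) (hR p.1 hp.1 s (hsub hp.2 s hs)) _ h0 hn
      have hint : Integrable (fun u => |pd l K ((h n)⁻¹ • (path f p.1 s - u))|)
          (densityMeasure f) := by
        have : Continuous fun u => |pd l K ((h n)⁻¹ • (path f p.1 s - u))| := by fun_prop
        exact integrable_of_abs_le this.measurable (b := B) fun u => by rw [abs_abs]; exact hB _
      calc ∫ u, |F n p.1 s u| ∂(densityMeasure f)
          ≤ ∫ u, (h n)⁻¹ ^ 4 * |pd l K ((h n)⁻¹ • (path f p.1 s - u))| ∂(densityMeasure f) := by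
            refine integral_mono (hFi n p.1 s).abs (hint.const_mul _) fun u => ?_
            simp only [hF]
            rw [abs_mul, abs_mul, abs_of_pos (a := (h n)⁻¹ ^ 4) (by positivity)]
            exact mul_le_of_le_one_left (by positivity) (hw1 _)
        _ ≤ (h n)⁻¹ ^ 4 * (D * h n ^ 2) := by
            rw [integral_const_mul]
            gcongr
        _ = D * (h n)⁻¹ ^ 2 := by
            rw [show 4 = 2 + 2 by rfl, pow_add, inv_pow]
            field_simp
    · have h2 : |p.2| ≤ a := hp.2
      calc D * (h n)⁻¹ ^ 2 * |p.2| ≤ D * (h n)⁻¹ ^ 2 * a := by gcongr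
        _ = _ := by ring
  have hξint : ∀ n, ∀ p ∈ T, Integrable (ξ n p) (densityMeasure f) := fun n p hp =>
    integrable_of_abs_le (hξm n p) (hξb n p hp)
  have hFdist : ∀ n, h n ≤ 1 → ∀ y ∈ L, ∀ y' ∈ L, ∀ s, |s| ≤ a → ∀ u,
      |F n y s u - F n y' s u| ≤ (Kw * B + Λ) * Λp * (h n)⁻¹ ^ 5 * dist y y' := by
    intro n hn y hy y' hy' s hs u
    have h0 := hh.pos n
    have hinv : 1 ≤ (h n)⁻¹ := (one_le_inv₀ h0).mpr hn
    have h45 : (h n)⁻¹ ^ 4 ≤ (h n)⁻¹ ^ 5 := pow_le_pow_right₀ hinv (by norm_num)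
    have h1 := abs_comp_scale_sub_le hΛ (inv_pos.mpr h0).le (path f y s) (path f y' s) u u
    rw [dist_self, add_zero] at h1
    have h2 : |w (path f y s) - w (path f y' s)| ≤ Kw * dist (path f y s) (path f y' s) := by
      rw [← Real.dist_eq]; exact hw.dist_le_mul _ _
    have h3 := hflow y hy y' hy' s hs
    have e : F n y s u - F n y' s u = (h n)⁻¹ ^ 4 * ((w (path f y s) - w (path f y' s)) *
        pd l K ((h n)⁻¹ • (path f y s - u)) + w (path f y' s) *
        (pd l K ((h n)⁻¹ • (path f y s - u)) - pd l K ((h n)⁻¹ • (path f y' s - u)))) := by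
      simp only [hF]; ring
    rw [e, abs_mul, abs_of_pos (a := (h n)⁻¹ ^ 4) (by positivity)]
    calc _ ≤ (h n)⁻¹ ^ 4 * (Kw * (Λp * dist y y') * B +
          1 * (Λ * ((h n)⁻¹ * (Λp * dist y y')))) := by
          refine mul_le_mul_of_nonneg_left ((abs_add_le _ _).trans ?_) (by positivity)
          rw [abs_mul, abs_mul]
          gcongr
          · exact h2.trans (by gcongr)
          · exact hB _
          · exact hw1 _
          · exact h1.trans (by gcongr)
      _ = (h n)⁻¹ ^ 4 * (Kw * B * Λp * dist y y') + (h n)⁻¹ ^ 5 * (Λ * Λp * dist y y') := by ring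
      _ ≤ (h n)⁻¹ ^ 5 * (Kw * B * Λp * dist y y') + (h n)⁻¹ ^ 5 * (Λ * Λp * dist y y') := by
          gcongr
      _ = _ := by ring
  obtain ⟨M, hM⟩ := hX.tendsto_measure_deviation_rate hh (T := T) hTb (ξ := ξ) (B := 2 * B / c)
    (D := 2 * B / c * (a * D)) (Λ := (Kw * B + Λ) * Λp * a + B)
    -- The second moment is at most the supremum, of order `h⁻¹ ^ 3`, times the first absolute
    -- moment, of order `h⁻¹ ^ 2`. Pointwise second derivatives would have `h⁻¹ ^ 6` instead.
    (kb := 3) (kv := 5) (kΛ := 5) (by norm_num) (by norm_num) (fun n p _ => hξm n p)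
    (fun n _ p hp x => hξb n p hp x)
    (fun n hn p hp => by
      have h0 := hh.pos n
      calc ∫ x, ξ n p x ^ 2 ∂(densityMeasure f)
          ≤ ∫ x, 2 * B / c * (h n)⁻¹ ^ 3 * |ξ n p x| ∂(densityMeasure f) := by
            refine integral_mono_of_nonneg (Eventually.of_forall fun _ => sq_nonneg _)
              ((hξint n p hp).abs.const_mul _) (Eventually.of_forall fun u => ?_)
            change ξ n p u ^ 2 ≤ _ * |ξ n p u|
            rw [← sq_abs, sq]
            exact mul_le_mul_of_nonneg_right (hξb n p hp u) (abs_nonneg _)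
        _ ≤ 2 * B / c * (h n)⁻¹ ^ 3 * (a * D * (h n)⁻¹ ^ 2) := by
            rw [integral_const_mul]
            gcongr
            exact hξ1 n hn p hp
        _ = _ := by ring)
    (fun n hn p hp q hq u => by
      have h0 := hh.pos n
      have hinv : 1 ≤ (h n)⁻¹ := (one_le_inv₀ h0).mpr hn
      have h45 : (h n)⁻¹ ^ 4 ≤ (h n)⁻¹ ^ 5 := pow_le_pow_right₀ hinv (by norm_num)
      have hii : ∀ y b b', IntervalIntegrable (fun s => F n y s u) volume b b' := fun y b b' =>
        ((hFc n y).comp (Continuous.prodMk_left u)).intervalIntegrable _ _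
      -- First the starting point is changed at fixed final time, then the final time at fixed
      -- starting point.
      have e : ξ n p u - ξ n q u = (∫ s in (0 : ℝ)..p.2, (F n p.1 s u - F n q.1 s u)) +
          ∫ s in q.2..p.2, F n q.1 s u := by
        simp only [hξ]
        rw [intervalIntegral.integral_sub (hii _ _ _) (hii _ _ _),
          ← intervalIntegral.integral_interval_sub_left (hii q.1 0 p.2) (hii q.1 0 q.2)]
        ring
      have h1 : |∫ s in (0 : ℝ)..p.2, (F n p.1 s u - F n q.1 s u)| ≤
          (Kw * B + Λ) * Λp * (h n)⁻¹ ^ 5 * dist p.1 q.1 * |p.2 - 0| := by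
        rw [← Real.norm_eq_abs]
        exact intervalIntegral.norm_integral_le_of_norm_le_const fun s hs =>
          hFdist n hn p.1 hp.1 q.1 hq.1 s (hsub hp.2 s hs) u
      have h2 : |∫ s in q.2..p.2, F n q.1 s u| ≤ (h n)⁻¹ ^ 4 * B * |p.2 - q.2| := by
        rw [← Real.norm_eq_abs]
        exact intervalIntegral.norm_integral_le_of_norm_le_const fun s _ => hFB n q.1 s u
      have h3 : |p.2 - 0| ≤ a := by rw [sub_zero]; exact hp.2
      have h4 : dist p.1 q.1 ≤ dist p q := le_max_left _ _
      have h5 : |p.2 - q.2| ≤ dist p q := le_max_right _ _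
      rw [e]
      calc _ ≤ (Kw * B + Λ) * Λp * (h n)⁻¹ ^ 5 * dist p.1 q.1 * |p.2 - 0| +
            (h n)⁻¹ ^ 4 * B * |p.2 - q.2| := (abs_add_le _ _).trans (add_le_add h1 h2)
        _ ≤ (Kw * B + Λ) * Λp * (h n)⁻¹ ^ 5 * dist p q * a + (h n)⁻¹ ^ 5 * B * dist p q := by
            gcongr
        _ = _ := by ring)
  refine ⟨M, ?_⟩
  convert hM using 4 with n
  ext ω
  have h0 := hh.pos n
  -- By Fubini's theorem, the path integral of the centred derivative is a centred empirical mean of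
  -- the path integrals `ξ n p`.
  have key : ∀ p : Plane × ℝ, ∫ s in (0 : ℝ)..p.2, w (path f p.1 s) *
      (pd l (kde K (h n) n fun i => X i ω) (path f p.1 s) -
        ∫ z, K z * pd l f (path f p.1 s - h n • z)) =
      1 / (n : ℝ) * ∑ i ∈ Finset.range n, ξ n p (X i ω) - ∫ x, ξ n p x ∂(densityMeasure f) := by
    intro p
    have hii : ∀ u, IntervalIntegrable (fun s => F n p.1 s u) volume 0 p.2 := fun u =>
      ((hFc n p.1).comp (Continuous.prodMk_left u)).intervalIntegrable _ _
    have hprod := integrable_uncurry_of_bounded (ν := densityMeasure f) (hFc n p.1) (hFB n p.1) p.2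
    have hE : IntervalIntegrable (fun s => ∫ u, F n p.1 s u ∂(densityMeasure f)) volume 0 p.2 :=
      intervalIntegrable_iff.mpr hprod.integral_prod_left
    have hsum : IntervalIntegrable (fun s => 1 / (n : ℝ) * ∑ i ∈ Finset.range n,
        F n p.1 s (X i ω)) volume 0 p.2 := (continuous_const.mul (continuous_finsetSum _ fun i _ =>
      (hFc n p.1).comp (Continuous.prodMk_left (X i ω)))).intervalIntegrable _ _
    simp only [hξ]
    rw [← intervalIntegral_integral_swap hprod, ← intervalIntegral.integral_finsetSum
      fun i _ => hii (X i ω), ← intervalIntegral.integral_const_mul,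
      ← intervalIntegral.integral_sub hsum hE]
    refine intervalIntegral.integral_congr fun s _ => ?_
    change w (path f p.1 s) * (pd l (kde K (h n) n fun i => X i ω) (path f p.1 s) -
        ∫ z, K z * pd l f (path f p.1 s - h n • z)) =
      1 / (n : ℝ) * ∑ i ∈ Finset.range n, F n p.1 s (X i ω) - ∫ u, F n p.1 s u ∂(densityMeasure f)
    simp only [hF]
    rw [pd_kde_eq_mean hK.tame _ _ _ hl3, ← integral_pd_scale hK.tame hK.hasCompactSupport
      (hf.smooth.of_le (by norm_num)) hf.density.1 l hl3 _ h0, hl, mul_sub,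
      ← integral_const_mul (w _), mul_left_comm, Finset.mul_sum]
  refine not_congr ⟨fun H p hp => ?_, fun H y hy t ht => ?_⟩
  · rw [← key]
    exact H p.1 hp.1 p.2 hp.2
  · have := H (y, t) ⟨hy, ht⟩
    rwa [← key] at this

end Sample

/-! ### Comparison of the rates -/

section Rates

variable {h : ℕ → ℝ}

theorem rate_nonneg (h : ℕ → ℝ) (k n : ℕ) : 0 ≤ rate h k n := Real.sqrt_nonneg _

namespace BandwidthAssumptions

theorem eventually_rate_le_rate (hh : BandwidthAssumptions h) {j k : ℕ} (hjk : j ≤ k) :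
    ∀ᶠ n in atTop, rate h j n ≤ rate h k n := by
  filter_upwards [hh.eventually_le_one, eventually_one_le_log, eventually_ge_atTop 1]
    with n h1 hlog hn
  have h0 := hh.pos n
  have hn' : (0 : ℝ) < n := by exact_mod_cast hn
  refine Real.sqrt_le_sqrt (div_le_div_of_nonneg_left (by linarith) (by positivity) ?_)
  exact mul_le_mul_of_nonneg_left (pow_le_pow_of_le_one h0.le h1 hjk) hn'.le

/-- The exponent 8 is that of the third derivatives, which only need to converge; no rate for them
enters the conclusion. -/
theorem tendsto_rate (hh : BandwidthAssumptions h) : Tendsto (rate h 8) atTop (𝓝 0) := by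
  have h1 : Tendsto (fun n : ℕ => Real.log n / (n * h n ^ 8)) atTop (𝓝 0) := by
    refine tendsto_of_tendsto_of_tendsto_of_le_of_le' tendsto_const_nhds
      hh.lower.inv_tendsto_atTop ?_ ?_
    · filter_upwards [eventually_one_le_log] with n hlog
      have h0 := hh.pos n
      have : 0 ≤ Real.log n := by linarith
      positivity
    · filter_upwards [eventually_one_le_log] with n hlog
      have h0 := hh.pos n
      rw [Pi.inv_apply, inv_div]
      exact div_le_div_of_nonneg_right (le_self_pow₀ hlog (by norm_num)) (by positivity)
  have h2 := (Real.continuous_sqrt.tendsto 0).comp h1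
  rwa [Real.sqrt_zero] at h2

/-- The bias is absorbed: `h n ^ 4 * (n * h n ^ 5) = n * h n ^ 9` stays bounded. -/
theorem exists_eventually_sq_le (hh : BandwidthAssumptions h) :
    ∃ B : ℝ, 0 ≤ B ∧ ∀ᶠ n in atTop, h n ^ 2 ≤ B * rate h 5 n := by
  obtain ⟨β, hβ, hlim⟩ := hh.upper
  refine ⟨√(β + 1), Real.sqrt_nonneg _, ?_⟩
  filter_upwards [eventually_one_le_log, eventually_ge_atTop 1,
    hlim.eventually (gt_mem_nhds (lt_add_one β))] with n hlog hn hb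
  have h0 := hh.pos n
  have hn' : (0 : ℝ) < n := by exact_mod_cast hn
  rw [rate, ← Real.sqrt_mul (by linarith)]
  refine Real.le_sqrt_of_sq_le ?_
  rw [← mul_div_assoc, le_div_iff₀ (by positivity)]
  calc (h n ^ 2) ^ 2 * (n * h n ^ 5) = n * h n ^ 9 := by ring
    _ ≤ (β + 1) * 1 := by linarith
    _ ≤ (β + 1) * Real.log n := by gcongr

/-- The quadratic remainder of the linearization is absorbed: after squaring, the claim is `log n ≤
n * h n ^ 7`. -/
theorem eventually_rate_sq_le (hh : BandwidthAssumptions h) :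
    ∀ᶠ n in atTop, rate h 6 n ^ 2 ≤ rate h 5 n := by
  filter_upwards [hh.eventually_le_one, eventually_one_le_log, eventually_ge_atTop 1,
    hh.eventually_mul_log_le 1 (j := 0) (k := 7) (by norm_num)] with n h1 hlog hn hle
  have h0 := hh.pos n
  have hn' : (0 : ℝ) < n := by exact_mod_cast hn
  have hlog0 : 0 < Real.log n := by linarith
  rw [pow_zero, mul_one, one_mul, inv_pow, inv_mul_le_iff₀ (by positivity)] at hle
  rw [rate, rate, Real.sq_sqrt (by positivity)]
  refine Real.le_sqrt_of_sq_le ?_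
  rw [div_pow, div_le_div_iff₀ (by positivity) (by positivity)]
  calc Real.log n ^ 2 * (n * h n ^ 5) = Real.log n * (n * h n ^ 5) * Real.log n := by ring
    _ ≤ Real.log n * (n * h n ^ 5) * (h n ^ 7 * n) := by gcongr
    _ = _ := by ring

end BandwidthAssumptions

end Rates

/-! ### Events of high probability -/

section HighProbability

variable {Ω : Type*} [MeasurableSpace Ω] {P : Measure Ω}

/-- The outer probability that `A n` fails tends to zero. -/
def WithHighProbability (P : Measure Ω) (A : ℕ → Ω → Prop) : Prop :=
  Tendsto (fun n => P {ω | ¬ A n ω}) atTop (𝓝 0)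

theorem WithHighProbability.mono {A B : ℕ → Ω → Prop} (hA : WithHighProbability P A)
    (hAB : ∀ᶠ n in atTop, ∀ ω, A n ω → B n ω) : WithHighProbability P B :=
  tendsto_of_tendsto_of_tendsto_of_le_of_le' tendsto_const_nhds hA
    (Eventually.of_forall fun _ => zero_le)
    (hAB.mono fun _ hn => measure_mono fun ω hω h => hω (hn ω h))

theorem WithHighProbability.and {A B : ℕ → Ω → Prop} (hA : WithHighProbability P A)
    (hB : WithHighProbability P B) : WithHighProbability P fun n ω => A n ω ∧ B n ω := by
  have h1 := hA.add hB
  rw [add_zero] at h1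
  refine tendsto_of_tendsto_of_tendsto_of_le_of_le tendsto_const_nhds h1
    (fun _ => zero_le) fun n => ?_
  refine (measure_mono fun ω hω => ?_).trans (measure_union_le _ _)
  exact not_and_or.mp hω

theorem WithHighProbability.forall {ι : Type*} [Finite ι] {A : ι → ℕ → Ω → Prop}
    (hA : ∀ i, WithHighProbability P (A i)) : WithHighProbability P fun n ω => ∀ i, A i n ω := by
  have := Fintype.ofFinite ι
  have h1 := tendsto_finsetSum (Finset.univ : Finset ι) fun i _ => hA i
  rw [Finset.sum_const_zero] at h1
  refine tendsto_of_tendsto_of_tendsto_of_le_of_le tendsto_const_nhds h1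
    (fun _ => zero_le) fun n => ?_
  refine (measure_mono fun ω hω => ?_).trans (measure_iUnion_fintype_le P fun i => {ω | ¬ A i n ω})
  simpa using hω

theorem WithHighProbability.exists_forall {ι : Type*} [Finite ι] {A : ι → ℝ → ℕ → Ω → Prop}
    (hmono : ∀ i M M' n ω, M ≤ M' → A i M n ω → A i M' n ω)
    (hA : ∀ i, ∃ M, WithHighProbability P (A i M)) :
    ∃ M, 0 ≤ M ∧ WithHighProbability P fun n ω => ∀ i, A i M n ω := by
  choose M hM using hA
  obtain ⟨M', hM'⟩ := Finite.exists_le M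
  exact ⟨max M' 0, le_max_right _ _, WithHighProbability.forall fun i => (hM i).mono
    (Eventually.of_forall fun n ω => hmono i _ _ n ω ((hM' i).trans (le_max_left _ _)))⟩

theorem WithHighProbability.isBigOInProbability {Y : ℕ → Ω → ℝ≥0∞} {α : ℕ → ℝ} {M : ℝ}
    (hα : ∀ n, 0 ≤ α n)
    (hY : WithHighProbability P fun n ω => Y n ω ≤ ENNReal.ofReal (M * α n)) :
    IsBigOInProbability P Y α := by
  intro ε hε
  -- One constant serves every `ε`, because the failure probability tends to zero; the maximum with
  -- 1 makes it positive.
  refine ⟨max M 1, by positivity, ?_⟩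
  filter_upwards [hY.eventually (ge_mem_nhds (ENNReal.ofReal_pos.mpr hε))] with n hn
  refine (measure_mono fun ω hω => ?_).trans hn
  refine not_le.mpr (lt_of_le_of_lt (ENNReal.ofReal_le_ofReal ?_) hω)
  exact mul_le_mul_of_nonneg_right (le_max_left _ _) (hα n)

end HighProbability

/-! ### Bias -/

theorem KernelAssumptions.continuous_integral_mul {K g : Plane → ℝ} (hK : KernelAssumptions K)
    {C : ℝ≥0} (hg : LipschitzWith C g) (h : ℝ) :
    Continuous fun y : Plane => ∫ z, K z * g (y - h • z) := by
  have hKc : Continuous K := hK.tame.continuous_pd [] (by simp)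
  refine (LipschitzWith.of_dist_le_mul (K := C) fun y y' => ?_).continuous
  rw [Real.dist_eq, ← integral_sub (integrable_mul_comp hKc hK.hasCompactSupport hg.continuous y h)
    (integrable_mul_comp hKc hK.hasCompactSupport hg.continuous y' h)]
  simp only [← mul_sub]
  refine hK.abs_integral_mul_le fun z _ => ?_
  have := hg.dist_le_mul (y - h • z) (y' - h • z)
  rwa [Real.dist_eq, dist_sub_right] at this

/-- Order `h ^ 2` requires one more Lipschitz derivative than order `h`, hence the different ranges
of `l.length`. -/
theorem KernelAssumptions.exists_abs_bias_le {K f : Plane → ℝ} (hK : KernelAssumptions K)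
    (hf : Tame f) : ∃ C : ℝ, 0 ≤ C ∧ ∀ h : ℝ, 0 < h → ∀ (l : List (Fin 2)) (y : Plane),
      (l.length ≤ 3 → |(∫ z, K z * pd l f (y - h • z)) - pd l f y| ≤ C * h) ∧
      (l.length ≤ 2 → |(∫ z, K z * pd l f (y - h • z)) - pd l f y| ≤ C * h ^ 2) := by
  obtain ⟨C, hC⟩ := hf.exists_lipschitzWith
  refine ⟨2 * C, by positivity, fun h hh l y => ⟨fun hl => ?_, fun hl => ?_⟩⟩
  · refine (hK.abs_integral_sub_le_of_lipschitz (hC l hl) y hh).trans ?_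
    nlinarith [C.2]
  · exact hK.abs_integral_sub_le_of_lipschitz_deriv (hf.differentiable l hl)
      (fun i => hC (i :: l) (Nat.succ_le_succ hl)) y hh

/-! ### The main estimate -/

section Sample

variable {Ω : Type*} [MeasurableSpace Ω] {P : Measure Ω} [IsProbabilityMeasure P]
  {X : ℕ → Ω → Plane} {f K : Plane → ℝ} {h : ℕ → ℝ} {H L : Set Plane} {a : ℝ}

/-- The partial derivatives of the kernel density estimator are uniformly close to those of the
density. -/
theorem exists_withHighProbability_pd_kde_sub_le (hX : IsSample P X f)
    (hh : BandwidthAssumptions h) (hf : DensityAssumptions f) (hK : KernelAssumptions K) (R : ℝ) :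
    ∃ M : ℝ, 0 ≤ M ∧ WithHighProbability P fun n ω => ∀ (l : List (Fin 2)) (y : Plane), ‖y‖ ≤ R →
      (l.length ≤ 3 → |pd l (kde K (h n) n fun i => X i ω) y - pd l f y| ≤
        M * (rate h (2 + 2 * l.length) n + h n)) ∧
      (l.length ≤ 2 → |pd l (kde K (h n) n fun i => X i ω) y - pd l f y| ≤
        M * (rate h (2 + 2 * l.length) n + h n ^ 2)) := by
  have : Finite {l : List (Fin 2) | l.length ≤ 3} := List.finite_length_le _ _
  obtain ⟨M, hM0, hM⟩ := WithHighProbability.exists_forall (P := P)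
    (ι := {l : List (Fin 2) | l.length ≤ 3})
    (A := fun l M n ω => ∀ y : Plane, ‖y‖ ≤ R → |pd l.1 (kde K (h n) n fun i => X i ω) y -
      ∫ z, K z * pd l.1 f (y - h n • z)| ≤ M * rate h (2 + 2 * l.1.length) n)
    (fun l M M' n ω hMM hA y hy => (hA y hy).trans
      (mul_le_mul_of_nonneg_right hMM (rate_nonneg _ _ _)))
    fun l => tendsto_measure_pd_kde_sub_mean hX hh hf hK R l.1 l.2
  obtain ⟨C, hC0, hC⟩ := hK.exists_abs_bias_le hf.tame
  refine ⟨M + C, by positivity, hM.mono (Eventually.of_forall fun n ω hω l y hy => ?_)⟩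
  have h0 := hh.pos n
  have hr := rate_nonneg h (2 + 2 * l.length) n
  refine ⟨fun hl => ?_, fun hl => ?_⟩
  · have h1 := abs_add_le (pd l (kde K (h n) n fun i => X i ω) y -
      ∫ z, K z * pd l f (y - h n • z)) ((∫ z, K z * pd l f (y - h n • z)) - pd l f y)
    rw [sub_add_sub_cancel] at h1
    have h2 := hω ⟨l, hl⟩ y hy
    have h3 := (hC (h n) h0 l y).1 hl
    have h4 : 0 ≤ M * h n := by positivity
    have h5 : 0 ≤ C * rate h (2 + 2 * l.length) n := by positivity
    dsimp only at h2
    linarith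
  · have h1 := abs_add_le (pd l (kde K (h n) n fun i => X i ω) y -
      ∫ z, K z * pd l f (y - h n • z)) ((∫ z, K z * pd l f (y - h n • z)) - pd l f y)
    rw [sub_add_sub_cancel] at h1
    have h2 := hω ⟨l, hl.trans (by norm_num)⟩ y hy
    have h3 := (hC (h n) h0 l y).2 hl
    have h4 : 0 ≤ M * h n ^ 2 := by positivity
    have h5 : 0 ≤ C * rate h (2 + 2 * l.length) n := by positivity
    dsimp only at h2
    linarith

/-- The integrals of weighted second order partial derivatives along the integral curves are
uniformly close to those for the density. -/
theorem exists_withHighProbability_path_integral_le (hX : IsSample P X f)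
    (hh : BandwidthAssumptions h) (hf : DensityAssumptions f) (hK : KernelAssumptions K)
    (hL : FilamentAssumptions f H L a) {ι : Type*} [Finite ι] {w : ι → Plane → ℝ}
    (hw1 : ∀ k x, |w k x| ≤ 1) (hw : ∀ k, ∃ C : ℝ≥0, LipschitzWith C (w k)) :
    ∃ M : ℝ, 0 ≤ M ∧ WithHighProbability P fun n ω => ∀ y ∈ L, ∀ t : ℝ, |t| ≤ a → ∀ k i j,
      |∫ u in (0 : ℝ)..t, w k (path f y u) * (pd [i, j] (kde K (h n) n fun i => X i ω)
        (path f y u) - pd [i, j] f (path f y u))| ≤ M * (rate h 5 n + h n ^ 2) := by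
  obtain ⟨M, hM0, hM⟩ := WithHighProbability.exists_forall (P := P) (ι := ι × Fin 2 × Fin 2)
    (A := fun p M n ω => ∀ y ∈ L, ∀ t : ℝ, |t| ≤ a → |∫ u in (0 : ℝ)..t, w p.1 (path f y u) *
      (pd [p.2.1, p.2.2] (kde K (h n) n fun i => X i ω) (path f y u) -
        ∫ z, K z * pd [p.2.1, p.2.2] f (path f y u - h n • z))| ≤ M * rate h 5 n)
    (fun p M M' n ω hMM hA y hy t ht => (hA y hy t ht).trans
      (mul_le_mul_of_nonneg_right hMM (rate_nonneg _ _ _)))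
    fun p => by
      obtain ⟨C, hC⟩ := hw p.1
      exact tendsto_measure_path_integral hX hh hf hK hL (hw1 p.1) hC rfl
  obtain ⟨C, hC0, hC⟩ := hK.exists_abs_bias_le hf.tame
  have ha := hL.pos
  refine ⟨M + C * a, by positivity, hM.mono (Eventually.of_forall fun n ω hω y hy t ht k i j => ?_)⟩
  have h0 := hh.pos n
  have hr := rate_nonneg h 5 n
  obtain ⟨Cw, hCw⟩ := hw k
  obtain ⟨Cf, hCf⟩ := hf.tame.lipschitz [i, j] (by simp)
  have hc1 := hCw.continuous
  have hc2 := hK.continuous_integral_mul hCf (h n)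
  have hc3 := (tame_kde hK.tame h0 n fun i => X i ω).continuous_pd [i, j] (by simp)
  have hc4 := hf.tame.continuous_path y
  have hc5 := hCf.continuous
  set E : Plane → ℝ := fun y => ∫ z, K z * pd [i, j] f (y - h n • z) with hE
  -- Only the stochastic part gains from integration along the curve; the bias part is bounded
  -- pointwise, with the weights at most 1.
  have e : ∫ u in (0 : ℝ)..t, w k (path f y u) * (pd [i, j] (kde K (h n) n fun i => X i ω)
      (path f y u) - pd [i, j] f (path f y u)) =
      (∫ u in (0 : ℝ)..t, w k (path f y u) * (pd [i, j] (kde K (h n) n fun i => X i ω)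
        (path f y u) - E (path f y u))) +
      ∫ u in (0 : ℝ)..t, w k (path f y u) * (E (path f y u) - pd [i, j] f (path f y u)) := by
    rw [← intervalIntegral.integral_add]
    · refine intervalIntegral.integral_congr fun u _ => ?_
      ring
    · exact Continuous.intervalIntegrable (by fun_prop) _ _
    · exact Continuous.intervalIntegrable (by fun_prop) _ _
  have h1 := hω (k, i, j) y hy t ht
  have h2 : |∫ u in (0 : ℝ)..t, w k (path f y u) * (E (path f y u) - pd [i, j] f (path f y u))| ≤
      C * h n ^ 2 * |t - 0| := by
    rw [← Real.norm_eq_abs]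
    refine intervalIntegral.norm_integral_le_of_norm_le_const fun u _ => ?_
    rw [Real.norm_eq_abs, abs_mul]
    exact (mul_le_of_le_one_left (abs_nonneg _) (hw1 _ _)).trans
      ((hC (h n) h0 [i, j] _).2 (by simp))
  have h3 : C * h n ^ 2 * |t - 0| ≤ C * h n ^ 2 * a := by
    rw [sub_zero]; gcongr
  have h4 : 0 ≤ M * h n ^ 2 := by positivity
  have h5 : 0 ≤ C * a * rate h 5 n := by positivity
  rw [e]
  refine (abs_add_le _ _).trans ?_
  dsimp only at h1
  linarith

/-- Uniqueness of the minimizer and the rates of its convergence, with high probability. -/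
theorem exists_withHighProbability_theta (hX : IsSample P X f) (hh : BandwidthAssumptions h)
    (hf : DensityAssumptions f) (hH : RegionAssumptions f H) (hK : KernelAssumptions K)
    (hL : FilamentAssumptions f H L a) :
    ∃ M : ℝ, WithHighProbability P fun n ω =>
      (∀ x ∈ startingSet f L a,
        ∃! t, IsArgminAbs (filamentTimes (kde K (h n) n fun i => X i ω) x) t) ∧
      (∀ x ∈ startingSet f L a,
        |theta (kde K (h n) n fun i => X i ω) x - theta f x| ≤ M * rate h 6 n) ∧
      ((∀ x ∈ startingSet f L a, ∇ f (path f x (theta f x)) = 0) → ∀ x ∈ startingSet f L a,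
        |theta (kde K (h n) n fun i => X i ω) x - theta f x| ≤ M * rate h 5 n) := by
  obtain ⟨R, η, C, w, hη, hC, hw1, hw, -, hdet⟩ := hL.deterministic_bound hf.tame hH
  obtain ⟨M₁, hM₁, hev₁⟩ := exists_withHighProbability_pd_kde_sub_le hX hh hf hK R
  obtain ⟨M₂, hM₂, hev₂⟩ := exists_withHighProbability_path_integral_le hX hh hf hK hL hw1 hw
  obtain ⟨B, hB, hsq⟩ := hh.exists_eventually_sq_le
  -- This bounds the errors of all orders up to three, the third being the largest, so the estimator
  -- eventually enters the fixed `η`-neighbourhood of `f` on the event considered.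
  have hsmall : ∀ᶠ n in atTop, M₁ * (rate h 8 n + h n) ≤ η := by
    have : Tendsto (fun n => M₁ * (rate h 8 n + h n)) atTop (𝓝 0) := by
      simpa using (hh.tendsto_rate.add hh.to_zero).const_mul M₁
    exact (this.eventually (gt_mem_nhds hη)).mono fun _ => le_of_lt
  set A₁ := M₁ * (1 + B) with hA₁
  set A₂ := M₂ * (1 + B) with hA₂
  refine ⟨max (C * (A₁ + A₁)) (C * (A₁ + A₂ + A₁ ^ 2)), (hev₁.and hev₂).mono ?_⟩
  filter_upwards [hsmall, hsq, hh.eventually_rate_le_rate (j := 4) (k := 5) (by norm_num),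
    hh.eventually_rate_le_rate (j := 5) (k := 6) (by norm_num),
    hh.eventually_rate_le_rate (j := 4) (k := 8) (by norm_num),
    hh.eventually_rate_le_rate (j := 6) (k := 8) (by norm_num), hh.eventually_rate_sq_le]
    with n hn hsqn h45 h56 h48 h68 hsq6 ω hω
  have h0 := hh.pos n
  have hr5 := rate_nonneg h 5 n
  have hr6 := rate_nonneg h 6 n
  have hclose : Close R η f (kde K (h n) n fun i => X i ω) := by
    intro l h1 h3 x hx
    refine ((hω.1 l x hx).1 h3).trans (le_trans ?_ hn)
    gcongr
    interval_cases l.length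
    exacts [h48, h68, le_rfl]
  obtain ⟨huniq, hbound⟩ := hdet _ (tame_kde hK.tame h0 n fun i => X i ω) hclose
  -- The gradient error, with stochastic rate exponent 4 and bias `h n ^ 2`, already satisfies the
  -- bound with exponent 5; the second derivatives reach only exponent 6.
  obtain ⟨hb₁, hb₂⟩ := hbound (A₁ * rate h 5 n) (A₁ * rate h 6 n)
    (fun i x hx => ((hω.1 [i] x hx).2 (by simp)).trans (by
      rw [hA₁, mul_assoc]
      refine mul_le_mul_of_nonneg_left ?_ hM₁
      change rate h 4 n + h n ^ 2 ≤ _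
      linarith))
    (fun i j x hx => ((hω.1 [i, j] x hx).2 (by simp)).trans (by
      rw [hA₁, mul_assoc]
      refine mul_le_mul_of_nonneg_left ?_ hM₁
      change rate h 6 n + h n ^ 2 ≤ _
      nlinarith [mul_le_mul_of_nonneg_left h56 hB]))
  have hA₁0 : 0 ≤ A₁ := by positivity
  refine ⟨huniq, fun x hx => (hb₁ x hx).trans ?_, fun hgrad x hx =>
    (hb₂ hgrad (A₂ * rate h 5 n) (fun y hy t ht k i j => (hω.2 y hy t ht k i j).trans (by
      rw [hA₂, mul_assoc]
      refine mul_le_mul_of_nonneg_left ?_ hM₂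
      linarith)) x hx).trans ?_⟩
  · calc C * (A₁ * rate h 5 n + A₁ * rate h 6 n) ≤ C * (A₁ * rate h 6 n + A₁ * rate h 6 n) := by
          gcongr
      _ = C * (A₁ + A₁) * rate h 6 n := by ring
      _ ≤ _ := mul_le_mul_of_nonneg_right (le_max_left _ _) hr6
  · calc C * (A₁ * rate h 5 n + A₂ * rate h 5 n + (A₁ * rate h 6 n) ^ 2) =
          C * (A₁ * rate h 5 n + A₂ * rate h 5 n + A₁ ^ 2 * rate h 6 n ^ 2) := by ring
      _ ≤ C * (A₁ * rate h 5 n + A₂ * rate h 5 n + A₁ ^ 2 * rate h 5 n) := by gcongr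
      _ = C * (A₁ + A₂ + A₁ ^ 2) * rate h 5 n := by ring
      _ ≤ _ := mul_le_mul_of_nonneg_right (le_max_right _ _) hr5

end Sample

theorem thetaDeviation_le {g₁ g₂ : Plane → ℝ} {S : Set Plane} {c : ℝ}
    (h : ∀ x ∈ S, |theta g₁ x - theta g₂ x| ≤ c) : thetaDeviation g₁ g₂ S ≤ ENNReal.ofReal c :=
  iSup₂_le fun x hx => ENNReal.ofReal_le_ofReal (h x hx)

end Ridge

end

theorem proposition5p1 {Ω : Type*} [MeasurableSpace Ω] (P : Measure Ω) [IsProbabilityMeasure P]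
    (f K : Plane → ℝ) (H L : Set Plane) (a : ℝ) (h : ℕ → ℝ) (X : ℕ → Ω → Plane)
    (hf : Ridge.DensityAssumptions f) (hH : Ridge.RegionAssumptions f H)
    (hL : Ridge.FilamentAssumptions f H L a) (hK : Ridge.KernelAssumptions K)
    (hh : Ridge.BandwidthAssumptions h) (hX : Ridge.IsSample P X f) :
    Ridge.IsBigOInProbability P
      (fun n ω => Ridge.thetaDeviation (Ridge.kde K (h n) n fun i => X i ω) f
        (Ridge.startingSet f L a))
      (fun n => √(Real.log n / (n * h n ^ 6))) ∧
    ((∀ x₀ ∈ Ridge.startingSet f L a, ∇ f (Ridge.path f x₀ (Ridge.theta f x₀)) = 0) →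
      Ridge.IsBigOInProbability P
        (fun n ω => Ridge.thetaDeviation (Ridge.kde K (h n) n fun i => X i ω) f
          (Ridge.startingSet f L a))
        (fun n => √(Real.log n / (n * h n ^ 5)))) ∧
    Tendsto
      (fun n => P {ω | ¬ ∀ x₀ ∈ Ridge.startingSet f L a,
        ∃! t, Ridge.IsArgminAbs
          (Ridge.filamentTimes (Ridge.kde K (h n) n fun i => X i ω) x₀) t})
      atTop (𝓝 0) := by
  obtain ⟨M, hM⟩ := Ridge.exists_withHighProbability_theta hX hh hf hH hK hL
  refine ⟨?_, fun hgrad => ?_, hM.mono (Eventually.of_forall fun n ω hω => hω.1)⟩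
  · exact Ridge.WithHighProbability.isBigOInProbability (M := M) (fun n => Real.sqrt_nonneg _)
      (hM.mono (Eventually.of_forall fun n ω hω => Ridge.thetaDeviation_le hω.2.1))
  · exact Ridge.WithHighProbability.isBigOInProbability (M := M) (fun n => Real.sqrt_nonneg _)
      (hM.mono (Eventually.of_forall fun n ω hω => Ridge.thetaDeviation_le (hω.2.2 hgrad)))
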